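/- Let $f(x)=a+bx+\int_{(0,\infty)}(1-e^{-xs})\,\overline\nu(ds)$, $x>0$, be a Bernstein function, where $a,b\ge 0$ and $\overline\nu$ is a measure on $(0,\infty)$ with $\int_{(0,\infty)}(s\wedge 1)\,\overline\nu(ds)<\infty$, and let $\nu(s)=a+\overline\nu((s,\infty))$, $s>0$. Assume that $\overline\nu((0,\infty))=\infty$ and that $\nu$ is absolutely continuous on every compact subinterval of $(0,\infty)$. Let $H^f$ be a subordinator (with values in $[0,\infty]$; it is killed if $a>0$) with $\mathbb E e^{-xH^f(t)}=e^{-tf(x)}$ for $x>0$, $t\ge0$, and let $Y^f(t)=\inf\{s\ge 0: H^f(s)>t\}$ be its inverse. Let $N$ be a Poisson process with rate $\lambda>0$ independent of $Y^f$. For a function $u$ on $[0,\infty)$ that is absolutely continuous on compact intervals put $$\mathcal D^f_t u(t)=b\,\frac{d}{dt}u(t)+\int_0^t \frac{\partial}{\partial t}u(t-s)\,\nu(s)\,ds .$$ Then for every $t>0$ the random variable $Y^f(t)$ has a density $\ell_f(t,\cdot)$; put $\tilde\ell_f(t,q)=\int_0^\infty e^{-qx}\ell_f(t,x)\,dx$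 for $q>0$. Moreover: 1. The probabilities $p_k^f(t)=P\{N(Y^f(t))=k\}$, $k=0,1,2,\dots$, are absolutely continuous on compact subintervals of $[0,\infty)$; for every $t>0$ the integral in $\mathcal D^f_t p^f_k(t)$ converges absolutely, $p_k^f$ is differentiable at $t$ if $b>0$, and $$\mathcal D^f_t p_k^f(t)=-\lambda\bigl(p_k^f(t)-p_{k-1}^f(t)\bigr),\qquad p_{-1}^f:=0 .$$ The initial conditions are $p_0^f(0)=1$ and $p_k^f(0)=0$ for $k\ge1$. 2. For every $t>0$ the function $q\mapsto\tilde\ell_f(t,q)$ is infinitely differentiable on $(0,\infty)$, and for every $k\ge 0$ $$p_k^f(t)=\frac{(-\lambda)^k}{k!}\,\frac{\partial^k}{\partial\lambda^k}\tilde\ell_f(t,\lambda).$$ 3. For every real $u$ with $|u|<1$ the probability generating function $G^f(u,t)=\mathbb E\,u^{N(Y^f(t))}$ satisfies $G^f(u,t)=\tilde\ell_f(t,\lambda(1-u))$ for $t>0$; as a function of $t$ it has the regularity stated for $p_k^f$ in 1, and $$\mathcal D^f_t G^f(u,t)=-\lambda(1-u)\,G^f(u,t)\quad (t>0),\qquad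 G^f(u,0)=1 .$$ -/

import Mathlib

open MeasureTheory ProbabilityTheory Set
open scoped NNReal ENNReal

namespace InverseSubordinator

/-- `ν` is a Lévy measure of a Bernstein function: it is carried by `(0, ∞)` and
`∫ min(s, 1) ν(ds) < ∞`. -/
structure IsLevyMeasure (ν : Measure ℝ) : Prop where
  nonpos_null : ν (Iic 0) = 0
  lintegral_lt_top : ∫⁻ s, ENNReal.ofReal (min s 1) ∂ν < ∞

/-- The Bernstein function `f(x) = a + b x + ∫_{(0,∞)} (1 - e^{-xs}) ν(ds)`. -/
noncomputable def bernstein (a b : ℝ) (ν : Measure ℝ) (x : ℝ) : ℝ :=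
  a + b * x + ∫ s in Ioi (0 : ℝ), (1 - Real.exp (-(x * s))) ∂ν

/-- The tail `s ↦ a + ν((s, ∞))`. -/
noncomputable def levyTail (a : ℝ) (ν : Measure ℝ) (s : ℝ) : ℝ :=
  a + ν.real (Ioi s)

/-- Infinite activity, and absolute continuity of the tail on `(0, ∞)`
(that is, on every compact subinterval; the tail is unbounded at `0`). -/
structure ConditionI (a : ℝ) (ν : Measure ℝ) : Prop where
  infinite : ν (Ioi 0) = ∞
  tail_ac : ∀ c d : ℝ, 0 < c → c ≤ d → AbsolutelyContinuousOnInterval (levyTail a ν) c d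

/-- The convolution-type (generalized Caputo–Djrbashian) derivative
`b u'(t) + ∫_0^t ∂_t u(t - s) κ(s) ds` with drift `b` and tail `κ`. -/
noncomputable def convDeriv (b : ℝ) (κ : ℝ → ℝ) (u : ℝ → ℝ) (t : ℝ) : ℝ :=
  b * deriv u t + ∫ s in (0 : ℝ)..t, deriv (fun r => u (r - s)) t * κ s

/-- The convolution-type derivative of `u` is meaningful at every `t > 0`: `u` is absolutely
continuous on compact intervals of `[0, ∞)`, the local term exists if it is present, and the
integral converges absolutely. -/
structure ConvDifferentiable (b : ℝ) (κ : ℝ → ℝ) (u : ℝ → ℝ) : Prop where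
  ac : ∀ T : ℝ, 0 ≤ T → AbsolutelyContinuousOnInterval u 0 T
  local_term : b ≠ 0 → ∀ t : ℝ, 0 < t → DifferentiableAt ℝ u t
  integral_term : ∀ t : ℝ, 0 < t →
    IntervalIntegrable (fun s => deriv (fun r => u (r - s)) t * κ s) volume 0 t

section Processes

variable {Ω : Type*} [MeasurableSpace Ω]

/-- A (possibly killed) subordinator: a nondecreasing right-continuous process with values in
`[0, ∞]` started at `0` such that, for all `s` and `t`, on the event `H s < ∞` the increment
`H (s + t) - H s` is independent of the past up to time `s` and has the law of `H t`.
The value `∞` is the state after killing. -/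
structure IsSubordinator (H : ℝ≥0 → Ω → ℝ≥0∞) (P : Measure Ω) : Prop where
  measurable : ∀ t, Measurable (H t)
  zero : ∀ᵐ ω ∂P, H 0 ω = 0
  mono : ∀ᵐ ω ∂P, Monotone fun t => H t ω
  right_cont : ∀ᵐ ω ∂P, ∀ t, ContinuousWithinAt (fun s => H s ω) (Ici t) t
  increments : ∀ (s t : ℝ≥0) (A : Set Ω) (B : Set ℝ≥0∞),
    MeasurableSet[⨆ r : Iic s, MeasurableSpace.comap (H r) inferInstance] A →
    MeasurableSet B →
    P ({ω | H s ω < ∞} ∩ A ∩ {ω | H (s + t) ω - H s ω ∈ B}) =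
      P ({ω | H s ω < ∞} ∩ A) * P {ω | H t ω ∈ B}

/-- `E e^{-x H(t)} = e^{-t f(x)}` for `x > 0`, where `e^{-x ∞} = 0`. -/
def HasLaplaceExponent (H : ℝ≥0 → Ω → ℝ≥0∞) (f : ℝ → ℝ) (P : Measure Ω) : Prop :=
  ∀ (t : ℝ≥0) (x : ℝ), 0 < x →
    ∫ ω, (if H t ω = ∞ then 0 else Real.exp (-(x * (H t ω).toReal))) ∂P =
      Real.exp (-(t * f x))

/-- The inverse process `Y(t) = inf {s ≥ 0 : H(s) > t}`. -/
noncomputable def inverse (H : ℝ≥0 → Ω → ℝ≥0∞) (t : ℝ) (ω : Ω) : ℝ≥0 :=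
  sInf {s : ℝ≥0 | ENNReal.ofReal t < H s ω}

/-- A (homogeneous) Poisson process with rate `lam`. -/
structure IsPoissonProcess (N : ℝ≥0 → Ω → ℕ) (lam : ℝ≥0) (P : Measure Ω) : Prop where
  measurable : ∀ t, Measurable (N t)
  zero : ∀ᵐ ω ∂P, N 0 ω = 0
  mono : ∀ᵐ ω ∂P, Monotone fun t => N t ω
  right_cont : ∀ᵐ ω ∂P, ∀ t, ContinuousWithinAt (fun s => N s ω) (Ici t) t
  indep_increments : HasIndepIncrements N P
  increments_law : ∀ s t : ℝ≥0,
    P.map (fun ω => N (s + t) ω - N s ω) = poissonMeasure (lam * t)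

/-- The density `ℓ(t, x) = P{Y(t) ∈ dx}/dx` of the inverse process. -/
noncomputable def density (H : ℝ≥0 → Ω → ℝ≥0∞) (P : Measure Ω) (t x : ℝ) : ℝ :=
  (pdf (fun ω => (inverse H t ω : ℝ)) P volume x).toReal

/-- The Laplace transform `∫_0^∞ e^{-q x} ℓ(t, x) dx` of the density in the space variable. -/
noncomputable def densityLaplace (H : ℝ≥0 → Ω → ℝ≥0∞) (P : Measure Ω) (t q : ℝ) : ℝ :=
  ∫ x in Ioi (0 : ℝ), Real.exp (-(q * x)) * density H P t x

/-- The marginal probability `P{N(Y(t)) = k}`. -/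
noncomputable def prob (N : ℝ≥0 → Ω → ℕ) (H : ℝ≥0 → Ω → ℝ≥0∞) (P : Measure Ω)
    (k : ℕ) (t : ℝ) : ℝ :=
  P.real {ω | N (inverse H t ω) ω = k}

/-- The probability generating function `E u^{N(Y(t))}`. -/
noncomputable def pgf (N : ℝ≥0 → Ω → ℕ) (H : ℝ≥0 → Ω → ℝ≥0∞) (P : Measure Ω)
    (u t : ℝ) : ℝ :=
  ∫ ω, u ^ N (inverse H t ω) ω ∂P

end Processes

end InverseSubordinator

/-! ### Uniqueness of Laplace transforms for measures on [0, ∞). -/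

namespace InverseSubordinator

open Filter Topology

/-! Write w_k(y) = e^{-λy}(λy)^k/k!. Conditioning on the independent time gives p_k(t) = E
w_k(Y(t)). Since w_k' = -λ(w_k - w_{k-1}), and since Y(t) > y means H(y) ≤ t up to a null event,
integrating out gives p_k(t) = w_k(0) - λ(U_k[0,t] - U_{k-1}[0,t]), where U_k = ∫_0^∞ w_k(y) P{H(y)
∈ ·} dy is a potential measure (`integral_poissonWeight_inverse`). If U_k has density v_k, then p_k
is absolutely continuous with derivative -λ(v_k - v_{k-1}), and the equation reduces to the renewal
equation b v_k + v_k ∗ ν = E w_k(Y(·)).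

As an identity of measures the renewal equation is a comparison of Laplace transforms: b δ_0 +
ν(s)ds has transform f(x)/x (`laplace_tailDensity`), and at an independent exponential time of rate
x the inverse is exponential of rate f(x) (`bind_exp_eq`). This yields the equation at almost every
t, while the theorem asks for every t > 0. If b > 0, the density is bounded, its convolution with
the tail is continuous, and the equation can be solved for a continuous version of the density. If b
= 0, the density may be unbounded and two inequalities are needed. Fatou's lemma gives v ∗ ν ≤ E
w(Y) (`potentialTail_le`). The converse (`le_potentialTail`) uses that U almost dominates its
translate by the law of H(s), up to a factor e^{-qs}; this law is absolutely continuous, so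
averaging over it makes the almost everywhere equation usable, and s → 0 finishes.

Absolute continuity of the law μ of H(s) comes from differentiating e^{-sf}: t μ(dt) = s b μ(dt) + s
(r ν(dr) ∗ μ)(dt). The convolution is absolutely continuous, so a singular part of μ could only sit
at the point s b, and infinite activity excludes an atom there (`absolutelyContinuous_of_laplace`).
For Y(t), the exponential time argument shows that a null set is not charged at almost every time;
restarting at level s, with the absolutely continuous time t - H(s), extends this to all times
(`inverse_absolutelyContinuous`).

The density's Laplace transform is the moment generating function of Y(t) at -q, whose derivatives
give the p_k. The generating function is E e^{-λ(1-u)Y(t)}, hence the case k = 0 at rate λ(1-u). -/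

/-- A bounded strictly decreasing continuous function that equals `e^{-t}` for `t ≥ 0`. -/
noncomputable def expBounded : BoundedContinuousFunction ℝ ℝ :=
  BoundedContinuousFunction.ofNormedAddCommGroup
    (fun t : ℝ => if 0 ≤ t then Real.exp (-t) else 2 - Real.exp t)
    (by
      refine Continuous.if_le (by fun_prop) (by fun_prop) (by fun_prop) (by fun_prop) ?_
      intro x hx
      subst hx
      norm_num) 2
    (by
      intro t
      split_ifs with h
      · rw [Real.norm_eq_abs, abs_of_pos (Real.exp_pos _)]
        linarith [Real.exp_le_one_iff.2 (neg_nonpos.2 h)]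
      · push Not at h
        have := Real.exp_le_one_iff.2 h.le
        rw [Real.norm_eq_abs, abs_of_nonneg] <;> linarith [Real.exp_pos t])

lemma expBounded_of_nonneg {t : ℝ} (h : 0 ≤ t) : expBounded t = Real.exp (-t) := by
  change (if 0 ≤ t then Real.exp (-t) else 2 - Real.exp t) = _
  rw [if_pos h]

lemma expBounded_of_neg {t : ℝ} (h : t < 0) : expBounded t = 2 - Real.exp t := by
  change (if 0 ≤ t then Real.exp (-t) else 2 - Real.exp t) = _
  rw [if_neg (not_le.2 h)]

lemma expBounded_injective : Function.Injective expBounded := by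
  refine StrictAnti.injective fun s t hst => ?_
  rcases lt_or_ge s 0 with hs | hs
  · rw [expBounded_of_neg hs]
    rcases lt_or_ge t 0 with ht | ht
    · rw [expBounded_of_neg ht]
      linarith [Real.exp_lt_exp.2 hst]
    · rw [expBounded_of_nonneg ht]
      linarith [Real.exp_le_one_iff.2 (neg_nonpos.2 ht), Real.exp_lt_exp.2 hs, Real.exp_zero]
  · rw [expBounded_of_nonneg hs, expBounded_of_nonneg (hs.trans hst.le)]
    exact Real.exp_lt_exp.2 (neg_lt_neg hst)

/-- A finite measure on `[0, ∞)` is determined by the integrals of `e^{-nt}`. -/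
theorem ext_of_integral_exp_neg_nat {μ₁ μ₂ : Measure ℝ} [IsFiniteMeasure μ₁] [IsFiniteMeasure μ₂]
    (h₁ : μ₁ (Iio 0) = 0) (h₂ : μ₂ (Iio 0) = 0)
    (h : ∀ n : ℕ, ∫ t, Real.exp (-(n * t)) ∂μ₁ = ∫ t, Real.exp (-(n * t)) ∂μ₂) : μ₁ = μ₂ := by
  have hpow : ∀ (μ : Measure ℝ), μ (Iio 0) = 0 → ∀ n : ℕ,
      ∫ t, (expBounded t) ^ n ∂μ = ∫ t, Real.exp (-(n * t)) ∂μ := by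
    intro μ hμ n
    have hae : ∀ᵐ t ∂μ, 0 ≤ t := by
      rw [ae_iff]
      simpa [Iio_def] using hμ
    refine integral_congr_ae ?_
    filter_upwards [hae] with t ht
    rw [expBounded_of_nonneg ht, ← Real.exp_nat_mul]
    ring_nf
  let A : StarSubalgebra ℝ (BoundedContinuousFunction ℝ ℝ) :=
    { Algebra.adjoin ℝ {expBounded} with
      star_mem' := by
        intro a ha
        have : star a = a := by
          ext x
          simp
        rw [this]
        exact ha }
  -- It suffices to compare integrals over a star subalgebra of bounded continuous functions that
  -- separates points. The separation is required on all of ℝ, hence the injective continuation of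
  -- e^{-t} to negative t.
  refine ext_of_forall_mem_subalgebra_integral_eq_of_pseudoEMetric_complete_countable
    (𝕜 := ℝ) (A := A) ?_ ?_
  · intro x y hxy
    refine ⟨expBounded, ⟨BoundedContinuousFunction.toContinuousMapStarₐ ℝ expBounded, ?_, rfl⟩,
      expBounded_injective.ne hxy⟩
    exact ⟨expBounded, Algebra.self_mem_adjoin_singleton ℝ expBounded, rfl⟩
  · intro g hg
    have hg' : g ∈ Algebra.adjoin ℝ {expBounded} := hg
    rw [Algebra.adjoin_singleton_eq_range_aeval] at hg'
    obtain ⟨p, rfl⟩ := hg'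
    change ∫ x, (Polynomial.aeval expBounded p) x ∂μ₁ = ∫ x, (Polynomial.aeval expBounded p) x ∂μ₂
    induction p using Polynomial.induction_on' with
    | add p q hp hq =>
      have hp' := hp (by change _ ∈ Algebra.adjoin ℝ {expBounded}
                         rw [Algebra.adjoin_singleton_eq_range_aeval]; exact ⟨p, rfl⟩)
      have hq' := hq (by change _ ∈ Algebra.adjoin ℝ {expBounded}
                         rw [Algebra.adjoin_singleton_eq_range_aeval]; exact ⟨q, rfl⟩)
      simp only [map_add, BoundedContinuousFunction.add_apply]
      rw [integral_add (BoundedContinuousFunction.integrable _ _)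
        (BoundedContinuousFunction.integrable _ _),
        integral_add (BoundedContinuousFunction.integrable _ _)
        (BoundedContinuousFunction.integrable _ _), hp', hq']
    | monomial n a =>
      have : ∀ x, (Polynomial.aeval expBounded (Polynomial.monomial n a)) x
          = a * (expBounded x) ^ n := by
        intro x
        rw [Polynomial.aeval_monomial, BoundedContinuousFunction.mul_apply,
          BoundedContinuousFunction.algebraMap_apply]
        simp
      simp only [this, integral_const_mul]
      rw [hpow μ₁ h₁, hpow μ₂ h₂, h n]

/-- The Laplace transform of a measure on the line, with values in `[0, ∞]`. -/
noncomputable def laplace (μ : Measure ℝ) (x : ℝ) : ℝ≥0∞ :=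
  ∫⁻ t, ENNReal.ofReal (Real.exp (-(x * t))) ∂μ

/-- Measures on `[0, ∞)` are determined by a finite Laplace transform on `(0, ∞)`. -/
theorem ext_of_laplace {μ₁ μ₂ : Measure ℝ} (h₁ : μ₁ (Iio 0) = 0) (h₂ : μ₂ (Iio 0) = 0)
    (h : ∀ x, 0 < x → laplace μ₁ x = laplace μ₂ x) (hfin : ∀ x, 0 < x → laplace μ₁ x ≠ ∞) :
    μ₁ = μ₂ := by
  -- Tilting by e^{-t} makes both measures finite and turns integrals of e^{-nt} into Laplace
  -- transforms at n + 1. The tilt is invertible.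
  set d : ℝ → ℝ≥0∞ := fun t => ENNReal.ofReal (Real.exp (-t)) with hd
  have hdm : Measurable d := by fun_prop
  have hinv : ∀ μ : Measure ℝ, (μ.withDensity d).withDensity d⁻¹ = μ := fun μ =>
    withDensity_inv_same hdm (by simp [hd, Real.exp_pos]) (by simp [hd])
  have hfinm : ∀ μ : Measure ℝ, laplace μ 1 ≠ ∞ → IsFiniteMeasure (μ.withDensity d) := by
    intro μ hμ
    refine isFiniteMeasure_withDensity ?_
    simpa [laplace, hd] using hμ
  have h1 := hfinm μ₁ (hfin 1 one_pos)
  have h2 := hfinm μ₂ (h 1 one_pos ▸ hfin 1 one_pos)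
  have key : ∀ (μ : Measure ℝ) (n : ℕ), ∫ t, Real.exp (-(n * t)) ∂(μ.withDensity d)
      = (laplace μ (n + 1)).toReal := by
    intro μ n
    rw [integral_eq_lintegral_of_nonneg_ae (ae_of_all _ fun t => (Real.exp_pos _).le)
      (by fun_prop), lintegral_withDensity_eq_lintegral_mul _ hdm (by fun_prop), laplace]
    congr 1
    refine lintegral_congr fun t => ?_
    simp only [Pi.mul_apply, hd]
    rw [← ENNReal.ofReal_mul (Real.exp_pos _).le, ← Real.exp_add]
    ring_nf
  have : μ₁.withDensity d = μ₂.withDensity d := by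
    refine ext_of_integral_exp_neg_nat (withDensity_absolutelyContinuous _ _ h₁)
      (withDensity_absolutelyContinuous _ _ h₂) fun n => ?_
    rw [key, key, h _ (by positivity)]
  rw [← hinv μ₁, ← hinv μ₂, this]

lemma laplace_conv (μ₁ μ₂ : Measure ℝ) [SFinite μ₂] (x : ℝ) :
    laplace (μ₁ ∗ μ₂) x = laplace μ₁ x * laplace μ₂ x := by
  unfold laplace
  rw [Measure.lintegral_conv (by fun_prop), ← lintegral_mul_const _ (by fun_prop)]
  refine lintegral_congr fun s => ?_
  rw [← lintegral_const_mul _ (by fun_prop)]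
  refine lintegral_congr fun t => ?_
  rw [← ENNReal.ofReal_mul (Real.exp_pos _).le, ← Real.exp_add]
  ring_nf

lemma laplace_add (μ₁ μ₂ : Measure ℝ) (x : ℝ) :
    laplace (μ₁ + μ₂) x = laplace μ₁ x + laplace μ₂ x := by
  simp [laplace, lintegral_add_measure]

lemma laplace_smul (c : ℝ≥0∞) (μ : Measure ℝ) (x : ℝ) :
    laplace (c • μ) x = c * laplace μ x := by
  simp [laplace, lintegral_smul_measure]

lemma conv_Iio_zero {μ₁ μ₂ : Measure ℝ} [SFinite μ₂] (h₁ : μ₁ (Iio 0) = 0)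
    (h₂ : μ₂ (Iio 0) = 0) : (μ₁ ∗ μ₂) (Iio 0) = 0 := by
  have a1 : ∀ᵐ t ∂μ₁, 0 ≤ t := by rw [ae_iff]; simpa [Iio_def] using h₁
  rw [← lintegral_indicator_one measurableSet_Iio, Measure.lintegral_conv
    (measurable_one.indicator measurableSet_Iio), lintegral_eq_zero_iff' ?_]
  · filter_upwards [a1] with s hs
    refine le_antisymm ?_ zero_le
    calc ∫⁻ y, (Iio 0).indicator (1 : ℝ → ℝ≥0∞) (s + y) ∂μ₂
        ≤ ∫⁻ y, (Iio 0).indicator (1 : ℝ → ℝ≥0∞) y ∂μ₂ := by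
          refine lintegral_mono fun y => ?_
          by_cases hy : s + y < 0
          · have : y < 0 := by linarith
            simp [indicator, hy, this]
          · simp [indicator, hy]
      _ = 0 := by rw [lintegral_indicator_one measurableSet_Iio, h₂]
  · exact (Measurable.lintegral_prod_right'
      (f := fun p : ℝ × ℝ => (Iio 0).indicator (1 : ℝ → ℝ≥0∞) (p.1 + p.2))
      ((measurable_one.indicator measurableSet_Iio).comp measurable_add)).aemeasurable

end InverseSubordinator

/-! ### Lévy measures, Bernstein functions and the tail. -/

namespace InverseSubordinator

open Filter Topology

lemma lintegral_exp_neg_mul_Ioi {x : ℝ} (hx : 0 < x) (c : ℝ) :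
    ∫⁻ t in Ioi c, ENNReal.ofReal (Real.exp (-(x * t))) =
      ENNReal.ofReal (Real.exp (-(x * c)) / x) := by
  have h1 := integrableOn_exp_mul_Ioi (neg_lt_zero.2 hx) c
  have h2 := integral_exp_mul_Ioi (neg_lt_zero.2 hx) c
  simp only [neg_mul] at h1 h2
  rw [← ofReal_integral_eq_lintegral_ofReal h1 (ae_of_all _ fun t => (Real.exp_pos _).le), h2]
  congr 1
  field_simp

section LevyMeasure

variable {ν : Measure ℝ}

lemma IsLevyMeasure.ae_pos (hν : IsLevyMeasure ν) : ∀ᵐ s ∂ν, 0 < s := by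
  rw [ae_iff]
  simpa [Iic_def] using hν.nonpos_null

lemma IsLevyMeasure.restrict_Ioi (hν : IsLevyMeasure ν) : ν.restrict (Ioi 0) = ν :=
  Measure.restrict_eq_self_of_ae_mem hν.ae_pos

lemma IsLevyMeasure.integrable_min (hν : IsLevyMeasure ν) :
    Integrable (fun s => min s 1) ν := by
  refine ⟨by fun_prop, ?_⟩
  rw [hasFiniteIntegral_iff_ofReal]
  · exact hν.lintegral_lt_top
  · filter_upwards [hν.ae_pos] with s hs
    exact le_min hs.le zero_le_one

lemma IsLevyMeasure.measure_Ioi_lt_top (hν : IsLevyMeasure ν) {c : ℝ} (hc : 0 < c) :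
    ν (Ioi c) < ∞ := by
  have h := mul_meas_ge_le_lintegral₀ (μ := ν)
    (f := fun s => ENNReal.ofReal (min s 1)) (by fun_prop) (ENNReal.ofReal (min c 1))
  have hlt := h.trans_lt hν.lintegral_lt_top
  have hpos : ENNReal.ofReal (min c 1) ≠ 0 := by simp [hc]
  refine lt_of_le_of_lt (measure_mono ?_) (ENNReal.lt_top_of_mul_ne_top_right hlt.ne hpos)
  intro s hs
  exact ENNReal.ofReal_le_ofReal (min_le_min_right 1 (le_of_lt hs))

/-- The measure min(s, 1) ν(ds) is finite and its density is positive almost everywhere, so dividing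
by it recovers ν. -/
lemma IsLevyMeasure.sFinite (hν : IsLevyMeasure ν) : SFinite ν := by
  set d : ℝ → ℝ≥0∞ := fun s => ENNReal.ofReal (min s 1) with hd
  have : IsFiniteMeasure (ν.withDensity d) := isFiniteMeasure_withDensity hν.lintegral_lt_top.ne
  have h : (ν.withDensity d).withDensity d⁻¹ = ν := by
    refine withDensity_inv_same₀ (by fun_prop) ?_ (by simp [hd])
    filter_upwards [hν.ae_pos] with s hs
    simp [hd, hs]
  rw [← h]
  infer_instance

lemma one_sub_exp_nonneg {x s : ℝ} (hx : 0 ≤ x) (hs : 0 ≤ s) : 0 ≤ 1 - Real.exp (-(x * s)) := by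
  have : Real.exp (-(x * s)) ≤ 1 := Real.exp_le_one_iff.2 (by nlinarith)
  linarith

lemma one_sub_exp_le {x s : ℝ} (hs : 0 ≤ s) :
    1 - Real.exp (-(x * s)) ≤ max x 1 * min s 1 := by
  have h1 : 1 - Real.exp (-(x * s)) ≤ 1 := by linarith [Real.exp_pos (-(x * s))]
  have h2 : 1 - Real.exp (-(x * s)) ≤ x * s := by linarith [Real.add_one_le_exp (-(x * s))]
  rcases le_total s 1 with h | h
  · rw [min_eq_left h]
    exact h2.trans (mul_le_mul_of_nonneg_right (le_max_left _ _) hs)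
  · rw [min_eq_right h, mul_one]
    exact h1.trans (le_max_right _ _)

lemma IsLevyMeasure.integrable_one_sub_exp (hν : IsLevyMeasure ν) {x : ℝ} (hx : 0 ≤ x) :
    Integrable (fun s => 1 - Real.exp (-(x * s))) ν := by
  refine (hν.integrable_min.const_mul (max x 1)).mono' (by fun_prop) ?_
  filter_upwards [hν.ae_pos] with s hs
  rw [Real.norm_eq_abs, abs_of_nonneg (one_sub_exp_nonneg hx hs.le)]
  exact one_sub_exp_le hs.le

lemma IsLevyMeasure.bernstein_eq (hν : IsLevyMeasure ν) (a b x : ℝ) :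
    bernstein a b ν x = a + b * x + ∫ s, (1 - Real.exp (-(x * s))) ∂ν := by
  rw [bernstein, hν.restrict_Ioi]

lemma IsLevyMeasure.integral_one_sub_exp_nonneg (hν : IsLevyMeasure ν) {x : ℝ} (hx : 0 ≤ x) :
    0 ≤ ∫ s, (1 - Real.exp (-(x * s))) ∂ν := by
  refine integral_nonneg_of_ae ?_
  filter_upwards [hν.ae_pos] with s hs
  exact one_sub_exp_nonneg hx hs.le

lemma IsLevyMeasure.ofReal_integral_one_sub_exp (hν : IsLevyMeasure ν) {x : ℝ} (hx : 0 ≤ x) :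
    ENNReal.ofReal (∫ s, (1 - Real.exp (-(x * s))) ∂ν) =
      ∫⁻ s, ENNReal.ofReal (1 - Real.exp (-(x * s))) ∂ν := by
  refine ofReal_integral_eq_lintegral_ofReal (hν.integrable_one_sub_exp hx) ?_
  filter_upwards [hν.ae_pos] with s hs
  exact one_sub_exp_nonneg hx hs.le

/-- For infinite activity the jump part of the exponent tends to infinity. -/
lemma IsLevyMeasure.tendsto_integral_one_sub_exp (hν : IsLevyMeasure ν) (hinf : ν (Ioi 0) = ∞) :
    Tendsto (fun x : ℝ => ∫ s, (1 - Real.exp (-(x * s))) ∂ν) atTop atTop := by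
  have hlim : Tendsto (fun x : ℕ => ∫⁻ s, ENNReal.ofReal (1 - Real.exp (-(x * s))) ∂ν) atTop
      (𝓝 (∫⁻ _, 1 ∂ν)) := by
    refine lintegral_tendsto_of_tendsto_of_monotone (fun n => by fun_prop) ?_ ?_
    · filter_upwards [hν.ae_pos] with s hs
      intro m n hmn
      refine ENNReal.ofReal_le_ofReal ?_
      have : Real.exp (-((n : ℝ) * s)) ≤ Real.exp (-(m * s)) := by
        rw [Real.exp_le_exp]
        have : (m : ℝ) ≤ n := by exact_mod_cast hmn
        nlinarith
      linarith
    · filter_upwards [hν.ae_pos] with s hs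
      have : Tendsto (fun n : ℕ => 1 - Real.exp (-((n : ℝ) * s))) atTop (𝓝 (1 - 0)) := by
        refine tendsto_const_nhds.sub (Real.tendsto_exp_neg_atTop_nhds_zero.comp ?_)
        exact tendsto_natCast_atTop_atTop.atTop_mul_const hs
      simpa [Function.comp_def] using (ENNReal.continuous_ofReal.tendsto _).comp this
  have htop : ∫⁻ _, 1 ∂ν = ∞ := by
    rw [lintegral_one, eq_top_iff, ← hinf]
    exact measure_mono (subset_univ _)
  rw [htop] at hlim
  rw [tendsto_atTop]
  intro M
  have hM := (tendsto_order.1 hlim).1 (ENNReal.ofReal M) ENNReal.ofReal_lt_top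
  obtain ⟨n, hn⟩ := hM.exists
  rw [← hν.ofReal_integral_one_sub_exp (Nat.cast_nonneg n)] at hn
  have hMn := (ENNReal.lt_ofReal_iff_toReal_lt ENNReal.ofReal_ne_top).1 hn
  filter_upwards [eventually_ge_atTop (n : ℝ)] with x hx
  have hx0 : 0 ≤ x := (Nat.cast_nonneg n).trans hx
  have hle : ∫ s, (1 - Real.exp (-((n : ℝ) * s))) ∂ν ≤ ∫ s, (1 - Real.exp (-(x * s))) ∂ν := by
    refine integral_mono_ae (hν.integrable_one_sub_exp (Nat.cast_nonneg n))
      (hν.integrable_one_sub_exp hx0) ?_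
    filter_upwards [hν.ae_pos] with s hs
    have : Real.exp (-(x * s)) ≤ Real.exp (-((n : ℝ) * s)) := by
      rw [Real.exp_le_exp]
      nlinarith
    linarith
  rw [ENNReal.toReal_ofReal'] at hMn
  exact (le_max_left M 0).trans (hMn.le.trans hle)

lemma IsLevyMeasure.bernstein_nonneg (hν : IsLevyMeasure ν) {a b x : ℝ} (ha : 0 ≤ a) (hb : 0 ≤ b)
    (hx : 0 ≤ x) : 0 ≤ bernstein a b ν x := by
  rw [hν.bernstein_eq]
  have := hν.integral_one_sub_exp_nonneg hx
  positivity

lemma IsLevyMeasure.bernstein_pos (hν : IsLevyMeasure ν) {a b x : ℝ} (ha : 0 ≤ a) (hb : 0 ≤ b)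
    (hinf : ν (Ioi 0) = ∞) (hx : 0 < x) : 0 < bernstein a b ν x := by
  rw [hν.bernstein_eq]
  have : 0 < ∫ s, (1 - Real.exp (-(x * s))) ∂ν := by
    rw [integral_pos_iff_support_of_nonneg_ae ?_ (hν.integrable_one_sub_exp hx.le)]
    · refine lt_of_lt_of_le ?_ (measure_mono (s := Ioi 0) ?_)
      · simp [hinf]
      · intro s hs
        have : Real.exp (-(x * s)) < 1 := by
          rw [← Real.exp_zero, Real.exp_lt_exp]
          have := mul_pos hx hs
          linarith
        exact (sub_pos.2 this).ne'
    · filter_upwards [hν.ae_pos] with s hs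
      exact one_sub_exp_nonneg hx.le hs.le
  positivity

lemma mul_exp_neg_le {x s : ℝ} (hx : 0 < x) (hs : 0 ≤ s) :
    s * Real.exp (-(x * s)) ≤ max 1 x⁻¹ * min s 1 := by
  have h1 : Real.exp (-(x * s)) ≤ 1 := Real.exp_le_one_iff.2 (by nlinarith)
  rcases le_total s 1 with h | h
  · rw [min_eq_left h]
    have : (1 : ℝ) ≤ max 1 x⁻¹ := le_max_left _ _
    have := Real.exp_pos (-(x * s))
    nlinarith
  · rw [min_eq_right h, mul_one]
    refine le_trans ?_ (le_max_right _ _)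
    have h2 : x * s ≤ Real.exp (x * s) := by linarith [Real.add_one_le_exp (x * s)]
    rw [Real.exp_neg, ← div_eq_mul_inv, div_le_iff₀ (Real.exp_pos _), inv_mul_eq_div,
      le_div_iff₀ hx]
    linarith

/-- Supplies both the derivative of the Bernstein function and, at x/2, the dominating function for
differentiating under the integral. -/
lemma IsLevyMeasure.integrable_mul_exp_neg (hν : IsLevyMeasure ν) {x : ℝ} (hx : 0 < x) :
    Integrable (fun s => s * Real.exp (-(x * s))) ν := by
  refine (hν.integrable_min.const_mul (max 1 x⁻¹)).mono' (by fun_prop) ?_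
  filter_upwards [hν.ae_pos] with s hs
  rw [Real.norm_eq_abs, abs_of_nonneg (mul_nonneg hs.le (Real.exp_pos _).le)]
  exact mul_exp_neg_le hx hs.le

lemma IsLevyMeasure.hasDerivAt_bernstein (hν : IsLevyMeasure ν) (a b : ℝ) {x : ℝ} (hx : 0 < x) :
    HasDerivAt (bernstein a b ν) (b + ∫ s, s * Real.exp (-(x * s)) ∂ν) x := by
  have h := hasDerivAt_integral_of_dominated_loc_of_deriv_le (μ := ν)
    (F := fun x s => 1 - Real.exp (-(x * s))) (F' := fun x s => s * Real.exp (-(x * s)))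
    (bound := fun s => s * Real.exp (-(x / 2 * s))) (x₀ := x) (s := Ioi (x / 2))
    (Ioi_mem_nhds (by linarith)) (Eventually.of_forall fun y => by fun_prop)
    (hν.integrable_one_sub_exp hx.le) (by fun_prop) ?_
    (hν.integrable_mul_exp_neg (half_pos hx)) ?_
  · have h2 : HasDerivAt (fun y => a + b * y) b x := by
      simpa using ((hasDerivAt_id x).const_mul b).const_add a
    have h3 := h2.add h.2
    refine h3.congr_of_eventuallyEq (Eventually.of_forall fun y => ?_)
    exact hν.bernstein_eq a b y
  · filter_upwards [hν.ae_pos] with s hs y hy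
    rw [Real.norm_eq_abs, abs_of_nonneg (mul_nonneg hs.le (Real.exp_pos _).le)]
    refine mul_le_mul_of_nonneg_left (Real.exp_le_exp.2 ?_) hs.le
    have : x / 2 * s ≤ y * s := mul_le_mul_of_nonneg_right (le_of_lt hy) hs.le
    linarith
  · refine ae_of_all _ fun s y _ => ?_
    have h1 : HasDerivAt (fun y : ℝ => -(y * s)) (-s) y := by
      simpa using ((hasDerivAt_id y).mul_const s).fun_neg
    simpa [mul_comm] using (h1.exp).const_sub 1

/-! ### The tail -/

lemma levyTail_nonneg {a : ℝ} (ha : 0 ≤ a) (ν : Measure ℝ) (s : ℝ) : 0 ≤ levyTail a ν s :=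
  add_nonneg ha measureReal_nonneg

/-- Monotonicity cannot extend to the origin in general: for an infinite measure `Measure.real`
takes the default value 0 there. -/
lemma IsLevyMeasure.antitoneOn_levyTail (hν : IsLevyMeasure ν) (a : ℝ) :
    AntitoneOn (levyTail a ν) (Ioi 0) := by
  intro s hs t _ hst
  refine add_le_add_right (measureReal_mono (Ioi_subset_Ioi hst) ?_) a
  exact (hν.measure_Ioi_lt_top hs).ne

lemma IsLevyMeasure.levyTail_sub (hν : IsLevyMeasure ν) (a : ℝ) {c d : ℝ} (hc : 0 < c)
    (hcd : c ≤ d) : levyTail a ν c - levyTail a ν d = ν.real (Ioc c d) := by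
  have h : ν.real (Ioc c d ∪ Ioi d) = ν.real (Ioc c d) + ν.real (Ioi d) :=
    measureReal_union (Set.Ioc_disjoint_Ioi le_rfl) measurableSet_Ioi
      ((measure_mono Ioc_subset_Ioi_self).trans_lt (hν.measure_Ioi_lt_top hc)).ne
      (hν.measure_Ioi_lt_top (hc.trans_le hcd)).ne
  rw [Ioc_union_Ioi_eq_Ioi hcd] at h
  rw [levyTail, levyTail, h]
  ring

lemma ConditionI.continuousAt {a : ℝ} (hI : ConditionI a ν) {s : ℝ} (hs : 0 < s) :
    ContinuousAt (levyTail a ν) s := by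
  have h := (hI.tail_ac (s / 2) (2 * s) (by linarith) (by linarith)).continuousOn
  rw [uIcc_of_le (by linarith)] at h
  exact h.continuousAt (Icc_mem_nhds (by linarith) (by linarith))

/-- By the fundamental theorem of calculus for absolutely continuous functions, ν(p, q] is the
integral of minus the derivative of the tail, and half-open intervals determine the measure. -/
lemma ConditionI.restrict_absolutelyContinuous {a : ℝ} (hI : ConditionI a ν)
    (hν : IsLevyMeasure ν) {c : ℝ} (hc : 0 < c) : ν.restrict (Ioi c) ≪ volume := by
  have hfin : IsFiniteMeasure (ν.restrict (Ioi c)) :=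
    isFiniteMeasure_restrict.2 (hν.measure_Ioi_lt_top hc).ne
  have hnonneg : ∀ s, 0 < s → 0 ≤ -deriv (levyTail a ν) s := by
    intro s hs
    have h := (hν.antitoneOn_levyTail a).derivWithin_nonpos (x := s)
    rw [derivWithin_of_mem_nhds (Ioi_mem_nhds hs)] at h
    linarith
  set g : ℝ → ℝ≥0∞ := fun s => ENNReal.ofReal (-deriv (levyTail a ν) s)
  have heq : ν.restrict (Ioi c) = (volume.restrict (Ioi c)).withDensity g := by
    refine Measure.ext_of_Ioc _ _ fun p q hpq => ?_
    rw [withDensity_apply _ measurableSet_Ioc, Measure.restrict_apply measurableSet_Ioc,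
      Measure.restrict_restrict measurableSet_Ioc, Ioc_inter_Ioi]
    rcases le_or_gt q (p ⊔ c) with h | h
    · simp [Ioc_eq_empty (not_lt.2 h)]
    · have hpc : 0 < p ⊔ c := hc.trans_le le_sup_right
      have hac := hI.tail_ac _ _ hpc h.le
      have h1 := hac.integral_deriv_eq_sub
      have h2 := hac.intervalIntegrable_deriv
      rw [intervalIntegral.integral_of_le h.le] at h1
      rw [intervalIntegrable_iff_integrableOn_Ioc_of_le h.le] at h2
      have h3 : IntegrableOn (fun s => -deriv (levyTail a ν) s) (Ioc (p ⊔ c) q) := h2.neg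
      rw [← ofReal_integral_eq_lintegral_ofReal h3 ?_]
      · rw [integral_neg, h1, neg_sub, hν.levyTail_sub a hpc h.le, ofReal_measureReal
            ((measure_mono Ioc_subset_Ioi_self).trans_lt (hν.measure_Ioi_lt_top hpc)).ne]
      · filter_upwards [ae_restrict_mem measurableSet_Ioc] with s hs
        exact hnonneg s (hpc.trans hs.1)
  rw [heq]
  exact (withDensity_absolutelyContinuous _ _).trans Measure.absolutelyContinuous_restrict

lemma ConditionI.absolutelyContinuous {a : ℝ} (hI : ConditionI a ν) (hν : IsLevyMeasure ν) :
    ν ≪ volume := by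
  refine Measure.AbsolutelyContinuous.mk fun B _ h0 => ?_
  have hcover : B ⊆ Iic 0 ∪ ⋃ n : ℕ, B ∩ Ioi (1 / ((n : ℝ) + 1)) := by
    intro s hs
    rcases le_or_gt s 0 with h | h
    · exact Or.inl h
    · obtain ⟨n, hn⟩ := exists_nat_one_div_lt h
      exact Or.inr (mem_iUnion.2 ⟨n, hs, hn⟩)
  refine measure_mono_null hcover (measure_union_null hν.nonpos_null (measure_iUnion_null fun n => ?_))
  rw [← Measure.restrict_apply' measurableSet_Ioi]
  exact hI.restrict_absolutelyContinuous hν (by positivity) h0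

/-- The density of the tail, as a function on the line that vanishes on `(-∞, 0]`. -/
noncomputable def tailDensity (a : ℝ) (ν : Measure ℝ) : ℝ → ℝ≥0∞ :=
  (Ioi (0 : ℝ)).indicator fun s => ENNReal.ofReal (levyTail a ν s)

lemma measurable_tailDensity (a : ℝ) (ν : Measure ℝ) :
    Measurable (tailDensity a ν) := by
  have hanti : Antitone fun s => ν (Ioi s) := fun s t hst => measure_mono (Ioi_subset_Ioi hst)
  have hm : Measurable fun s => ENNReal.ofReal (a + (ν (Ioi s)).toReal) :=
    ((hanti.measurable.ennreal_toReal).const_add a).ennreal_ofReal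
  exact hm.indicator measurableSet_Ioi

/-- The layer cake formula turns ∫ (1 - e^{-xs})/x ν(ds) into ∫_0^∞ e^{-xt} ν((t, ∞)) dt, and the
killing rate contributes a/x. Thus f(x)/x is the transform of b δ_0 plus the tail, the kernel of the
convolution-type derivative. -/
lemma IsLevyMeasure.laplace_tailDensity (hν : IsLevyMeasure ν) {a b x : ℝ} (ha : 0 ≤ a)
    (hb : 0 ≤ b) (hx : 0 < x) :
    ENNReal.ofReal b + laplace (volume.withDensity (tailDensity a ν)) x =
      ENNReal.ofReal (bernstein a b ν x / x) := by
  have hcake := lintegral_comp_eq_lintegral_meas_lt_mul ν (f := fun s => s)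
    (g := fun t => Real.exp (-(x * t))) (by filter_upwards [hν.ae_pos] with s hs using hs.le)
    (by fun_prop) (fun t _ => (by fun_prop : Continuous fun t => Real.exp (-(x * t))).intervalIntegrable _ _)
    (ae_of_all _ fun t => (Real.exp_pos _).le)
  have hint : ∀ s : ℝ, ∫ t in (0 : ℝ)..s, Real.exp (-(x * t)) = (1 - Real.exp (-(x * s))) / x := by
    intro s
    have := intervalIntegral.integral_comp_mul_left (f := fun t => Real.exp t) (a := 0) (b := s)
      (c := -x) (by linarith)
    simp only [neg_mul, integral_exp, smul_eq_mul, mul_zero, Real.exp_zero] at this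
    rw [this]
    field_simp
    ring
  simp only [hint] at hcake
  have h1 : laplace (volume.withDensity (tailDensity a ν)) x =
      ∫⁻ t in Ioi (0 : ℝ), (ENNReal.ofReal a * ENNReal.ofReal (Real.exp (-(x * t))) +
        ν {s | t < s} * ENNReal.ofReal (Real.exp (-(x * t)))) := by
    rw [laplace, lintegral_withDensity_eq_lintegral_mul _ (measurable_tailDensity a ν)
      (by fun_prop), ← lintegral_indicator measurableSet_Ioi]
    refine lintegral_congr fun t => ?_
    by_cases ht : t ∈ Ioi (0 : ℝ)
    · simp only [Pi.mul_apply, tailDensity, indicator_of_mem ht]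
      rw [levyTail, ENNReal.ofReal_add ha measureReal_nonneg,
        ofReal_measureReal (hν.measure_Ioi_lt_top ht).ne, add_mul]
      rfl
    · simp [tailDensity, indicator_of_notMem ht]
  have hI := hν.integral_one_sub_exp_nonneg hx.le
  rw [h1, lintegral_add_left (by fun_prop), ← hcake, lintegral_const_mul _ (by fun_prop),
    lintegral_exp_neg_mul_Ioi hx]
  have h2 : ∫⁻ s, ENNReal.ofReal ((1 - Real.exp (-(x * s))) / x) ∂ν =
      ENNReal.ofReal ((∫ s, (1 - Real.exp (-(x * s))) ∂ν) / x) := by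
    rw [ENNReal.ofReal_div_of_pos hx, hν.ofReal_integral_one_sub_exp hx.le, div_eq_mul_inv,
      ← lintegral_mul_const _ (by fun_prop)]
    refine lintegral_congr fun s => ?_
    rw [ENNReal.ofReal_div_of_pos hx, div_eq_mul_inv]
  rw [h2, hν.bernstein_eq, ← ENNReal.ofReal_mul ha, ← ENNReal.ofReal_add (by positivity)
    (by positivity), ← ENNReal.ofReal_add hb (by positivity)]
  congr 1
  simp only [mul_zero, neg_zero, Real.exp_zero]
  field_simp
  ring

lemma tailDensity_Iio_zero (a : ℝ) (ν : Measure ℝ) :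
    (volume.withDensity (tailDensity a ν)) (Iio 0) = 0 := by
  rw [withDensity_apply _ measurableSet_Iio, setLIntegral_eq_zero measurableSet_Iio]
  intro s hs
  exact indicator_of_notMem (notMem_Ioi.2 (le_of_lt hs)) _

end LevyMeasure

end InverseSubordinator

/-! ### Absolute continuity of the laws with Laplace transform e^{-sf}. -/

namespace InverseSubordinator

open Filter Topology

lemma integrable_exp_neg_mul {μ : Measure ℝ} [IsFiniteMeasure μ] (h0 : μ (Iio 0) = 0) {x : ℝ}
    (hx : 0 ≤ x) : Integrable (fun t => Real.exp (-(x * t))) μ := by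
  refine (integrable_const (1 : ℝ)).mono' (by fun_prop) ?_
  have hae : ∀ᵐ t ∂μ, 0 ≤ t := by rw [ae_iff]; simpa [Iio_def] using h0
  filter_upwards [hae] with t ht
  rw [Real.norm_eq_abs, abs_of_pos (Real.exp_pos _)]
  exact Real.exp_le_one_iff.2 (by nlinarith)

/-- This places -x where the moment generating function is analytic, so it may be differentiated any
number of times. -/
lemma neg_mem_interior_integrableExpSet {μ : Measure ℝ} [IsFiniteMeasure μ] (h0 : μ (Iio 0) = 0)
    {x : ℝ} (hx : 0 < x) : -x ∈ interior (integrableExpSet id μ) := by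
  refine mem_interior.2 ⟨Iio 0, fun y hy => ?_, isOpen_Iio, by simpa using hx⟩
  have := integrable_exp_neg_mul h0 (x := -y) (by linarith [mem_Iio.1 hy])
  simpa [integrableExpSet] using this

lemma ofReal_integral_exp_neg_mul {μ : Measure ℝ} [IsFiniteMeasure μ] (h0 : μ (Iio 0) = 0) {x : ℝ}
    (hx : 0 ≤ x) : ENNReal.ofReal (∫ t, Real.exp (-(x * t)) ∂μ) = laplace μ x :=
  ofReal_integral_eq_lintegral_ofReal (integrable_exp_neg_mul h0 hx)
    (ae_of_all _ fun _ => (Real.exp_pos _).le)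

section AbsolutelyContinuous

variable {ν μ : Measure ℝ} {a b s : ℝ}

/-- Differentiating the Laplace transform `e^{-s f}` of `μ` yields
`t μ(dt) = s b μ(dt) + s (r ν(dr) ∗ μ)(dt)`. -/
lemma withDensity_id_eq_of_laplace [IsFiniteMeasure μ] (hb : 0 ≤ b) (hν : IsLevyMeasure ν)
    (hs : 0 < s) (h0 : μ (Iio 0) = 0)
    (hL : ∀ x, 0 < x → laplace μ x = ENNReal.ofReal (Real.exp (-(s * bernstein a b ν x)))) :
    μ.withDensity ENNReal.ofReal = ENNReal.ofReal (s * b) • μ +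
      ENNReal.ofReal s • (μ ∗ ν.withDensity ENNReal.ofReal) := by
  have := hν.sFinite
  have hae : ∀ᵐ t ∂μ, 0 ≤ t := by rw [ae_iff]; simpa [Iio_def] using h0
  have hρ0 : (ν.withDensity ENNReal.ofReal) (Iio 0) = 0 :=
    withDensity_absolutelyContinuous _ _
      (measure_mono_null Iio_subset_Iic_self hν.nonpos_null)
  have hμL : ∀ x, 0 < x → laplace (μ.withDensity ENNReal.ofReal) x =
      ENNReal.ofReal (s * (b + ∫ r, r * Real.exp (-(x * r)) ∂ν) *
        Real.exp (-(s * bernstein a b ν x))) := by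
    intro x hx
    have hmem := neg_mem_interior_integrableExpSet h0 hx
    have hreal : ∀ y, 0 < y → mgf id μ (-y) = Real.exp (-(s * bernstein a b ν y)) := by
      intro y hy
      have h := (ofReal_integral_exp_neg_mul h0 hy.le).trans (hL y hy)
      rw [ENNReal.ofReal_eq_ofReal_iff (integral_nonneg fun _ => (Real.exp_pos _).le)
        (Real.exp_pos _).le] at h
      simpa [mgf] using h
    have hd1 : HasDerivAt (fun y => mgf id μ (-y))
        ((∫ t, t * Real.exp (-(x * t)) ∂μ) * (-1)) x := by
      have h := (hasDerivAt_mgf hmem).comp x (hasDerivAt_neg x)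
      simpa [Function.comp_def] using h
    have hd2 := (((hν.hasDerivAt_bernstein a b hx).const_mul s).fun_neg).exp
    have hd3 := hd2.congr_of_eventuallyEq (f₁ := fun y => mgf id μ (-y))
      (by filter_upwards [Ioi_mem_nhds hx] with y hy using hreal y hy)
    have heq := hd1.unique hd3
    have hint : Integrable (fun t => t * Real.exp (-(x * t))) μ := by
      simpa using integrable_pow_mul_exp_of_mem_interior_integrableExpSet hmem 1
    rw [laplace, lintegral_withDensity_eq_lintegral_mul _ (by fun_prop) (by fun_prop)]
    have : ∫⁻ t, ENNReal.ofReal (t * Real.exp (-(x * t))) ∂μ =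
        ENNReal.ofReal (∫ t, t * Real.exp (-(x * t)) ∂μ) := by
      refine (ofReal_integral_eq_lintegral_ofReal hint ?_).symm
      filter_upwards [hae] with t ht
      exact mul_nonneg ht (Real.exp_pos _).le
    have hval : ∫ t, t * Real.exp (-(x * t)) ∂μ =
        s * (b + ∫ r, r * Real.exp (-(x * r)) ∂ν) * Real.exp (-(s * bernstein a b ν x)) := by
      linear_combination (-1) * heq
    rw [← hval, ← this]
    refine lintegral_congr_ae ?_
    filter_upwards [hae] with t ht
    rw [Pi.mul_apply, ENNReal.ofReal_mul ht]
  have hρL : ∀ x, 0 < x → laplace (ν.withDensity ENNReal.ofReal) x =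
      ENNReal.ofReal (∫ r, r * Real.exp (-(x * r)) ∂ν) := by
    intro x hx
    rw [laplace, lintegral_withDensity_eq_lintegral_mul _ (by fun_prop) (by fun_prop),
      ofReal_integral_eq_lintegral_ofReal (hν.integrable_mul_exp_neg hx)]
    · refine lintegral_congr_ae ?_
      filter_upwards [hν.ae_pos] with t ht
      rw [Pi.mul_apply, ENNReal.ofReal_mul ht.le]
    · filter_upwards [hν.ae_pos] with t ht
      exact mul_nonneg ht.le (Real.exp_pos _).le
  refine ext_of_laplace (withDensity_absolutelyContinuous _ _ h0) ?_ (fun x hx => ?_)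
    (fun x hx => by rw [hμL x hx]; exact ENNReal.ofReal_ne_top)
  · simp [h0, conv_Iio_zero h0 hρ0]
  · have hnn : 0 ≤ ∫ r, r * Real.exp (-(x * r)) ∂ν := by
      refine integral_nonneg_of_ae ?_
      filter_upwards [hν.ae_pos] with t ht
      exact mul_nonneg ht.le (Real.exp_pos _).le
    rw [hμL x hx, laplace_add, laplace_smul, laplace_smul, laplace_conv, hL x hx, hρL x hx,
      ← ENNReal.ofReal_mul (Real.exp_pos _).le, ← ENNReal.ofReal_mul hs.le,
      ← ENNReal.ofReal_mul (by positivity), ← ENNReal.ofReal_add (by positivity) (by positivity)]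
    congr 1
    ring

/-- A finite measure with Laplace transform `e^{-s f}`, where the Lévy measure of `f` is infinite
and has an absolutely continuous tail, is absolutely continuous. -/
theorem absolutelyContinuous_of_laplace [IsFiniteMeasure μ] (ha : 0 ≤ a) (hb : 0 ≤ b)
    (hν : IsLevyMeasure ν) (hI : ConditionI a ν) (hs : 0 < s) (h0 : μ (Iio 0) = 0)
    (hL : ∀ x, 0 < x → laplace μ x = ENNReal.ofReal (Real.exp (-(s * bernstein a b ν x)))) :
    μ ≪ volume := by
  have := hν.sFinite
  have hsb : 0 ≤ s * b := by positivity
  have hid := withDensity_id_eq_of_laplace hb hν hs h0 hL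
  have hac : μ ∗ ν.withDensity ENNReal.ofReal ≪ volume :=
    Measure.conv_absolutelyContinuous
      ((withDensity_absolutelyContinuous _ _).trans (hI.absolutelyContinuous hν))
  -- On a Lebesgue null set the convolution term drops out, so t and the constant s b have equal
  -- integrals against μ.
  have hnull : ∀ B : Set ℝ, MeasurableSet B → volume B = 0 →
      ∫⁻ t in B, ENNReal.ofReal t ∂μ = ∫⁻ _ in B, ENNReal.ofReal (s * b) ∂μ := by
    intro B hB hB0
    rw [← withDensity_apply _ hB, hid]
    simp [hac hB0]
  have hfin : ∀ B : Set ℝ, ∫⁻ _ in B, ENNReal.ofReal (s * b) ∂μ ≠ ∞ := by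
    intro B
    rw [setLIntegral_const]
    exact ENNReal.mul_ne_top ENNReal.ofReal_ne_top (measure_ne_top _ _)
  -- The atom is at most e^{x s b} times the transform at x, hence at most exp(-s ∫ (1 - e^{-xr})
  -- ν(dr)), which tends to 0 as x → ∞ by infinite activity.
  have hatom : μ {s * b} = 0 := by
    have hle : ∀ x, 0 < x → μ {s * b} ≤
        ENNReal.ofReal (Real.exp (-(s * ∫ r, (1 - Real.exp (-(x * r))) ∂ν))) := by
      intro x hx
      have h1 : ENNReal.ofReal (Real.exp (-(x * (s * b)))) * μ {s * b} ≤ laplace μ x := by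
        calc ENNReal.ofReal (Real.exp (-(x * (s * b)))) * μ {s * b}
            = ∫⁻ t in {s * b}, ENNReal.ofReal (Real.exp (-(x * t))) ∂μ := by
              rw [lintegral_singleton]
          _ ≤ laplace μ x := setLIntegral_le_lintegral _ _
      have hJ := hν.integral_one_sub_exp_nonneg hx.le
      have h2 : μ {s * b} ≤ ENNReal.ofReal (Real.exp (x * (s * b))) * laplace μ x := by
        refine le_trans (le_of_eq ?_) (mul_le_mul_right h1 _)
        rw [← mul_assoc, ← ENNReal.ofReal_mul (Real.exp_pos _).le, ← Real.exp_add]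
        simp
      refine h2.trans ?_
      rw [hL x hx, ← ENNReal.ofReal_mul (Real.exp_pos _).le, ← Real.exp_add, hν.bernstein_eq]
      refine ENNReal.ofReal_le_ofReal (Real.exp_le_exp.2 ?_)
      nlinarith [mul_nonneg hs.le ha]
    have hlim : Tendsto (fun x : ℝ =>
        ENNReal.ofReal (Real.exp (-(s * ∫ r, (1 - Real.exp (-(x * r))) ∂ν)))) atTop (𝓝 0) := by
      have h := Real.tendsto_exp_neg_atTop_nhds_zero.comp
        ((hν.tendsto_integral_one_sub_exp hI.infinite).const_mul_atTop hs)
      simpa [Function.comp_def] using (ENNReal.continuous_ofReal.tendsto _).comp h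
    refine le_antisymm (ge_of_tendsto hlim ?_) zero_le
    filter_upwards [eventually_gt_atTop 0] with x hx using hle x hx
  refine Measure.AbsolutelyContinuous.mk fun B hB hB0 => ?_
  -- On either side of s b the two integrands are strictly ordered, so equality of their finite
  -- integrals forces mass zero.
  have h1 : μ (B ∩ Ioi (s * b)) = 0 := by
    by_contra hne
    have hm : MeasurableSet (B ∩ Ioi (s * b)) := hB.inter measurableSet_Ioi
    have hlt := setLIntegral_strict_mono hm hne (f := fun _ => ENNReal.ofReal (s * b))
      (g := ENNReal.ofReal) (by fun_prop) (hfin _) (ae_of_all _ fun t ht =>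
        (ENNReal.ofReal_lt_ofReal_iff (lt_of_le_of_lt hsb ht.2)).2 ht.2)
    exact hlt.ne (hnull _ hm (measure_mono_null inter_subset_left hB0)).symm
  have h2 : μ (B ∩ Iio (s * b)) = 0 := by
    by_contra hne
    have hm : MeasurableSet (B ∩ Iio (s * b)) := hB.inter measurableSet_Iio
    have heq := hnull _ hm (measure_mono_null inter_subset_left hB0)
    have hlt := setLIntegral_strict_mono hm hne (g := fun _ => ENNReal.ofReal (s * b))
      (f := ENNReal.ofReal) (by fun_prop) (by rw [heq]; exact hfin _) ?_
    · exact hlt.ne heq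
    · have hae : ∀ᵐ t ∂μ, 0 ≤ t := by rw [ae_iff]; simpa [Iio_def] using h0
      filter_upwards [hae] with t ht0 ht
      exact (ENNReal.ofReal_lt_ofReal_iff (lt_of_le_of_lt ht0 ht.2)).2 ht.2
  refine measure_mono_null ?_ (measure_union_null (measure_union_null h1 h2) hatom)
  intro t ht
  rcases lt_trichotomy t (s * b) with h | h | h
  · exact Or.inl (Or.inr ⟨ht, h⟩)
  · exact Or.inr h
  · exact Or.inl (Or.inl ⟨ht, h⟩)

end AbsolutelyContinuous

end InverseSubordinator

/-! ### One-dimensional laws of a subordinator and of its inverse. -/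

namespace InverseSubordinator

open Filter Topology

/-- The laws `κ y` of a subordinator with Laplace exponent `f` (restricted to finite values), and
the laws `l t` of its inverse. -/
structure IsLawPair (f : ℝ → ℝ) (κ l : Kernel ℝ ℝ) : Prop where
  nonneg : ∀ y, 0 ≤ y → κ y (Iio 0) = 0
  laplace_eq : ∀ y, 0 ≤ y → ∀ x, 0 < x →
    laplace (κ y) x = ENNReal.ofReal (Real.exp (-(y * f x)))
  passage : ∀ t, 0 < t → ∀ y, 0 ≤ y → l t (Ioi y) = κ y (Iic t)
  inverse_nonneg : ∀ t, l t (Iio 0) = 0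
  inverse_zero : l 0 (Ioi 0) = 0

set_option linter.unusedSectionVars false

namespace IsLawPair

variable {f : ℝ → ℝ} {κ l : Kernel ℝ ℝ} [IsFiniteKernel κ] [IsMarkovKernel l]

lemma ae_nonneg (h : IsLawPair f κ l) {y : ℝ} (hy : 0 ≤ y) : ∀ᵐ t ∂(κ y), 0 ≤ t := by
  rw [ae_iff]
  simpa [Iio_def] using h.nonneg y hy

lemma ae_inverse_nonneg (h : IsLawPair f κ l) (t : ℝ) : ∀ᵐ y ∂(l t), 0 ≤ y := by
  rw [ae_iff]
  simpa [Iio_def] using h.inverse_nonneg t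

/-- The convolution semigroup property is read off from e^{-(s+y)f} = e^{-sf} e^{-yf}. -/
lemma add_eq_conv (h : IsLawPair f κ l) {s y : ℝ} (hs : 0 ≤ s) (hy : 0 ≤ y) :
    κ (s + y) = κ s ∗ κ y := by
  refine ext_of_laplace (h.nonneg _ (add_nonneg hs hy))
    (conv_Iio_zero (h.nonneg s hs) (h.nonneg y hy)) (fun x hx => ?_) (fun x hx => ?_)
  · rw [laplace_conv, h.laplace_eq _ (add_nonneg hs hy) x hx, h.laplace_eq _ hs x hx,
      h.laplace_eq _ hy x hx, ← ENNReal.ofReal_mul (Real.exp_pos _).le, ← Real.exp_add]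
    ring_nf
  · rw [h.laplace_eq _ (add_nonneg hs hy) x hx]
    exact ENNReal.ofReal_ne_top

lemma zero_eq_dirac (h : IsLawPair f κ l) : κ 0 = Measure.dirac 0 := by
  refine ext_of_laplace (h.nonneg _ le_rfl) (by simp) (fun x hx => ?_) (fun x hx => ?_)
  · rw [h.laplace_eq _ le_rfl x hx]
    simp [laplace]
  · rw [h.laplace_eq _ le_rfl x hx]
    exact ENNReal.ofReal_ne_top

lemma inverse_Ioi_of_neg (h : IsLawPair f κ l) (t : ℝ) {y : ℝ} (hy : y < 0) : l t (Ioi y) = 1 := by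
  rw [prob_compl_eq_zero_iff measurableSet_Ioi |>.symm, compl_Ioi]
  exact measure_mono_null (Iic_subset_Iio.2 hy) (h.inverse_nonneg t)

lemma inverse_Iic_zero (h : IsLawPair f κ l) {t : ℝ} (ht : 0 < t) : l t (Iic 0) = 0 := by
  have h1 : l t (Ioi 0) = 1 := by
    rw [h.passage t ht 0 le_rfl, h.zero_eq_dirac]
    simp [ht.le]
  rw [← compl_Ioi, prob_compl_eq_zero_iff measurableSet_Ioi, h1]

lemma inverse_zero_eq_dirac (h : IsLawPair f κ l) : l 0 = Measure.dirac 0 := by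
  have hae : ∀ᵐ y ∂(l 0), y = 0 := by
    have h1 : ∀ᵐ y ∂(l 0), y ≤ 0 := by rw [ae_iff]; simpa [Ioi_def] using h.inverse_zero
    filter_upwards [h1, h.ae_inverse_nonneg 0] with y h1 h2 using le_antisymm h1 h2
  have : (l 0).map id = (l 0).map (fun _ : ℝ => (0 : ℝ)) := Measure.map_congr hae
  rw [Measure.map_id, Measure.map_const] at this
  simpa using this

/-- At an independent exponential time of rate `x` the inverse is exponential of rate `f x`. -/
lemma bind_exp_eq (h : IsLawPair f κ l) {x : ℝ} (hx : 0 < x) (hfx : 0 < f x) :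
    ((volume.restrict (Ioi 0)).withDensity
        fun t => ENNReal.ofReal (Real.exp (-(x * t)))).bind l =
      ENNReal.ofReal (f x / x) • (volume.restrict (Ioi 0)).withDensity
        fun y => ENNReal.ofReal (Real.exp (-(f x * y))) := by
  have hfin : ∀ c : ℝ, 0 < c → IsFiniteMeasure ((volume.restrict (Ioi 0)).withDensity
        fun t => ENNReal.ofReal (Real.exp (-(c * t)))) := by
    intro c hc
    refine isFiniteMeasure_withDensity ?_
    rw [lintegral_exp_neg_mul_Ioi hc]
    exact ENNReal.ofReal_ne_top
  have := hfin x hx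
  have := hfin (f x) hfx
  have hL : ∀ p : ℝ, ((volume.restrict (Ioi 0)).withDensity
        fun t => ENNReal.ofReal (Real.exp (-(x * t)))).bind l (Ioi p) =
      ∫⁻ t in Ioi 0, ENNReal.ofReal (Real.exp (-(x * t))) * l t (Ioi p) := by
    intro p
    rw [Measure.bind_apply measurableSet_Ioi (Kernel.aemeasurable _),
      lintegral_withDensity_eq_lintegral_mul _ (by fun_prop)
        (Kernel.measurable_coe _ measurableSet_Ioi)]
    rfl
  have hR : ∀ p : ℝ, (ENNReal.ofReal (f x / x) • (volume.restrict (Ioi 0)).withDensity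
        fun y => ENNReal.ofReal (Real.exp (-(f x * y)))) (Ioi p) =
      ENNReal.ofReal (Real.exp (-(f x * max p 0)) / x) := by
    intro p
    rw [Measure.smul_apply, withDensity_apply _ measurableSet_Ioi,
      Measure.restrict_restrict measurableSet_Ioi, Ioi_inter_Ioi, lintegral_exp_neg_mul_Ioi hfx,
      smul_eq_mul, ← ENNReal.ofReal_mul (by positivity)]
    congr 1
    field_simp
  have hneg : ∀ p : ℝ, p < 0 → ∫⁻ t in Ioi 0, ENNReal.ofReal (Real.exp (-(x * t))) * l t (Ioi p)
      = ENNReal.ofReal (Real.exp (-(f x * max p 0)) / x) := by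
    intro p hp
    simp only [h.inverse_Ioi_of_neg _ hp, mul_one]
    rw [lintegral_exp_neg_mul_Ioi hx, max_eq_right hp.le]
    simp
  have htail : ∀ p : ℝ, ∫⁻ t in Ioi 0, ENNReal.ofReal (Real.exp (-(x * t))) * l t (Ioi p)
      = ENNReal.ofReal (Real.exp (-(f x * max p 0)) / x) := by
    intro p
    rcases lt_or_ge p 0 with hp | hp
    · exact hneg p hp
    -- Fubini and the equivalence of Y(t) > p with H(p) ≤ t: integrating e^{-xt} over t ≥ H(p) gives
    -- e^{-xH(p)}/x, whose mean on finite values is e^{-p f(x)}/x.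
    calc ∫⁻ t in Ioi 0, ENNReal.ofReal (Real.exp (-(x * t))) * l t (Ioi p)
        = ∫⁻ t in Ioi 0, ∫⁻ s, ENNReal.ofReal (Real.exp (-(x * t))) *
            {q : ℝ × ℝ | q.2 ≤ q.1}.indicator 1 (t, s) ∂(κ p) := by
          refine setLIntegral_congr_fun measurableSet_Ioi fun t ht => ?_
          have hind : ∀ s, {q : ℝ × ℝ | q.2 ≤ q.1}.indicator (1 : ℝ × ℝ → ℝ≥0∞) (t, s) =
            (Iic t).indicator 1 s := fun s => rfl
          simp only [hind]
          rw [lintegral_const_mul _ (measurable_one.indicator measurableSet_Iic),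
            lintegral_indicator_one measurableSet_Iic, h.passage t ht p hp]
      _ = ∫⁻ s, (∫⁻ t in Ioi 0, ENNReal.ofReal (Real.exp (-(x * t))) *
            {q : ℝ × ℝ | q.2 ≤ q.1}.indicator 1 (t, s)) ∂(κ p) := by
          refine lintegral_lintegral_swap (Measurable.aemeasurable ?_)
          refine Measurable.mul (by fun_prop) ?_
          exact measurable_one.indicator (measurableSet_le measurable_snd measurable_fst)
      _ = ∫⁻ s, ENNReal.ofReal (Real.exp (-(x * s))) * ENNReal.ofReal x⁻¹ ∂(κ p) := by
          refine lintegral_congr_ae ?_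
          filter_upwards [h.ae_nonneg hp] with s hs
          have hind : ∀ t, ENNReal.ofReal (Real.exp (-(x * t))) *
              {q : ℝ × ℝ | q.2 ≤ q.1}.indicator (1 : ℝ × ℝ → ℝ≥0∞) (t, s) =
            (Ici s).indicator (fun t => ENNReal.ofReal (Real.exp (-(x * t)))) t := by
            intro t
            by_cases hst : s ≤ t <;> simp [indicator, hst]
          simp only [hind]
          rw [setLIntegral_indicator measurableSet_Ici,
            setLIntegral_congr (t := Ioi s), lintegral_exp_neg_mul_Ioi hx,
            ← ENNReal.ofReal_mul (Real.exp_pos _).le, div_eq_mul_inv]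
          have hae : (Ici s ∩ Ioi 0 : Set ℝ) =ᵐ[volume] (Ioi s ∩ Ioi 0 : Set ℝ) :=
            ae_eq_set_inter Ioi_ae_eq_Ici.symm (ae_eq_refl _)
          rwa [Ioi_inter_Ioi, max_eq_left hs] at hae
      _ = ENNReal.ofReal (Real.exp (-(f x * max p 0)) / x) := by
          rw [lintegral_mul_const _ (by fun_prop)]
          have := h.laplace_eq p hp x hx
          rw [laplace] at this
          rw [this, ← ENNReal.ofReal_mul (Real.exp_pos _).le, max_eq_left hp, div_eq_mul_inv,
            mul_comm p]
  refine ext_of_generate_finite (range Ioi) (borel_eq_generateFrom_Ioi ℝ ▸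
    BorelSpace.measurable_eq) isPiSystem_Ioi ?_ ?_
  · rintro _ ⟨p, rfl⟩
    rw [hL, hR, htail]
  -- The total masses must also agree. Both measures live on [0, ∞), so the half-line (-1, ∞)
  -- already carries everything.
  · have hu : ∀ μ : Measure ℝ, μ (Iio 0) = 0 → μ univ = μ (Ioi (-1)) := by
      intro μ hμ
      refine le_antisymm ?_ (measure_mono (subset_univ _))
      calc μ univ ≤ μ (Iio 0 ∪ Ioi (-1)) := measure_mono fun y _ => by
            rcases lt_or_ge y 0 with hy | hy
            · exact Or.inl hy
            · exact Or.inr (by simp only [mem_Ioi]; linarith)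
        _ ≤ μ (Iio 0) + μ (Ioi (-1)) := measure_union_le _ _
        _ = μ (Ioi (-1)) := by rw [hμ, zero_add]
    rw [hu _ ?_, hu (_ • _) ?_, hL, hR, htail]
    · refine Measure.smul_absolutelyContinuous (withDensity_absolutelyContinuous _ _ ?_)
      rw [Measure.restrict_apply measurableSet_Iio, Iio_inter_Ioi, Ioo_self, measure_empty]
    · rw [Measure.bind_apply measurableSet_Iio (Kernel.aemeasurable _)]
      simp [h.inverse_nonneg]

/-- The form of `bind_exp_eq` used later: it computes the Laplace transform in t of E ψ(Y(t)). -/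
lemma lintegral_exp_inverse (h : IsLawPair f κ l) {x : ℝ} (hx : 0 < x) (hfx : 0 < f x)
    {ψ : ℝ → ℝ≥0∞} (hψ : Measurable ψ) :
    ∫⁻ t in Ioi 0, ENNReal.ofReal (Real.exp (-(x * t))) * ∫⁻ y, ψ y ∂(l t) =
      ENNReal.ofReal (f x / x) * ∫⁻ y in Ioi 0, ENNReal.ofReal (Real.exp (-(f x * y))) * ψ y := by
  have hb := congrArg (fun μ => ∫⁻ y, ψ y ∂μ) (h.bind_exp_eq hx hfx)
  rw [Measure.lintegral_bind (Kernel.aemeasurable _) hψ.aemeasurable, lintegral_smul_measure,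
    lintegral_withDensity_eq_lintegral_mul _ (by fun_prop) hψ,
    lintegral_withDensity_eq_lintegral_mul _ (by fun_prop) hψ.lintegral_kernel] at hb
  exact hb

/-- A null set is not charged by the inverse, at almost all times. -/
lemma ae_inverse_null (h : IsLawPair f κ l) (hf : ∀ x, 0 < x → 0 < f x) {B : Set ℝ}
    (hB : MeasurableSet B) (hB0 : volume B = 0) : ∀ᵐ t, 0 < t → l t B = 0 := by
  have h1 := h.lintegral_exp_inverse one_pos (hf 1 one_pos) (ψ := B.indicator 1)
    (measurable_one.indicator hB)
  have h2 : ∫⁻ y in Ioi 0, ENNReal.ofReal (Real.exp (-(f 1 * y))) * B.indicator 1 y = 0 := by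
    have hm : Measurable fun y => ENNReal.ofReal (Real.exp (-(f 1 * y))) *
      B.indicator (1 : ℝ → ℝ≥0∞) y := (by fun_prop : Measurable fun y =>
        ENNReal.ofReal (Real.exp (-(f 1 * y)))).mul (measurable_one.indicator hB)
    rw [lintegral_eq_zero_iff hm]
    refine ae_restrict_of_ae ?_
    have : ∀ᵐ y, y ∉ B := measure_eq_zero_iff_ae_notMem.1 hB0
    filter_upwards [this] with y hy
    simp [hy]
  rw [h2, mul_zero] at h1
  simp only [lintegral_indicator_one hB] at h1
  have hm : Measurable fun y : ℝ => ENNReal.ofReal (Real.exp (-(1 * y))) * l y B :=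
    (by fun_prop : Measurable fun y : ℝ => ENNReal.ofReal (Real.exp (-(1 * y)))).mul
      (Kernel.measurable_coe _ hB)
  rw [lintegral_eq_zero_iff hm, EventuallyEq, ae_restrict_iff' measurableSet_Ioi] at h1
  filter_upwards [h1] with t ht ht0
  simpa [not_le.2 (Real.exp_pos _)] using ht ht0

/-- The Markov property of the inverse at level `s`, on the level of one-dimensional laws. -/
lemma inverse_restrict_Ioi (h : IsLawPair f κ l) {s t : ℝ} (hs : 0 < s) (ht : 0 < t)
    (hac : κ s ≪ volume) : (l t).restrict (Ioi s) =
      (((κ s).restrict (Iio t)).bind fun z => (l (t - z)).map (s + ·)) := by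
  have hm : Measurable fun z => (l (t - z)).map (s + ·) :=
    (Measure.measurable_map _ (measurable_const_add s)).comp
      (l.measurable.comp (measurable_const.sub measurable_id))
  have hval : ∀ p, s ≤ p → (((κ s).restrict (Iio t)).bind fun z => (l (t - z)).map (s + ·)) (Ioi p)
      = l t (Ioi p) := by
    intro p hp
    have hps : 0 ≤ p - s := by linarith
    -- For p ≥ s, Y(t) > p means H(p) - H(s) ≤ t - H(s), which is the semigroup property split at s.
    have h1 : l t (Ioi p) = ∫⁻ z, κ (p - s) (Iic (t - z)) ∂(κ s) := by
      rw [h.passage t ht p (by linarith), show p = s + (p - s) by ring,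
        h.add_eq_conv hs.le hps, ← lintegral_indicator_one measurableSet_Iic,
        Measure.lintegral_conv (measurable_one.indicator measurableSet_Iic)]
      refine lintegral_congr fun z => ?_
      rw [add_sub_cancel_left, ← lintegral_indicator_one measurableSet_Iic]
      refine lintegral_congr fun w => ?_
      by_cases hw : z + w ≤ t
      · simp [indicator, hw, show w ≤ t - z by linarith]
      · simp [indicator, hw, show ¬ w ≤ t - z by intro hw'; exact hw (by linarith)]
    rw [h1, Measure.bind_apply measurableSet_Ioi hm.aemeasurable,
      ← lintegral_indicator measurableSet_Iio]
    -- `passage` requires t - z > 0, so the boundary point z = t has to be null for `κ s`.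
    have hne : ∀ᵐ z ∂(κ s), z ≠ t := by
      rw [ae_iff]
      simpa using hac (Real.volume_singleton (a := t))
    refine lintegral_congr_ae ?_
    filter_upwards [hne] with z hz
    rcases lt_or_gt_of_ne hz with hlt | hgt
    · rw [indicator_of_mem (mem_Iio.2 hlt), Measure.map_apply (measurable_const_add s)
        measurableSet_Ioi, ← h.passage (t - z) (by linarith) _ hps]
      congr 1
      ext y
      simp only [mem_preimage, mem_Ioi]
      constructor <;> intro _ <;> linarith
    · rw [indicator_of_notMem (by simpa using hgt.le)]
      refine (measure_mono_null ?_ (h.nonneg (p - s) hps)).symm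
      exact Iic_subset_Iio.2 (by linarith)
  -- Lowering the level below s changes nothing, because the inverse is positive at positive times
  -- and the translated laws live on (s, ∞).
  have hle : ∀ p, p ≤ s → (((κ s).restrict (Iio t)).bind fun z => (l (t - z)).map (s + ·)) (Ioi p)
      = l t (Ioi s) := by
    intro p hp
    rw [← hval s le_rfl, Measure.bind_apply measurableSet_Ioi hm.aemeasurable,
      Measure.bind_apply measurableSet_Ioi hm.aemeasurable]
    refine setLIntegral_congr_fun measurableSet_Iio fun z hz => ?_
    have hz' : 0 < t - z := by linarith [mem_Iio.1 hz]
    have h0 := h.inverse_Iic_zero hz'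
    rw [Measure.map_apply (measurable_const_add s) measurableSet_Ioi,
      Measure.map_apply (measurable_const_add s) measurableSet_Ioi]
    refine measure_congr ?_
    have : ∀ᵐ y ∂(l (t - z)), 0 < y := by rw [ae_iff]; simpa [Iic_def] using h0
    filter_upwards [this] with y hy
    refine propext ?_
    change p < s + y ↔ s < s + y
    constructor <;> intro _ <;> linarith
  refine ext_of_generate_finite (range Ioi) (borel_eq_generateFrom_Ioi ℝ ▸
    BorelSpace.measurable_eq) isPiSystem_Ioi ?_ ?_
  · rintro _ ⟨p, rfl⟩
    rw [Measure.restrict_apply measurableSet_Ioi, Ioi_inter_Ioi]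
    rcases le_total p s with hps | hps
    · rw [max_eq_right hps, hle p hps]
    · rw [max_eq_left hps, hval p hps]
  · rw [Measure.restrict_apply_univ]
    have hu : (⋃ n : ℕ, Ioi (-(n : ℝ))) = univ := by
      refine eq_univ_of_forall fun y => ?_
      obtain ⟨n, hn⟩ := exists_nat_gt (-y)
      exact mem_iUnion.2 ⟨n, by simp only [mem_Ioi]; linarith⟩
    rw [← hu, Monotone.measure_iUnion]
    · have hn : ∀ n : ℕ, -(n : ℝ) ≤ s := fun n => by linarith [Nat.cast_nonneg (α := ℝ) n]
      simp only [hle _ (hn _), ciSup_const]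
    · intro m n hmn
      exact Ioi_subset_Ioi (neg_le_neg (by exact_mod_cast hmn))

/-- The inverse has an absolutely continuous law at every positive time. -/
theorem inverse_absolutelyContinuous (h : IsLawPair f κ l) (hf : ∀ x, 0 < x → 0 < f x)
    (hac : ∀ s, 0 < s → κ s ≪ volume) {t : ℝ} (ht : 0 < t) : l t ≪ volume := by
  have hpart : ∀ s, 0 < s → (l t).restrict (Ioi s) ≪ volume := by
    intro s hs
    refine Measure.AbsolutelyContinuous.mk fun B hB hB0 => ?_
    have hm : Measurable fun z => (l (t - z)).map (s + ·) :=
      (Measure.measurable_map _ (measurable_const_add s)).comp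
        (l.measurable.comp (measurable_const.sub measurable_id))
    rw [h.inverse_restrict_Ioi hs ht (hac s hs), Measure.bind_apply hB hm.aemeasurable]
    have hB' : volume ((s + ·) ⁻¹' B) = 0 := by rw [measure_preimage_add, hB0]
    have h1 := h.ae_inverse_null hf (measurable_const_add s hB) hB'
    have h2 : ∀ᵐ z, 0 < t - z → l (t - z) ((s + ·) ⁻¹' B) = 0 :=
      (Measure.measurePreserving_sub_left volume t).quasiMeasurePreserving.ae h1
    rw [lintegral_eq_zero_iff (Measure.measurable_measure.1 hm B hB), EventuallyEq,
      ae_restrict_iff' measurableSet_Iio]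
    -- The exceptional z form a Lebesgue null set, which the law of H(s) does not charge.
    filter_upwards [(hac s hs).ae_le h2] with z hz hzt
    rw [Measure.map_apply (measurable_const_add s) hB, hz (by linarith [mem_Iio.1 hzt])]
    rfl
  refine Measure.AbsolutelyContinuous.mk fun B _ hB0 => ?_
  have hcover : B ⊆ Iic 0 ∪ ⋃ n : ℕ, B ∩ Ioi (1 / ((n : ℝ) + 1)) := by
    intro s hs
    rcases le_or_gt s 0 with h | h
    · exact Or.inl h
    · obtain ⟨n, hn⟩ := exists_nat_one_div_lt h
      exact Or.inr (mem_iUnion.2 ⟨n, hs, hn⟩)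
  refine measure_mono_null hcover (measure_union_null (h.inverse_Iic_zero ht)
    (measure_iUnion_null fun n => ?_))
  rw [← Measure.restrict_apply' measurableSet_Ioi]
  exact hpart _ (by positivity) hB0

end IsLawPair

end InverseSubordinator

/-! ### Potential measures and the renewal equation. -/

namespace InverseSubordinator

open Filter Topology

/-- The potential measure `∫_0^∞ ψ(y) κ(y, ·) dy`. -/
noncomputable def potential (κ : Kernel ℝ ℝ) (ψ : ℝ → ℝ≥0∞) : Measure ℝ :=
  ((volume.restrict (Ioi 0)).withDensity ψ).bind κ

section Potential

variable {κ : Kernel ℝ ℝ} {ψ φ : ℝ → ℝ≥0∞}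

lemma lintegral_potential (hψ : Measurable ψ) (hφ : Measurable φ) :
    ∫⁻ t, φ t ∂(potential κ ψ) = ∫⁻ y in Ioi 0, ψ y * ∫⁻ t, φ t ∂(κ y) := by
  rw [potential, Measure.lintegral_bind (Kernel.aemeasurable _) hφ.aemeasurable,
    lintegral_withDensity_eq_lintegral_mul _ hψ hφ.lintegral_kernel]
  rfl

lemma potential_apply (hψ : Measurable ψ) {B : Set ℝ} (hB : MeasurableSet B) :
    potential κ ψ B = ∫⁻ y in Ioi 0, ψ y * κ y B := by
  rw [← lintegral_indicator_one hB, lintegral_potential hψ (measurable_one.indicator hB)]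
  simp only [lintegral_indicator_one hB]

lemma isFiniteMeasure_potential [IsFiniteKernel κ] (hψ : Measurable ψ)
    (hfin : ∫⁻ y in Ioi 0, ψ y ≠ ∞) : IsFiniteMeasure (potential κ ψ) := by
  refine ⟨?_⟩
  rw [potential_apply hψ MeasurableSet.univ]
  calc ∫⁻ y in Ioi 0, ψ y * κ y univ ≤ ∫⁻ y in Ioi 0, ψ y * κ.bound :=
        lintegral_mono fun y => mul_le_mul_right (κ.measure_le_bound y univ) _
    _ = (∫⁻ y in Ioi 0, ψ y) * κ.bound := lintegral_mul_const _ hψ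
    _ < ∞ := ENNReal.mul_lt_top hfin.lt_top κ.bound_lt_top

lemma potential_absolutelyContinuous (hψ : Measurable ψ) (hac : ∀ s, 0 < s → κ s ≪ volume) :
    potential κ ψ ≪ volume := by
  refine Measure.AbsolutelyContinuous.mk fun B hB hB0 => ?_
  rw [potential_apply hψ hB]
  refine setLIntegral_eq_zero measurableSet_Ioi fun y hy => ?_
  simp [hac y hy hB0]

end Potential

namespace IsLawPair

set_option linter.unusedSectionVars false

variable {f : ℝ → ℝ} {κ l : Kernel ℝ ℝ} [IsFiniteKernel κ] [IsMarkovKernel l]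
  {ψ : ℝ → ℝ≥0∞} {a b q : ℝ} {ν : Measure ℝ}

lemma potential_Iio (h : IsLawPair f κ l) (hψ : Measurable ψ) : potential κ ψ (Iio 0) = 0 := by
  rw [potential_apply hψ measurableSet_Iio]
  refine setLIntegral_eq_zero measurableSet_Ioi fun y hy => ?_
  simp [h.nonneg y (le_of_lt hy)]

lemma laplace_potential (h : IsLawPair f κ l) (hψ : Measurable ψ) {x : ℝ} (hx : 0 < x) :
    laplace (potential κ ψ) x =
      ∫⁻ y in Ioi 0, ENNReal.ofReal (Real.exp (-(f x * y))) * ψ y := by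
  rw [laplace, lintegral_potential hψ (by fun_prop)]
  refine setLIntegral_congr_fun measurableSet_Ioi fun y hy => ?_
  have := h.laplace_eq y (le_of_lt hy) x hx
  rw [laplace] at this
  rw [this, mul_comm, mul_comm y]

lemma potential_Iic (h : IsLawPair f κ l) (hψ : Measurable ψ) {t : ℝ} (ht : 0 < t) :
    potential κ ψ (Iic t) = ∫⁻ y in Ioi 0, ψ y * l t (Ioi y) := by
  rw [potential_apply hψ measurableSet_Iic]
  refine setLIntegral_congr_fun measurableSet_Ioi fun y hy => ?_
  simp only [h.passage t ht y (le_of_lt hy)]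

lemma lintegral_inverse_le (h : IsLawPair f κ l) {C : ℝ≥0∞} (hC : ∀ y, 0 ≤ y → ψ y ≤ C) (t : ℝ) :
    ∫⁻ y, ψ y ∂(l t) ≤ C := by
  calc ∫⁻ y, ψ y ∂(l t) ≤ ∫⁻ _, C ∂(l t) := lintegral_mono_ae (by
        filter_upwards [h.ae_inverse_nonneg t] with y hy using hC y hy)
    _ = C := by simp

/-- The renewal equation as an identity of measures. -/
lemma potential_add_conv (h : IsLawPair (bernstein a b ν) κ l) (ha : 0 ≤ a) (hb : 0 ≤ b)
    (hν : IsLevyMeasure ν) (hinf : ν (Ioi 0) = ∞) (hψ : Measurable ψ)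
    (hfin : ∫⁻ y in Ioi 0, ψ y ≠ ∞) :
    ENNReal.ofReal b • potential κ ψ +
      potential κ ψ ∗ volume.withDensity (tailDensity a ν) =
      (volume.restrict (Ioi 0)).withDensity fun t => ∫⁻ y, ψ y ∂(l t) := by
  -- Under the transform, convolution with b δ_0 plus the tail is multiplication by f(x)/x. The
  -- right-hand side of the equation has the same transform by `lintegral_exp_inverse`.
  have hL : ∀ x, 0 < x → laplace (ENNReal.ofReal b • potential κ ψ +
      potential κ ψ ∗ volume.withDensity (tailDensity a ν)) x =
      ENNReal.ofReal (bernstein a b ν x / x) *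
        ∫⁻ y in Ioi 0, ENNReal.ofReal (Real.exp (-(bernstein a b ν x * y))) * ψ y := by
    intro x hx
    rw [laplace_add, laplace_smul, laplace_conv, h.laplace_potential hψ hx,
      ← hν.laplace_tailDensity ha hb hx]
    ring
  refine ext_of_laplace ?_ ?_ (fun x hx => ?_) (fun x hx => ?_)
  · simp [h.potential_Iio hψ, conv_Iio_zero (h.potential_Iio hψ) (tailDensity_Iio_zero a ν)]
  · refine withDensity_absolutelyContinuous _ _ ?_
    rw [Measure.restrict_apply measurableSet_Iio, Iio_inter_Ioi, Ioo_self, measure_empty]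
  · rw [hL x hx, ← h.lintegral_exp_inverse hx (hν.bernstein_pos ha hb hinf hx) hψ, laplace,
      lintegral_withDensity_eq_lintegral_mul _ hψ.lintegral_kernel (by fun_prop)]
    refine lintegral_congr fun t => ?_
    rw [Pi.mul_apply, mul_comm]
  · rw [hL x hx]
    refine ENNReal.mul_ne_top ENNReal.ofReal_ne_top (ne_top_of_le_ne_top hfin ?_)
    refine setLIntegral_mono' measurableSet_Ioi fun y hy => ?_
    refine mul_le_of_le_one_left zero_le (ENNReal.ofReal_le_one.2 (Real.exp_le_one_iff.2 ?_))
    have := mul_nonneg (hν.bernstein_nonneg ha hb hx.le) (le_of_lt hy)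
    linarith

/-- The convolution of the potential density with the tail. -/
noncomputable def potentialTail (κ : Kernel ℝ ℝ) (ψ : ℝ → ℝ≥0∞) (a : ℝ) (ν : Measure ℝ)
    (t : ℝ) : ℝ≥0∞ :=
  ∫⁻ y, tailDensity a ν (t - y) ∂(potential κ ψ)

lemma potentialTail_eq (hψ : Measurable ψ) (hfin : ∫⁻ y in Ioi 0, ψ y ≠ ∞)
    (hac : ∀ s, 0 < s → κ s ≪ volume) (t : ℝ) :
    potentialTail κ ψ a ν t =
      ∫⁻ y, (potential κ ψ).rnDeriv volume y * tailDensity a ν (t - y) := by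
  have := isFiniteMeasure_potential (κ := κ) hψ hfin
  rw [potentialTail, lintegral_rnDeriv_mul (potential_absolutelyContinuous hψ hac)]
  exact ((measurable_tailDensity a ν).comp (measurable_const.sub measurable_id)).aemeasurable

lemma measurable_potentialTail (hψ : Measurable ψ) (hfin : ∫⁻ y in Ioi 0, ψ y ≠ ∞) :
    Measurable (potentialTail κ ψ a ν) := by
  have := isFiniteMeasure_potential (κ := κ) hψ hfin
  exact Measurable.lintegral_prod_right' (f := fun p : ℝ × ℝ => tailDensity a ν (p.1 - p.2))
    ((measurable_tailDensity a ν).comp (measurable_fst.sub measurable_snd))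

/-- The renewal equation at almost all times. -/
lemma renewal_ae (h : IsLawPair (bernstein a b ν) κ l) (ha : 0 ≤ a) (hb : 0 ≤ b)
    (hν : IsLevyMeasure ν) (hinf : ν (Ioi 0) = ∞) (hψ : Measurable ψ)
    (hfin : ∫⁻ y in Ioi 0, ψ y ≠ ∞) (hac : ∀ s, 0 < s → κ s ≪ volume) :
    ∀ᵐ t, 0 < t → ENNReal.ofReal b * (potential κ ψ).rnDeriv volume t +
      potentialTail κ ψ a ν t = ∫⁻ y, ψ y ∂(l t) := by
  have := isFiniteMeasure_potential (κ := κ) hψ hfin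
  have hU : volume.withDensity ((potential κ ψ).rnDeriv volume) = potential κ ψ :=
    Measure.withDensity_rnDeriv_eq _ _ (potential_absolutelyContinuous hψ hac)
  have hid := h.potential_add_conv ha hb hν hinf hψ hfin
  have hm := Measure.measurable_rnDeriv (potential κ ψ) volume
  have hconv : potential κ ψ ∗ volume.withDensity (tailDensity a ν) =
      volume.withDensity (potentialTail κ ψ a ν) := by
    conv_lhs => rw [← hU]
    rw [conv_withDensity_eq_lconvolution hm (measurable_tailDensity a ν)]
    congr 1
    ext t
    rw [lconvolution_def, potentialTail_eq hψ hfin hac]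
    refine lintegral_congr fun y => ?_
    rw [neg_add_eq_sub]
  rw [hconv] at hid
  conv_lhs at hid => rw [← hU]
  rw [← withDensity_smul _ hm, ← withDensity_add_left (hm.const_smul _),
    ← withDensity_indicator measurableSet_Ioi, withDensity_eq_iff_of_sigmaFinite] at hid
  · filter_upwards [hid] with t ht ht0
    simpa [indicator_of_mem (mem_Ioi.2 ht0)] using ht
  · exact ((hm.const_smul _).add (measurable_potentialTail hψ hfin)).aemeasurable
  · exact (hψ.lintegral_kernel.indicator measurableSet_Ioi).aemeasurable

lemma tendsto_tailDensity_right (hI : ConditionI a ν) {r : ℝ} {s : ℕ → ℝ}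
    (hs : Tendsto s atTop (𝓝 r)) (hr : 0 < r) :
    Tendsto (fun n => tailDensity a ν (s n)) atTop (𝓝 (tailDensity a ν r)) := by
  have h1 : Tendsto (fun n => ENNReal.ofReal (levyTail a ν (s n))) atTop
      (𝓝 (ENNReal.ofReal (levyTail a ν r))) :=
    (ENNReal.continuous_ofReal.tendsto _).comp ((hI.continuousAt hr).tendsto.comp hs)
  rw [show tailDensity a ν r = ENNReal.ofReal (levyTail a ν r) from indicator_of_mem hr _]
  refine h1.congr' ?_
  filter_upwards [hs.eventually (Ioi_mem_nhds hr)] with n hn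
  rw [tailDensity, indicator_of_mem (mem_Ioi.2 hn)]

/-- One half of the renewal equation, at all times. -/
lemma potentialTail_le (h : IsLawPair (bernstein a b ν) κ l) (ha : 0 ≤ a) (hb : 0 ≤ b)
    (hν : IsLevyMeasure ν) (hI : ConditionI a ν) (hψ : Measurable ψ)
    (hfin : ∫⁻ y in Ioi 0, ψ y ≠ ∞) (hac : ∀ s, 0 < s → κ s ≪ volume)
    (hG : ContinuousOn (fun t => ∫⁻ y, ψ y ∂(l t)) (Ioi 0)) {t : ℝ} (ht : 0 < t) :
    potentialTail κ ψ a ν t ≤ ∫⁻ y, ψ y ∂(l t) := by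
  -- The times at which the renewal equation holds are dense, so such times can converge to t from
  -- above.
  have hdense := Measure.dense_of_ae (h.renewal_ae ha hb hν hI.infinite hψ hfin hac)
  have hex : ∀ n : ℕ, ∃ s, (0 < s → ENNReal.ofReal b * (potential κ ψ).rnDeriv volume s +
      potentialTail κ ψ a ν s = ∫⁻ y, ψ y ∂(l s)) ∧ t < s ∧ s < t + 1 / ((n : ℝ) + 1) := by
    intro n
    obtain ⟨s, hs, h1⟩ := hdense.exists_between
      (show t < t + 1 / ((n : ℝ) + 1) by linarith [Nat.one_div_pos_of_nat (α := ℝ) (n := n)])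
    exact ⟨s, hs, h1⟩
  choose s hs hts hst using hex
  have hlim : Tendsto s atTop (𝓝 t) := by
    refine tendsto_of_tendsto_of_tendsto_of_le_of_le tendsto_const_nhds ?_
      (fun n => (hts n).le) (fun n => (hst n).le)
    simpa using tendsto_const_nhds.add (tendsto_one_div_add_atTop_nhds_zero_nat (𝕜 := ℝ))
  have hGlim : Tendsto (fun n => ∫⁻ y, ψ y ∂(l (s n))) atTop (𝓝 (∫⁻ y, ψ y ∂(l t))) :=
    ((hG.continuousAt (Ioi_mem_nhds ht)).tendsto).comp hlim
  have hm : ∀ r : ℝ, Measurable fun y => tailDensity a ν (r - y) := fun r =>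
    (measurable_tailDensity a ν).comp (measurable_const.sub measurable_id)
  -- Fatou's lemma applies since the tail is continuous at t - y > 0 and its density on the line
  -- vanishes when y ≥ t.
  calc potentialTail κ ψ a ν t
      ≤ ∫⁻ y, liminf (fun n => tailDensity a ν (s n - y)) atTop ∂(potential κ ψ) := by
        refine lintegral_mono fun y => ?_
        rcases lt_or_ge y t with hy | hy
        · refine ((tendsto_tailDensity_right hI (hlim.sub_const y)
            (by linarith)).liminf_eq).ge
        · rw [tailDensity, indicator_of_notMem (by simpa using hy)]
          exact zero_le
    _ ≤ liminf (fun n => potentialTail κ ψ a ν (s n)) atTop :=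
        lintegral_liminf_le fun n => hm (s n)
    _ ≤ liminf (fun n => ∫⁻ y, ψ y ∂(l (s n))) atTop := by
        refine liminf_le_liminf (Eventually.of_forall fun n => ?_)
        rw [← hs n (ht.trans (hts n))]
        exact le_add_self
    _ = ∫⁻ y, ψ y ∂(l t) := hGlim.liminf_eq

/-- Convolving with `κ s` replaces `κ y` by `κ (s + y)`. The growth condition on ψ then allows the
substitution y ↦ y + s, and enlarging the range from (s, ∞) to (0, ∞) only increases the integral.
-/
lemma conv_potential_le (h : IsLawPair f κ l) (hψ : Measurable ψ)
    (hq : ∀ y s, 0 ≤ y → 0 ≤ s → ENNReal.ofReal (Real.exp (-(q * s))) * ψ y ≤ ψ (y + s))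
    {φ : ℝ → ℝ≥0∞} (hφ : Measurable φ) {s : ℝ} (hs : 0 ≤ s) :
    ENNReal.ofReal (Real.exp (-(q * s))) * ∫⁻ z, ∫⁻ w, φ (z + w) ∂(potential κ ψ) ∂(κ s) ≤
      ∫⁻ t, φ t ∂(potential κ ψ) := by
  have hinner : ∀ z, ∫⁻ w, φ (z + w) ∂(potential κ ψ) =
      ∫⁻ y in Ioi 0, ψ y * ∫⁻ w, φ (z + w) ∂(κ y) := fun z =>
    lintegral_potential hψ (hφ.comp (measurable_const_add z))
  have hm2 : Measurable fun p : ℝ × ℝ => ∫⁻ w, φ (p.1 + w) ∂(κ p.2) := by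
    have := Measurable.lintegral_kernel_prod_right' (κ := Kernel.prodMkLeft ℝ κ)
      (f := fun p : (ℝ × ℝ) × ℝ => φ (p.1.1 + p.2))
      (hφ.comp ((measurable_fst.comp measurable_fst).add measurable_snd))
    simpa using this
  calc ENNReal.ofReal (Real.exp (-(q * s))) * ∫⁻ z, ∫⁻ w, φ (z + w) ∂(potential κ ψ) ∂(κ s)
      = ENNReal.ofReal (Real.exp (-(q * s))) *
          ∫⁻ y in Ioi 0, (∫⁻ z, ψ y * ∫⁻ w, φ (z + w) ∂(κ y) ∂(κ s)) := by
        simp only [hinner]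
        congr 1
        refine lintegral_lintegral_swap (Measurable.aemeasurable ?_)
        exact (hψ.comp measurable_snd).mul hm2
    _ = ∫⁻ y in Ioi 0, ENNReal.ofReal (Real.exp (-(q * s))) *
          (ψ y * ∫⁻ t, φ t ∂(κ (s + y))) := by
        rw [← lintegral_const_mul']
        · refine setLIntegral_congr_fun measurableSet_Ioi fun y hy => ?_
          have hm3 : Measurable fun z : ℝ => ∫⁻ w, φ (z + w) ∂(κ y) :=
            hm2.comp (measurable_id.prodMk measurable_const)
          rw [lintegral_const_mul _ hm3,
            h.add_eq_conv hs (le_of_lt hy), Measure.lintegral_conv hφ]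
        · exact ENNReal.ofReal_ne_top
    _ ≤ ∫⁻ y in Ioi 0, ψ (y + s) * ∫⁻ t, φ t ∂(κ (y + s)) := by
        refine setLIntegral_mono' measurableSet_Ioi fun y hy => ?_
        rw [← mul_assoc, add_comm s y]
        exact mul_le_mul_left (hq y s (le_of_lt hy) hs) _
    _ = ∫⁻ y in Ioi s, ψ y * ∫⁻ t, φ t ∂(κ y) := by
        have := (measurePreserving_add_right volume s).setLIntegral_comp_preimage
          (measurableSet_Ioi (a := s)) (hψ.mul (hφ.lintegral_kernel (κ := κ)))
        simpa using this
    _ ≤ ∫⁻ t, φ t ∂(potential κ ψ) := by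
        rw [lintegral_potential hψ hφ]
        exact lintegral_mono_set (Ioi_subset_Ioi hs)

/-- The other half of the renewal equation, at all times: without drift the subordinator does not
creep. -/
lemma le_potentialTail (h : IsLawPair (bernstein a 0 ν) κ l) (ha : 0 ≤ a)
    (hν : IsLevyMeasure ν) (hI : ConditionI a ν) (hψ : Measurable ψ)
    (hfin : ∫⁻ y in Ioi 0, ψ y ≠ ∞) (hac : ∀ s, 0 < s → κ s ≪ volume)
    (hq : ∀ y s, 0 ≤ y → 0 ≤ s → ENNReal.ofReal (Real.exp (-(q * s))) * ψ y ≤ ψ (y + s))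
    (hG : ContinuousOn (fun t => ∫⁻ y, ψ y ∂(l t)) (Ioi 0)) {t : ℝ} (ht : 0 < t) :
    ∫⁻ y, ψ y ∂(l t) ≤ potentialTail κ ψ a ν t := by
  -- Continuity keeps the average above c' on [t - r, t]. The bound `hbound` then holds with a
  -- factor that tends to 1 as s → 0.
  refine le_of_forall_lt fun c hc => ?_
  obtain ⟨c', hcc', hc'⟩ := exists_between hc
  refine hcc'.trans_le ?_
  have hev := (hG.continuousAt (Ioi_mem_nhds ht)).tendsto.eventually (lt_mem_nhds hc')
  obtain ⟨δ, hδ, hball⟩ := Metric.eventually_nhds_iff.1 hev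
  set r : ℝ := min (δ / 2) (t / 2) with hr
  have hr0 : 0 < r := by positivity
  have hrδ : r ≤ δ / 2 := min_le_left _ _
  have hrt : r ≤ t / 2 := min_le_right _ _
  have hbound : ∀ s, 0 < s → ENNReal.ofReal (Real.exp (-(q * s))) * (c' * l r (Ioi s)) ≤
      potentialTail κ ψ a ν t := by
    intro s hs
    refine le_trans (mul_le_mul_right ?_ _) (h.conv_potential_le hψ hq (φ := fun y =>
      tailDensity a ν (t - y)) ((measurable_tailDensity a ν).comp
        (measurable_const.sub measurable_id)) hs.le)
    rw [h.passage r hr0 s hs.le, ← setLIntegral_const]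
    refine le_trans ?_ (setLIntegral_le_lintegral (Iic r) _)
    have hren := h.renewal_ae ha le_rfl hν hI.infinite hψ hfin hac
    -- The equation holds at t - z for Lebesgue almost every z, hence for `κ s`-almost every z.
    have hren' : ∀ᵐ z, 0 < t - z → ENNReal.ofReal 0 * (potential κ ψ).rnDeriv volume (t - z) +
        potentialTail κ ψ a ν (t - z) = ∫⁻ y, ψ y ∂(l (t - z)) :=
      (Measure.measurePreserving_sub_left volume t).quasiMeasurePreserving.ae hren
    refine lintegral_mono_ae ?_
    refine (ae_restrict_iff' measurableSet_Iic).2 ?_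
    filter_upwards [(hac s hs).ae_le hren', h.ae_nonneg hs.le] with z hz hz0 hzr
    have hzr' : z ≤ r := hzr
    have h1 := hz (by linarith)
    have h2 : c' < ∫⁻ y, ψ y ∂(l (t - z)) := by
      refine hball ?_
      rw [Real.dist_eq, abs_lt]
      constructor <;> linarith
    rw [ENNReal.ofReal_zero, zero_mul, zero_add] at h1
    refine h2.le.trans (h1.symm.le.trans (le_of_eq ?_))
    simp only [potentialTail, sub_sub]
  -- The mass that `κ s` puts on [0, r] equals P{Y(r) > s}, which tends to 1 because Y(r) > 0 almost
  -- surely.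
  have hlim1 : Tendsto (fun n : ℕ => l r (Ioi (1 / ((n : ℝ) + 1)))) atTop (𝓝 1) := by
    have hone : l r (Ioi 0) = 1 := by
      rw [← prob_compl_eq_zero_iff measurableSet_Ioi, compl_Ioi, h.inverse_Iic_zero hr0]
    have hU : (⋃ n : ℕ, Ioi (1 / ((n : ℝ) + 1))) = Ioi 0 := by
      ext y
      simp only [mem_iUnion, mem_Ioi]
      constructor
      · rintro ⟨n, hn⟩
        exact lt_trans Nat.one_div_pos_of_nat hn
      · exact fun hy => exists_nat_one_div_lt hy
    rw [← hone, ← hU]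
    refine tendsto_measure_iUnion_atTop fun m n hmn => Ioi_subset_Ioi ?_
    exact Nat.one_div_le_one_div hmn
  have hlim2 : Tendsto (fun n : ℕ => ENNReal.ofReal (Real.exp (-(q * (1 / ((n : ℝ) + 1))))))
      atTop (𝓝 1) := by
    have h0 : Tendsto (fun n : ℕ => -(q * (1 / ((n : ℝ) + 1)))) atTop (𝓝 (-(q * 0))) :=
      ((tendsto_one_div_add_atTop_nhds_zero_nat (𝕜 := ℝ)).const_mul q).neg
    have h1 := (ENNReal.continuous_ofReal.tendsto _).comp ((Real.continuous_exp.tendsto _).comp h0)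
    simpa [Function.comp_def] using h1
  have hc'top : c' ≠ ∞ := hc'.ne_top
  have hlim3 := ENNReal.Tendsto.mul hlim2 (Or.inl one_ne_zero)
    (ENNReal.Tendsto.const_mul hlim1 (Or.inr hc'top)) (Or.inr ENNReal.one_ne_top)
  simp only [mul_one, one_mul] at hlim3
  exact le_of_tendsto' hlim3 fun n => hbound _ Nat.one_div_pos_of_nat

end IsLawPair

end InverseSubordinator

/-! ### Continuity of convolutions and a pointwise solution of the renewal equation. -/

namespace InverseSubordinator

open Filter Topology

section Continuity

variable {u g : ℝ → ℝ≥0∞} {K : ℝ≥0∞}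

lemma lintegral_Ico_sub_left (g : ℝ → ℝ≥0∞) (s t : ℝ) :
    ∫⁻ y in Ico s t, g (t - y) = ∫⁻ r in Ioc 0 (t - s), g r := by
  have hemb : MeasurableEmbedding fun y : ℝ => t - y := (Homeomorph.subLeft t).measurableEmbedding
  have := (Measure.measurePreserving_sub_left volume t).setLIntegral_comp_preimage_emb hemb g
    (Ioc 0 (t - s))
  rw [← this]
  congr 2
  ext y
  simp only [mem_Ico, mem_preimage, mem_Ioc]
  constructor <;> rintro ⟨_, _⟩ <;> constructor <;> linarith

/-- For y < s the integrand only decreases when s moves up to t. The new range [s, t) costs at most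
K times the mass of g on (0, t - s]. -/
lemma lintegral_conv_le_of_lt (hgm : Measurable g) (hg0 : ∀ r, r ≤ 0 → g r = 0)
    (hanti : AntitoneOn g (Ioi 0)) (hu : Measurable u) (huK : ∀ᵐ y, u y ≤ K) {s t : ℝ}
    (hst : s < t) :
    ∫⁻ y, u y * g (t - y) ≤ (∫⁻ y, u y * g (s - y)) + K * ∫⁻ r in Ioc 0 (t - s), g r := by
  have hm : ∀ c : ℝ, Measurable fun y => g (c - y) := fun c =>
    hgm.comp (measurable_const.sub measurable_id)
  rw [← lintegral_Ico_sub_left, ← lintegral_const_mul _ (hm t),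
    ← lintegral_indicator measurableSet_Ico, ← lintegral_add_left (hu.fun_mul (hm s))]
  refine lintegral_mono_ae ?_
  filter_upwards [huK] with y hy
  rcases lt_or_ge y s with h1 | h1
  · refine le_add_right (mul_le_mul_right (hanti ?_ ?_ (by linarith)) _) <;>
      simp only [mem_Ioi] <;> linarith
  · rcases lt_or_ge y t with h2 | h2
    · rw [indicator_of_mem (mem_Ico.2 ⟨h1, h2⟩)]
      exact le_add_left (mul_le_mul_left hy _)
    · rw [hg0 _ (by linarith)]
      simp

/-- With δ = t - s, the loss is at most K ∫_0^s (g(r) - g(r + δ)) dr. Both terms are integrals of g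
over overlapping ranges, so the difference is at most ∫_0^δ g. -/
lemma lintegral_conv_le_of_gt (hgm : Measurable g)
    (hanti : AntitoneOn g (Ioi 0)) (hfin : ∀ T, ∫⁻ r in Ioc 0 T, g r ≠ ∞)
    (hg0 : ∀ r, r ≤ 0 → g r = 0) (hu : Measurable u)
    (hu0 : ∀ᵐ y, y < 0 → u y = 0) (huK : ∀ᵐ y, u y ≤ K) {s t : ℝ} (hs : 0 < s) (hst : s < t) :
    ∫⁻ y, u y * g (s - y) ≤ (∫⁻ y, u y * g (t - y)) + K * ∫⁻ r in Ioc 0 (t - s), g r := by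
  have hm : ∀ c : ℝ, Measurable fun y => g (c - y) := fun c =>
    hgm.comp (measurable_const.sub measurable_id)
  set δ := t - s with hδ
  have hδ0 : 0 < δ := by linarith
  have hshift : ∀ c d : ℝ, ∫⁻ r in Ioc c d, g (r + δ) = ∫⁻ r in Ioc (c + δ) (d + δ), g r := by
    intro c d
    have := (measurePreserving_add_right volume δ).setLIntegral_comp_preimage
      (measurableSet_Ioc (a := c + δ) (b := d + δ)) hgm
    simpa using this
  have hle : ∀ r ∈ Ioc 0 s, g (r + δ) ≤ g r := fun r hr =>
    hanti hr.1 (by simp only [mem_Ioi]; linarith [hr.1]) (by linarith)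
  have hdiff : ∫⁻ r in Ioc 0 s, (g r - g (r + δ)) ≤ ∫⁻ r in Ioc 0 δ, g r := by
    have hgδ : Measurable fun r => g (r + δ) := hgm.comp (measurable_add_const δ)
    rw [lintegral_sub' hgδ.aemeasurable]
    · rw [tsub_le_iff_right, hshift, zero_add]
      calc ∫⁻ r in Ioc 0 s, g r ≤ ∫⁻ r in Ioc 0 δ ∪ Ioc δ (s + δ), g r := by
            refine lintegral_mono_set ?_
            rw [Ioc_union_Ioc_eq_Ioc hδ0.le (by linarith)]
            exact Ioc_subset_Ioc_right (by linarith)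
        _ ≤ _ := lintegral_union_le _ _ _
    · exact ne_top_of_le_ne_top (hfin s) (setLIntegral_mono' measurableSet_Ioc hle)
    · exact (ae_restrict_iff' measurableSet_Ioc).2 (ae_of_all _ hle)
  have hsub : ∫⁻ y in Ico 0 s, (g (s - y) - g (s - y + δ)) ≤ ∫⁻ r in Ioc 0 δ, g r := by
    have := lintegral_Ico_sub_left (fun r => g r - g (r + δ)) 0 s
    rw [this, sub_zero]
    exact hdiff
  have hm3 : Measurable fun y => g (s - y) - g (s - y + δ) :=
    (hm s).sub (hgm.comp ((measurable_const.sub measurable_id).add_const δ))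
  refine le_trans ?_ (add_le_add_right (mul_le_mul_right hsub K) _)
  rw [← lintegral_const_mul _ hm3, ← lintegral_indicator measurableSet_Ico,
    ← lintegral_add_left (hu.fun_mul (hm t))]
  refine lintegral_mono_ae ?_
  filter_upwards [huK, hu0] with y hy hy0
  rcases lt_or_ge y 0 with h1 | h1
  · simp [hy0 h1]
  · rcases lt_or_ge y s with h2 | h2
    · rw [indicator_of_mem (mem_Ico.2 ⟨h1, h2⟩), show s - y + δ = t - y by rw [hδ]; ring]
      calc u y * g (s - y) ≤ u y * (g (t - y) + (g (s - y) - g (t - y))) :=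
            mul_le_mul_right le_add_tsub _
        _ = u y * g (t - y) + u y * (g (s - y) - g (t - y)) := mul_add _ _ _
        _ ≤ _ := add_le_add_right (mul_le_mul_left hy _) _
    · rw [hg0 _ (by linarith)]
      simp

/-- The convolution of a bounded function with a locally integrable decreasing function is
continuous. -/
lemma continuousOn_lintegral_conv (hgm : Measurable g) (hg0 : ∀ r, r ≤ 0 → g r = 0)
    (hanti : AntitoneOn g (Ioi 0)) (hfin : ∀ T, ∫⁻ r in Ioc 0 T, g r ≠ ∞) (hu : Measurable u)
    (hu0 : ∀ᵐ y, y < 0 → u y = 0) (huK : ∀ᵐ y, u y ≤ K) (hK : K ≠ ∞) :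
    ContinuousOn (fun t => ∫⁻ y, u y * g (t - y)) (Ioi 0) := by
  have hboth : ∀ s t : ℝ, 0 < s → 0 < t →
      ∫⁻ y, u y * g (s - y) ≤ (∫⁻ y, u y * g (t - y)) + K * ∫⁻ r in Ioc 0 |t - s|, g r := by
    intro s t hs ht
    rcases lt_trichotomy s t with h | h | h
    · rw [abs_of_pos (by linarith)]
      exact lintegral_conv_le_of_gt hgm hanti hfin hg0 hu hu0 huK hs h
    · rw [h]
      exact le_add_right le_rfl
    · rw [abs_of_neg (by linarith), neg_sub]
      exact lintegral_conv_le_of_lt hgm hg0 hanti hu huK h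
  intro t ht
  refine ContinuousAt.continuousWithinAt ?_
  have hN : Tendsto (fun s : ℝ => K * ∫⁻ r in Ioc 0 |t - s|, g r) (𝓝 t) (𝓝 0) := by
    have h1 : Tendsto (fun s : ℝ => |t - s|) (𝓝 t) (𝓝 0) := by
      have : Continuous fun s : ℝ => |t - s| := by fun_prop
      simpa using this.tendsto t
    have h2 : Tendsto (fun s : ℝ => ∫⁻ r in Ioc 0 |t - s|, g r ∂(volume.restrict (Ioc 0 1)))
        (𝓝 t) (𝓝 0) := by
      refine tendsto_setLIntegral_zero (hfin 1) ?_
      have h3 : Tendsto (fun s : ℝ => ENNReal.ofReal |t - s|) (𝓝 t) (𝓝 0) := by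
        simpa [Function.comp_def] using (ENNReal.continuous_ofReal.tendsto 0).comp h1
      refine tendsto_of_tendsto_of_tendsto_of_le_of_le tendsto_const_nhds h3
        (fun _ => zero_le) fun s => ?_
      refine (Measure.restrict_apply_le _ _).trans ?_
      simp
    have h4 : Tendsto (fun s : ℝ => ∫⁻ r in Ioc 0 |t - s|, g r) (𝓝 t) (𝓝 0) := by
      refine h2.congr' ?_
      filter_upwards [h1.eventually (gt_mem_nhds (zero_lt_one))] with s hs
      rw [Measure.restrict_restrict measurableSet_Ioc, inter_eq_left.2]
      exact Ioc_subset_Ioc_right hs.le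
    simpa using ENNReal.Tendsto.const_mul h4 (Or.inr hK)
  have hlow : Tendsto (fun s : ℝ => (∫⁻ y, u y * g (t - y)) - K * ∫⁻ r in Ioc 0 |t - s|, g r)
      (𝓝 t) (𝓝 (∫⁻ y, u y * g (t - y))) := by
    simpa using ENNReal.Tendsto.sub tendsto_const_nhds hN (Or.inr ENNReal.zero_ne_top)
  have hupp : Tendsto (fun s : ℝ => (∫⁻ y, u y * g (t - y)) + K * ∫⁻ r in Ioc 0 |t - s|, g r)
      (𝓝 t) (𝓝 (∫⁻ y, u y * g (t - y))) := by
    simpa using tendsto_const_nhds.add hN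
  refine tendsto_of_tendsto_of_tendsto_of_le_of_le' hlow hupp ?_ ?_
  · filter_upwards [Ioi_mem_nhds ht] with s hs
    rw [tsub_le_iff_right, abs_sub_comm]
    exact (hboth t s ht hs).trans (by rw [abs_sub_comm])
  · filter_upwards [Ioi_mem_nhds ht] with s hs
    exact hboth s t hs ht

end Continuity

section TailDensity

variable {ν : Measure ℝ} {a b : ℝ}

lemma tailDensity_of_nonpos (a : ℝ) (ν : Measure ℝ) {r : ℝ} (hr : r ≤ 0) :
    tailDensity a ν r = 0 := indicator_of_notMem (notMem_Ioi.2 hr) _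

lemma tailDensity_of_pos (a : ℝ) (ν : Measure ℝ) {r : ℝ} (hr : 0 < r) :
    tailDensity a ν r = ENNReal.ofReal (levyTail a ν r) := indicator_of_mem (mem_Ioi.2 hr) _

lemma IsLevyMeasure.antitoneOn_tailDensity (hν : IsLevyMeasure ν) (a : ℝ) :
    AntitoneOn (tailDensity a ν) (Ioi 0) := by
  intro s hs t ht hst
  rw [tailDensity_of_pos a ν hs, tailDensity_of_pos a ν ht]
  exact ENNReal.ofReal_le_ofReal (hν.antitoneOn_levyTail a hs ht hst)

/-- Integrability near 0 follows from finiteness of the Laplace transform at 1, since e^{-r} ≥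
e^{-T} on (0, T]. -/
lemma IsLevyMeasure.lintegral_tailDensity_ne_top (hν : IsLevyMeasure ν) (ha : 0 ≤ a) (T : ℝ) :
    ∫⁻ r in Ioc 0 T, tailDensity a ν r ≠ ∞ := by
  have h1 := hν.laplace_tailDensity ha le_rfl one_pos
  rw [ENNReal.ofReal_zero, zero_add, laplace,
    lintegral_withDensity_eq_lintegral_mul _ (measurable_tailDensity a ν) (by fun_prop)] at h1
  have h2 : ENNReal.ofReal (Real.exp (-T)) * ∫⁻ r in Ioc 0 T, tailDensity a ν r ≤
      ENNReal.ofReal (bernstein a 0 ν 1 / 1) := by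
    rw [← h1, ← lintegral_const_mul _ (measurable_tailDensity a ν)]
    refine le_trans (setLIntegral_mono' measurableSet_Ioc fun r hr => ?_)
      (setLIntegral_le_lintegral (Ioc 0 T) _)
    rw [Pi.mul_apply, mul_comm]
    refine mul_le_mul_right (ENNReal.ofReal_le_ofReal (Real.exp_le_exp.2 ?_)) _
    linarith [hr.2]
  exact (ENNReal.lt_top_of_mul_ne_top_right (ne_top_of_le_ne_top ENNReal.ofReal_ne_top h2)
    (by simp [Real.exp_pos])).ne

lemma measurable_levyTail (a : ℝ) (ν : Measure ℝ) : Measurable (levyTail a ν) := by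
  have hanti : Antitone fun s => ν (Ioi s) := fun s t hst => measure_mono (Ioi_subset_Ioi hst)
  exact (hanti.measurable.ennreal_toReal).const_add a

end TailDensity

namespace IsLawPair

set_option linter.unusedSectionVars false

variable {κ l : Kernel ℝ ℝ} [IsFiniteKernel κ] [IsMarkovKernel l]
  {ψ : ℝ → ℝ≥0∞} {a b q : ℝ} {ν : Measure ℝ}

/-- A version of the potential density that solves the renewal equation at every positive time. -/
theorem exists_potential_density (h : IsLawPair (bernstein a b ν) κ l) (ha : 0 ≤ a) (hb : 0 ≤ b)
    (hν : IsLevyMeasure ν) (hI : ConditionI a ν) (hψ : Measurable ψ)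
    (hfin : ∫⁻ y in Ioi 0, ψ y ≠ ∞) (hac : ∀ s, 0 < s → κ s ≪ volume)
    {C : ℝ≥0∞} (hC : ∀ y, 0 ≤ y → ψ y ≤ C) (hCtop : C ≠ ∞)
    (hq : ∀ y s, 0 ≤ y → 0 ≤ s → ENNReal.ofReal (Real.exp (-(q * s))) * ψ y ≤ ψ (y + s))
    (hG : ContinuousOn (fun t => ∫⁻ y, ψ y ∂(l t)) (Ioi 0)) :
    ∃ w : ℝ → ℝ≥0∞, Measurable w ∧ volume.withDensity w = potential κ ψ ∧
      (b ≠ 0 → ContinuousOn w (Ioi 0) ∧ ∀ t, w t ≠ ∞) ∧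
      ∀ t, 0 < t → ENNReal.ofReal b * w t + ∫⁻ y, w y * tailDensity a ν (t - y) =
        ∫⁻ y, ψ y ∂(l t) := by
  have := isFiniteMeasure_potential (κ := κ) hψ hfin
  set u := (potential κ ψ).rnDeriv volume with hu
  have hum : Measurable u := Measure.measurable_rnDeriv _ _
  have hU : volume.withDensity u = potential κ ψ :=
    Measure.withDensity_rnDeriv_eq _ _ (potential_absolutelyContinuous hψ hac)
  have hle : ∀ t, 0 < t → potentialTail κ ψ a ν t ≤ ∫⁻ y, ψ y ∂(l t) := fun t ht =>
    h.potentialTail_le ha hb hν hI hψ hfin hac hG ht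
  -- Without drift the Radon–Nikodym derivative itself serves, by the two pointwise inequalities.
  rcases eq_or_ne b 0 with rfl | hb0
  · refine ⟨u, hum, hU, fun h0 => absurd rfl h0, fun t ht => ?_⟩
    rw [ENNReal.ofReal_zero, zero_mul, zero_add, ← potentialTail_eq hψ hfin hac]
    exact le_antisymm (hle t ht) (h.le_potentialTail ha hν hI hψ hfin hac hq hG ht)
  have hbpos : 0 < b := lt_of_le_of_ne hb hb0.symm
  set B := ENNReal.ofReal b with hB
  have hBpos : B ≠ 0 := by simpa [hB] using hbpos
  have hBtop : B ≠ ∞ := ENNReal.ofReal_ne_top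
  have hren := h.renewal_ae ha hb hν hI.infinite hψ hfin hac
  have hu0 : ∀ᵐ y, y < 0 → u y = 0 := by
    have h1 := h.potential_Iio hψ
    rw [← hU, withDensity_apply _ measurableSet_Iio, lintegral_eq_zero_iff hum] at h1
    exact (ae_restrict_iff' measurableSet_Iio).1 h1
  -- Drift bounds the density: b u ≤ E ψ(Y) ≤ C almost everywhere. This boundedness makes the
  -- convolution with the tail continuous.
  have huK : ∀ᵐ y, u y ≤ C / B := by
    filter_upwards [hren, hu0, Measure.ae_ne volume 0] with y hy hy0 hne
    rcases lt_or_gt_of_ne hne with hlt | hgt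
    · simp [hy0 hlt]
    · rw [ENNReal.le_div_iff_mul_le (Or.inl hBpos) (Or.inl hBtop), mul_comm]
      exact (le_self_add.trans (hy hgt).le).trans (h.lintegral_inverse_le hC y)
  have hhcont : ContinuousOn (potentialTail κ ψ a ν) (Ioi 0) := by
    refine (continuousOn_lintegral_conv (measurable_tailDensity a ν)
      (fun r hr => tailDensity_of_nonpos a ν hr) (hν.antitoneOn_tailDensity a)
      (hν.lintegral_tailDensity_ne_top ha) hum hu0 huK
      (ENNReal.div_ne_top hCtop hBpos)).congr fun t _ => ?_
    exact potentialTail_eq hψ hfin hac t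
  -- The equation is solved for the density at every time. Both terms of the difference are
  -- continuous, so this version is continuous too.
  set w : ℝ → ℝ≥0∞ := (Ioi 0).indicator fun t =>
    ((∫⁻ y, ψ y ∂(l t)) - potentialTail κ ψ a ν t) / B with hw
  have hwm : Measurable w := by
    refine Measurable.indicator ?_ measurableSet_Ioi
    exact (hψ.lintegral_kernel.sub (measurable_potentialTail hψ hfin)).div_const _
  have hGtop : ∀ t, ∫⁻ y, ψ y ∂(l t) ≠ ∞ := fun t =>
    ne_top_of_le_ne_top hCtop (h.lintegral_inverse_le hC t)
  have hwu : w =ᵐ[volume] u := by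
    filter_upwards [hren, hu0, Measure.ae_ne volume 0] with y hy hy0 hne
    rcases lt_or_gt_of_ne hne with hlt | hgt
    · rw [hy0 hlt]
      exact indicator_of_notMem (notMem_Ioi.2 hlt.le) _
    · rw [hw, indicator_of_mem (mem_Ioi.2 hgt), ← hy hgt]
      rw [ENNReal.add_sub_cancel_right (ne_top_of_le_ne_top (hGtop y) (hle y hgt)),
        mul_comm, ENNReal.mul_div_cancel_right hBpos hBtop]
  refine ⟨w, hwm, ?_, fun _ => ⟨?_, ?_⟩, ?_⟩
  · rw [withDensity_congr_ae hwu, hU]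
  · have hsub : ContinuousOn (fun t => ((∫⁻ y, ψ y ∂(l t)) - potentialTail κ ψ a ν t) / B)
        (Ioi 0) := by
      intro t ht
      exact ENNReal.Tendsto.div_const (ENNReal.Tendsto.sub (hG t ht) (hhcont t ht)
        (Or.inl (hGtop t))) (Or.inr hBpos)
    exact hsub.congr fun t ht => indicator_of_mem ht _
  · intro t
    by_cases ht : t ∈ Ioi (0 : ℝ)
    · rw [hw, indicator_of_mem ht]
      exact ENNReal.div_ne_top (ne_top_of_le_ne_top (hGtop t) tsub_le_self) hBpos
    · rw [hw, indicator_of_notMem ht]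
      exact ENNReal.zero_ne_top
  · intro t ht
    have h1 : ∫⁻ y, w y * tailDensity a ν (t - y) = potentialTail κ ψ a ν t := by
      rw [potentialTail_eq hψ hfin hac]
      refine lintegral_congr_ae ?_
      filter_upwards [hwu] with y hy
      rw [hy]
    rw [h1, hw, indicator_of_mem (mem_Ioi.2 ht), ENNReal.mul_div_cancel hBpos hBtop,
      tsub_add_cancel_of_le (hle t ht)]

end IsLawPair

end InverseSubordinator

/-! ### The convolution-type derivative of an indefinite integral, and Poisson weights. -/

namespace InverseSubordinator

open Filter Topology

lemma absolutelyContinuousOnInterval_congr {f g : ℝ → ℝ} {c d : ℝ}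
    (hf : AbsolutelyContinuousOnInterval f c d) (hfg : EqOn f g (uIcc c d)) :
    AbsolutelyContinuousOnInterval g c d := by
  rw [absolutelyContinuousOnInterval_iff] at hf ⊢
  intro ε hε
  obtain ⟨δ, hδ, h⟩ := hf ε hε
  refine ⟨δ, hδ, fun E hE hlt => ?_⟩
  have := h E hE hlt
  convert this using 2 with i hi
  rw [hfg (hE.1 i hi).1, hfg (hE.1 i hi).2]

/-- The convolution-type derivative of an indefinite integral. -/
lemma convDifferentiable_of_integral {b : ℝ} {n v p : ℝ → ℝ}
    (hv : ∀ T, 0 ≤ T → IntervalIntegrable v volume 0 T)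
    (hp : ∀ t, 0 ≤ t → p t = p 0 + ∫ s in (0 : ℝ)..t, v s)
    (hcont : b ≠ 0 → ContinuousOn v (Ioi 0))
    (hint : ∀ t, 0 < t → IntervalIntegrable (fun s => v (t - s) * n s) volume 0 t) :
    ConvDifferentiable b n p ∧
      ∀ t, 0 < t → convDeriv b n p t = b * v t + ∫ s in (0 : ℝ)..t, v (t - s) * n s := by
  have hpev : ∀ t, 0 < t → p =ᶠ[𝓝 t] fun t => p 0 + ∫ s in (0 : ℝ)..t, v s := by
    intro t ht
    filter_upwards [Ioi_mem_nhds ht] with s hs using hp s (le_of_lt hs)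
  have hder : ∀ᵐ t, 0 < t → deriv p t = v t := by
    have hN : ∀ᵐ t, ∀ N : ℕ, t ∈ uIcc (0 : ℝ) N → ∀ c ∈ uIcc (0 : ℝ) N,
        HasDerivAt (fun x => ∫ s in c..x, v s) (v t) t := by
      rw [ae_all_iff]
      exact fun N => (hv N (Nat.cast_nonneg N)).ae_hasDerivAt_integral
    filter_upwards [hN] with t ht ht0
    obtain ⟨N, hN⟩ := exists_nat_gt t
    have h1 := ht N (by rw [uIcc_of_le (Nat.cast_nonneg N)]; exact ⟨ht0.le, hN.le⟩) 0 left_mem_uIcc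
    exact ((h1.const_add (p 0)).congr_of_eventuallyEq (hpev t ht0)).deriv
  have hder' : ∀ t, 0 < t → ∀ᵐ s, s ∈ Ioo 0 t →
      deriv (fun r => p (r - s)) t * n s = v (t - s) * n s := by
    intro t _
    have h1 : ∀ᵐ s, 0 < t - s → deriv p (t - s) = v (t - s) :=
      (Measure.measurePreserving_sub_left volume t).quasiMeasurePreserving.ae hder
    filter_upwards [h1] with s hs hst
    rw [deriv_comp_sub_const, hs (by linarith [hst.2])]
  have hder'' : ∀ t, 0 < t → ∀ᵐ s, s ∈ Ioc 0 t →
      deriv (fun r => p (r - s)) t * n s = v (t - s) * n s := by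
    intro t ht
    -- At s = t the derivative would be taken at time 0, where nothing is known about p on the left;
    -- this single point is null.
    filter_upwards [hder' t ht, Measure.ae_ne volume t] with s hs hne hst
    exact hs ⟨hst.1, lt_of_le_of_ne hst.2 hne⟩
  have hloc : b ≠ 0 → ∀ t, 0 < t → HasDerivAt p (v t) t := by
    intro hb t ht
    have h1 : HasDerivAt (fun x => ∫ s in (0 : ℝ)..x, v s) (v t) t :=
      intervalIntegral.integral_hasDerivAt_right (hv t ht.le)
        ((hcont hb).stronglyMeasurableAtFilter isOpen_Ioi t ht)
        ((hcont hb).continuousAt (Ioi_mem_nhds ht))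
    exact (h1.const_add (p 0)).congr_of_eventuallyEq (hpev t ht)
  refine ⟨⟨fun T hT => ?_, fun hb t ht => (hloc hb t ht).differentiableAt, fun t ht => ?_⟩,
    fun t ht => ?_⟩
  · have h1 := (hv T hT).absolutelyContinuousOnInterval_intervalIntegral (c := 0) left_mem_uIcc
    have h2 : AbsolutelyContinuousOnInterval (fun _ : ℝ => p 0) 0 T :=
      ((LipschitzWith.const (p 0)).lipschitzOnWith (s := uIcc 0 T)).absolutelyContinuousOnInterval
    refine absolutelyContinuousOnInterval_congr (h2.add h1) fun t ht => ?_
    rw [uIcc_of_le hT] at ht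
    exact (hp t ht.1).symm
  · refine (hint t ht).congr_ae ?_
    rw [uIoc_of_le ht.le]
    refine (ae_restrict_iff' measurableSet_Ioc).2 ?_
    filter_upwards [hder'' t ht] with s hs hst using (hs hst).symm
  · rw [convDeriv]
    congr 1
    · rcases eq_or_ne b 0 with rfl | hb
      · simp
      · rw [(hloc hb t ht).deriv]
    · rw [intervalIntegral.integral_of_le ht.le, intervalIntegral.integral_of_le ht.le]
      exact setIntegral_congr_ae measurableSet_Ioc (hder'' t ht)

/-- The Poisson weights `e^{-qy} (qy)^k / k!`. -/
noncomputable def poissonWeight (q : ℝ) (k : ℕ) (y : ℝ) : ℝ :=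
  Real.exp (-(q * y)) * (q * y) ^ k / k.factorial

section PoissonWeight

variable {q : ℝ}

@[fun_prop]
lemma continuous_poissonWeight (q : ℝ) (k : ℕ) : Continuous (poissonWeight q k) := by
  unfold poissonWeight
  fun_prop

lemma poissonWeight_nonneg (hq : 0 ≤ q) (k : ℕ) {y : ℝ} (hy : 0 ≤ y) : 0 ≤ poissonWeight q k y := by
  unfold poissonWeight
  positivity

lemma poissonWeight_le_one (hq : 0 ≤ q) (k : ℕ) {y : ℝ} (hy : 0 ≤ y) :
    poissonWeight q k y ≤ 1 := by
  have h1 := Real.pow_div_factorial_le_exp (q * y) (by positivity) k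
  rw [poissonWeight, mul_div_assoc]
  calc Real.exp (-(q * y)) * ((q * y) ^ k / k.factorial)
      ≤ Real.exp (-(q * y)) * Real.exp (q * y) := by gcongr
    _ = 1 := by rw [← Real.exp_add]; simp

/-- Spending half of the exponential on the power leaves integrable decay; 2^k comes from (qy)^k =
2^k (qy/2)^k. -/
lemma poissonWeight_le_exp (hq : 0 ≤ q) (k : ℕ) {y : ℝ} (hy : 0 ≤ y) :
    poissonWeight q k y ≤ 2 ^ k * Real.exp (-(q / 2 * y)) := by
  have h1 := Real.pow_div_factorial_le_exp (q * y / 2) (by positivity) k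
  have h2 : poissonWeight q k y =
      2 ^ k * (Real.exp (-(q * y)) * ((q * y / 2) ^ k / k.factorial)) := by
    rw [poissonWeight, div_pow]
    field_simp
  rw [h2]
  calc (2 : ℝ) ^ k * (Real.exp (-(q * y)) * ((q * y / 2) ^ k / k.factorial))
      ≤ 2 ^ k * (Real.exp (-(q * y)) * Real.exp (q * y / 2)) := by gcongr
    _ = 2 ^ k * Real.exp (-(q / 2 * y)) := by
      rw [← Real.exp_add]
      ring_nf

/-- This is the growth condition required by `conv_potential_le`; it holds because y ↦ (qy)^k is
increasing on [0, ∞). -/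
lemma exp_mul_poissonWeight_le (hq : 0 ≤ q) (k : ℕ) {y s : ℝ} (hy : 0 ≤ y) (hs : 0 ≤ s) :
    Real.exp (-(q * s)) * poissonWeight q k y ≤ poissonWeight q k (y + s) := by
  have h1 : Real.exp (-(q * s)) * poissonWeight q k y =
      Real.exp (-(q * (y + s))) * (q * y) ^ k / k.factorial := by
    rw [poissonWeight, show -(q * (y + s)) = -(q * s) + -(q * y) by ring, Real.exp_add]
    ring
  rw [h1, poissonWeight]
  gcongr
  linarith

lemma lintegral_poissonWeight_ne_top (hq : 0 < q) (k : ℕ) :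
    ∫⁻ y in Ioi 0, ENNReal.ofReal (poissonWeight q k y) ≠ ∞ := by
  have h1 : ∫⁻ y in Ioi 0, ENNReal.ofReal (poissonWeight q k y) ≤
      ∫⁻ y in Ioi 0, ENNReal.ofReal (2 ^ k) * ENNReal.ofReal (Real.exp (-(q / 2 * y))) := by
    refine setLIntegral_mono' measurableSet_Ioi fun y hy => ?_
    rw [← ENNReal.ofReal_mul (by positivity)]
    exact ENNReal.ofReal_le_ofReal (poissonWeight_le_exp hq.le k (le_of_lt hy))
  refine ne_top_of_le_ne_top ?_ h1
  rw [lintegral_const_mul _ (by fun_prop), lintegral_exp_neg_mul_Ioi (half_pos hq)]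
  exact ENNReal.mul_ne_top ENNReal.ofReal_ne_top ENNReal.ofReal_ne_top

lemma hasDerivAt_poissonWeight (q : ℝ) (k : ℕ) (y : ℝ) :
    HasDerivAt (poissonWeight q k)
      (-q * (poissonWeight q k y - if k = 0 then 0 else poissonWeight q (k - 1) y)) y := by
  have h1 : HasDerivAt (fun y : ℝ => -(q * y)) (-q) y := by
    simpa using ((hasDerivAt_id y).const_mul q).fun_neg
  have h2 : HasDerivAt (fun y : ℝ => q * y) q y := by
    simpa using (hasDerivAt_id y).const_mul q
  have h3 := (h1.exp.mul (h2.pow k)).div_const (k.factorial : ℝ)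
  refine (h3.congr_deriv ?_)
  rcases k with _ | k
  · simp [poissonWeight]
    ring
  · simp only [poissonWeight, Nat.add_sub_cancel, Nat.factorial_succ, Nat.cast_mul,
      Nat.cast_add, Nat.cast_one, Nat.succ_ne_zero, if_false]
    have : (k.factorial : ℝ) ≠ 0 := by positivity
    field_simp
    simp
    ring

lemma integral_poissonWeight_eq (q : ℝ) (k : ℕ) (y : ℝ) :
    poissonWeight q k y = poissonWeight q k 0 + -q * ((∫ s in (0 : ℝ)..y, poissonWeight q k s) -
      if k = 0 then 0 else ∫ s in (0 : ℝ)..y, poissonWeight q (k - 1) s) := by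
  have hii : ∀ j, IntervalIntegrable (poissonWeight q j) volume 0 y := fun j =>
    (continuous_poissonWeight q j).intervalIntegrable _ _
  have h1 := intervalIntegral.integral_eq_sub_of_hasDerivAt (a := 0) (b := y)
    (fun s _ => hasDerivAt_poissonWeight q k s) (Continuous.intervalIntegrable (by
      by_cases hk : k = 0
      · simp only [hk, if_true]
        fun_prop
      · simp only [hk, if_false]
        fun_prop) _ _)
  rw [intervalIntegral.integral_const_mul] at h1
  by_cases hk : k = 0
  · simp only [hk, if_true, sub_zero] at h1 ⊢
    linarith
  · simp only [hk, if_false] at h1 ⊢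
    rw [intervalIntegral.integral_sub (hii _) (hii _)] at h1
    linarith

end PoissonWeight

end InverseSubordinator

/-! ### The equation for Poisson weights averaged over the inverse. -/

namespace InverseSubordinator

open Filter Topology

namespace IsLawPair

set_option linter.unusedSectionVars false

variable {f : ℝ → ℝ} {κ l : Kernel ℝ ℝ} [IsFiniteKernel κ] [IsMarkovKernel l]
  {a b q : ℝ} {ν : Measure ℝ}

/-- The potential of the Poisson weight. -/
noncomputable def weightPotential (κ : Kernel ℝ ℝ) (q : ℝ) (k : ℕ) : Measure ℝ :=
  potential κ fun y => ENNReal.ofReal (poissonWeight q k y)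

lemma measurable_ofReal_poissonWeight (q : ℝ) (k : ℕ) :
    Measurable fun y => ENNReal.ofReal (poissonWeight q k y) := by fun_prop

lemma integrable_poissonWeight (h : IsLawPair f κ l) (hq : 0 ≤ q) (k : ℕ) (t : ℝ) :
    Integrable (poissonWeight q k) (l t) := by
  refine (integrable_const (1 : ℝ)).mono' (by fun_prop) ?_
  filter_upwards [h.ae_inverse_nonneg t] with y hy
  rw [Real.norm_eq_abs, abs_of_nonneg (poissonWeight_nonneg hq k hy)]
  exact poissonWeight_le_one hq k hy

lemma lintegral_ofReal_poissonWeight (h : IsLawPair f κ l) (hq : 0 ≤ q) (k : ℕ) (t : ℝ) :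
    ∫⁻ y, ENNReal.ofReal (poissonWeight q k y) ∂(l t) =
      ENNReal.ofReal (∫ y, poissonWeight q k y ∂(l t)) := by
  refine (ofReal_integral_eq_lintegral_ofReal (h.integrable_poissonWeight hq k t) ?_).symm
  filter_upwards [h.ae_inverse_nonneg t] with y hy using poissonWeight_nonneg hq k hy

lemma integral_poissonWeight_inverse_zero (h : IsLawPair f κ l) (q : ℝ) (k : ℕ) :
    ∫ y, poissonWeight q k y ∂(l 0) = poissonWeight q k 0 := by
  rw [h.inverse_zero_eq_dirac, integral_dirac]

/-- Layer cake: E ∫_0^{Y(t)} w = ∫_0^∞ w(y) P{Y(t) > y} dy = ∫_0^∞ w(y) P{H(y) ≤ t} dy. -/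
lemma integral_primitive_poissonWeight (h : IsLawPair f κ l) (hq : 0 < q) (k : ℕ) {t : ℝ}
    (ht : 0 < t) : Integrable (fun y => ∫ s in (0 : ℝ)..y, poissonWeight q k s) (l t) ∧
      ∫ y, (∫ s in (0 : ℝ)..y, poissonWeight q k s) ∂(l t) =
        (weightPotential κ q k).real (Iic t) := by
  have hfinm : IsFiniteMeasure (weightPotential κ q k) :=
    isFiniteMeasure_potential (measurable_ofReal_poissonWeight q k)
      (lintegral_poissonWeight_ne_top hq k)
  have hcake := lintegral_comp_eq_lintegral_meas_lt_mul (l t) (f := fun y => y)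
    (g := poissonWeight q k) (h.ae_inverse_nonneg t) (by fun_prop)
    (fun t _ => (continuous_poissonWeight q k).intervalIntegrable _ _) (by
      filter_upwards [ae_restrict_mem measurableSet_Ioi] with y hy
      exact poissonWeight_nonneg hq.le k (le_of_lt hy))
  have hU : ∫⁻ y, ENNReal.ofReal (∫ s in (0 : ℝ)..y, poissonWeight q k s) ∂(l t) =
      weightPotential κ q k (Iic t) := by
    rw [hcake, weightPotential, h.potential_Iic (measurable_ofReal_poissonWeight q k) ht]
    refine lintegral_congr fun y => ?_
    rw [mul_comm]
    rfl
  have hcont : Continuous fun y => ∫ s in (0 : ℝ)..y, poissonWeight q k s :=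
    intervalIntegral.continuous_primitive
      (fun c d => (continuous_poissonWeight q k).intervalIntegrable c d) 0
  have hnn : ∀ᵐ y ∂(l t), 0 ≤ ∫ s in (0 : ℝ)..y, poissonWeight q k s := by
    filter_upwards [h.ae_inverse_nonneg t] with y hy
    exact intervalIntegral.integral_nonneg hy fun s hs => poissonWeight_nonneg hq.le k hs.1
  constructor
  · refine ⟨hcont.aestronglyMeasurable, ?_⟩
    rw [hasFiniteIntegral_iff_ofReal hnn, hU]
    exact measure_lt_top _ _
  · rw [integral_eq_lintegral_of_nonneg_ae hnn hcont.aestronglyMeasurable, hU]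
    rfl

/-- Averaging the integrated differential equation of the weights expresses the marginal through
distribution functions of potentials. Its regularity in t therefore comes from the potential
densities. -/
lemma integral_poissonWeight_inverse (h : IsLawPair f κ l) (hq : 0 < q) (k : ℕ) {t : ℝ}
    (ht : 0 < t) : ∫ y, poissonWeight q k y ∂(l t) = poissonWeight q k 0 +
      -q * ((weightPotential κ q k).real (Iic t) -
        if k = 0 then 0 else (weightPotential κ q (k - 1)).real (Iic t)) := by
  obtain ⟨hi, he⟩ := h.integral_primitive_poissonWeight hq k ht
  rw [integral_congr_ae (ae_of_all _ fun y => integral_poissonWeight_eq q k y)]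
  by_cases hk : k = 0
  · simp only [hk, if_true, sub_zero] at hi he ⊢
    rw [integral_add (integrable_const _) (hi.const_mul _), integral_const_mul, he]
    simp
  · obtain ⟨hi', he'⟩ := h.integral_primitive_poissonWeight hq (k - 1) ht
    simp only [hk, if_false]
    have hsub : Integrable (fun y => (∫ s in (0 : ℝ)..y, poissonWeight q k s) -
      ∫ s in (0 : ℝ)..y, poissonWeight q (k - 1) s) (l t) := hi.sub hi'
    rw [integral_add (integrable_const _) (hsub.const_mul _), integral_const_mul,
      integral_sub hi hi', he, he']
    simp

lemma continuous_measureReal_Iic {μ : Measure ℝ} [IsFiniteMeasure μ] (hμ : μ ≪ volume) :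
    Continuous fun t => μ.real (Iic t) := by
  have hint : Integrable (fun t => (μ.rnDeriv volume t).toReal) volume :=
    Measure.integrable_toReal_rnDeriv
  have heq : ∀ t, μ.real (Iic t) = μ.real (Iic 0) + ∫ s in (0 : ℝ)..t,
      (μ.rnDeriv volume s).toReal := by
    intro t
    rw [← intervalIntegral.integral_Iic_sub_Iic hint.integrableOn hint.integrableOn,
      Measure.setIntegral_toReal_rnDeriv hμ, Measure.setIntegral_toReal_rnDeriv hμ]
    ring
  rw [funext heq]
  exact continuous_const.add
    (intervalIntegral.continuous_primitive (fun c d => hint.intervalIntegrable) 0)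

/-- Potentials are absolutely continuous, so their distribution functions are continuous. This
continuity is what upgrades the renewal equation from almost all times to all times. -/
lemma continuousOn_lintegral_poissonWeight (h : IsLawPair f κ l)
    (hac : ∀ s, 0 < s → κ s ≪ volume) (hq : 0 < q) (k : ℕ) :
    ContinuousOn (fun t => ∫⁻ y, ENNReal.ofReal (poissonWeight q k y) ∂(l t)) (Ioi 0) := by
  have hc : ∀ j, Continuous fun t => (weightPotential κ q j).real (Iic t) := fun j => by
    have : IsFiniteMeasure (weightPotential κ q j) :=
      isFiniteMeasure_potential (measurable_ofReal_poissonWeight q j)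
        (lintegral_poissonWeight_ne_top hq j)
    exact continuous_measureReal_Iic
      (potential_absolutelyContinuous (measurable_ofReal_poissonWeight q j) hac)
  have hcont : Continuous fun t => ENNReal.ofReal (poissonWeight q k 0 +
      -q * ((weightPotential κ q k).real (Iic t) -
        if k = 0 then 0 else (weightPotential κ q (k - 1)).real (Iic t))) := by
    refine ENNReal.continuous_ofReal.comp (continuous_const.add (continuous_const.mul
      ((hc k).sub ?_)))
    by_cases hk : k = 0
    · simp only [hk, if_true]
      fun_prop
    · simp only [hk, if_false]
      exact hc _
  refine hcont.continuousOn.congr fun t ht => ?_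
  rw [h.lintegral_ofReal_poissonWeight hq.le, h.integral_poissonWeight_inverse hq k ht]

/-- The density of the potential of a Poisson weight, with the renewal equation at every positive
time. -/
theorem exists_weightPotential_density (h : IsLawPair (bernstein a b ν) κ l) (ha : 0 ≤ a)
    (hb : 0 ≤ b) (hν : IsLevyMeasure ν) (hI : ConditionI a ν)
    (hac : ∀ s, 0 < s → κ s ≪ volume) (hq : 0 < q) (k : ℕ) :
    ∃ v : ℝ → ℝ, Integrable v ∧
      (∀ t, 0 < t → (weightPotential κ q k).real (Iic t) = ∫ s in (0 : ℝ)..t, v s) ∧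
      (b ≠ 0 → ContinuousOn v (Ioi 0)) ∧
      ∀ t, 0 < t → IntervalIntegrable (fun s => v (t - s) * levyTail a ν s) volume 0 t ∧
        b * v t + ∫ s in (0 : ℝ)..t, v (t - s) * levyTail a ν s =
          ∫ y, poissonWeight q k y ∂(l t) := by
  have hψ := measurable_ofReal_poissonWeight q k
  have hfinm : IsFiniteMeasure (weightPotential κ q k) :=
    isFiniteMeasure_potential hψ (lintegral_poissonWeight_ne_top hq k)
  obtain ⟨w, hwm, hwU, hwc, hren⟩ := h.exists_potential_density ha hb hν hI hψ
    (lintegral_poissonWeight_ne_top hq k) hac (C := 1)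
    (fun y hy => ENNReal.ofReal_le_one.2 (poissonWeight_le_one hq.le k hy)) ENNReal.one_ne_top
    (q := q) (fun y s hy hs => by
      rw [← ENNReal.ofReal_mul (Real.exp_pos _).le]
      exact ENNReal.ofReal_le_ofReal (exp_mul_poissonWeight_le hq.le k hy hs))
    (h.continuousOn_lintegral_poissonWeight hac hq k)
  change volume.withDensity w = weightPotential κ q k at hwU
  have hwfin : ∫⁻ y, w y ≠ ∞ := by
    have := measure_ne_top (weightPotential κ q k) univ
    rwa [← hwU, withDensity_apply _ MeasurableSet.univ, Measure.restrict_univ] at this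
  have hwtop : ∀ᵐ y, w y < ∞ := ae_lt_top hwm hwfin
  have hw0 : ∀ᵐ y, y < 0 → w y = 0 := by
    have h1 : weightPotential κ q k (Iio 0) = 0 := h.potential_Iio hψ
    rw [← hwU, withDensity_apply _ measurableSet_Iio, lintegral_eq_zero_iff hwm] at h1
    exact (ae_restrict_iff' measurableSet_Iio).1 h1
  refine ⟨fun y => (w y).toReal, integrable_toReal_of_lintegral_ne_top hwm.aemeasurable hwfin,
    fun t ht => ?_, fun hb0 => ?_, fun t ht => ?_⟩
  · have h1 : weightPotential κ q k (Iic t) = ∫⁻ y in Ioc 0 t, w y := by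
      rw [← hwU, withDensity_apply _ measurableSet_Iic, ← lintegral_indicator measurableSet_Iic,
        ← lintegral_indicator measurableSet_Ioc]
      refine lintegral_congr_ae ?_
      filter_upwards [hw0, Measure.ae_ne volume 0] with y hy hne
      rcases lt_or_gt_of_ne hne with hlt | hgt
      · simp [indicator, hy hlt]
      · simp [indicator, hgt]
    rw [measureReal_def, h1, intervalIntegral.integral_of_le ht.le,
      integral_toReal hwm.aemeasurable (ae_restrict_of_ae hwtop)]
  · exact fun t ht => (ENNReal.tendsto_toReal ((hwc hb0).2 t)).comp ((hwc hb0).1 t ht)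
  -- The substitution y = t - s brings the convolution on the line to (0, t], as w vanishes almost
  -- everywhere on the negative half-line.
  · have hconv : ∫⁻ y, w y * tailDensity a ν (t - y) =
        ∫⁻ s in Ioc 0 t, ENNReal.ofReal ((w (t - s)).toReal * levyTail a ν s) := by
      have hF : Measurable fun y => w y * tailDensity a ν (t - y) :=
        hwm.mul ((measurable_tailDensity a ν).comp (measurable_const.sub measurable_id))
      rw [← (Measure.measurePreserving_sub_left volume t).lintegral_comp hF,
        ← lintegral_indicator measurableSet_Ioc]
      have hw0' : ∀ᵐ s, t - s < 0 → w (t - s) = 0 :=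
        (Measure.measurePreserving_sub_left volume t).quasiMeasurePreserving.ae hw0
      have hwtop' : ∀ᵐ s, w (t - s) < ∞ :=
        (Measure.measurePreserving_sub_left volume t).quasiMeasurePreserving.ae hwtop
      refine lintegral_congr_ae ?_
      filter_upwards [hw0', hwtop'] with s hs0 hsfin
      rw [sub_sub_cancel]
      rcases le_or_gt s 0 with h1 | h1
      · rw [tailDensity_of_nonpos a ν h1, mul_zero,
          indicator_of_notMem fun h2 => absurd h2.1 (not_lt.2 h1)]
      · rcases le_or_gt s t with h2 | h2
        · rw [indicator_of_mem (mem_Ioc.2 ⟨h1, h2⟩), tailDensity_of_pos a ν h1,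
            ENNReal.ofReal_mul ENNReal.toReal_nonneg, ENNReal.ofReal_toReal hsfin.ne]
        · rw [hs0 (by linarith), zero_mul,
            indicator_of_notMem fun h3 => absurd h3.2 (not_le.2 h2)]
    have hG := hren t ht
    rw [hconv, h.lintegral_ofReal_poissonWeight hq.le] at hG
    -- The right-hand side is finite, hence so is each summand; this is the absolute convergence of
    -- the integral.
    have hJtop : ∫⁻ s in Ioc 0 t, ENNReal.ofReal ((w (t - s)).toReal * levyTail a ν s) ≠ ∞ :=
      ne_top_of_le_ne_top ENNReal.ofReal_ne_top (hG ▸ le_add_self)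
    have hBtop : ENNReal.ofReal b * w t ≠ ∞ :=
      ne_top_of_le_ne_top ENNReal.ofReal_ne_top (hG ▸ le_self_add)
    have hm : Measurable fun s => (w (t - s)).toReal * levyTail a ν s :=
      ((hwm.comp (measurable_const.sub measurable_id)).ennreal_toReal).mul (measurable_levyTail a ν)
    have hnn : ∀ s, 0 ≤ (w (t - s)).toReal * levyTail a ν s := fun s =>
      mul_nonneg ENNReal.toReal_nonneg (levyTail_nonneg ha ν s)
    refine ⟨?_, ?_⟩
    · rw [intervalIntegrable_iff_integrableOn_Ioc_of_le ht.le]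
      refine ⟨hm.aestronglyMeasurable, ?_⟩
      rw [hasFiniteIntegral_iff_ofReal (ae_of_all _ hnn)]
      exact hJtop.lt_top
    · rw [intervalIntegral.integral_of_le ht.le, integral_eq_lintegral_of_nonneg_ae
        (ae_of_all _ hnn) hm.aestronglyMeasurable]
      have hG' := congrArg ENNReal.toReal hG
      rw [ENNReal.toReal_add hBtop hJtop, ENNReal.toReal_mul, ENNReal.toReal_ofReal hb,
        ENNReal.toReal_ofReal] at hG'
      · exact hG'
      · refine integral_nonneg_of_ae ?_
        filter_upwards [h.ae_inverse_nonneg t] with y hy using poissonWeight_nonneg hq.le k hy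

/-- The equation for the averages of the Poisson weights over the law of the inverse. -/
theorem convDeriv_integral_poissonWeight (h : IsLawPair (bernstein a b ν) κ l) (ha : 0 ≤ a)
    (hb : 0 ≤ b) (hν : IsLevyMeasure ν) (hI : ConditionI a ν)
    (hac : ∀ s, 0 < s → κ s ≪ volume) (hq : 0 < q) (k : ℕ) {p : ℝ → ℝ}
    (hp : ∀ t, 0 ≤ t → p t = ∫ y, poissonWeight q k y ∂(l t)) :
    ConvDifferentiable b (levyTail a ν) p ∧ ∀ t, 0 < t → convDeriv b (levyTail a ν) p t =
      -q * ((∫ y, poissonWeight q k y ∂(l t)) -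
        if k = 0 then 0 else ∫ y, poissonWeight q (k - 1) y ∂(l t)) := by
  obtain ⟨v, hv, hvU, hvc, hvr⟩ := h.exists_weightPotential_density ha hb hν hI hac hq k
  obtain ⟨v', hv', hvU', hvc', hvr'⟩ := h.exists_weightPotential_density ha hb hν hI hac hq (k - 1)
  -- The factor c switches off the preceding weight for k = 0, where k - 1 is 0 in ℕ.
  set c : ℝ := if k = 0 then 0 else 1 with hc
  have hite : ∀ x : ℝ, (if k = 0 then 0 else x) = c * x := by
    intro x
    by_cases hk : k = 0 <;> simp [hc, hk]
  have hsplit : ∀ t s, -q * (v (t - s) - c * v' (t - s)) * levyTail a ν s =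
      -q * (v (t - s) * levyTail a ν s) - -q * c * (v' (t - s) * levyTail a ν s) := by
    intro t s
    ring
  have hmain := convDifferentiable_of_integral (b := b) (n := levyTail a ν) (p := p)
    (v := fun s => -q * (v s - c * v' s))
    (fun T _ => ((hv.sub (hv'.const_mul c)).const_mul (-q)).intervalIntegrable)
    (fun t ht => ?_)
    (fun hb0 => continuousOn_const.mul ((hvc hb0).sub (continuousOn_const.mul (hvc' hb0))))
    (fun t ht => ?_)
  · refine ⟨hmain.1, fun t ht => ?_⟩
    rw [hmain.2 t ht, hite, ← (hvr t ht).2, ← (hvr' t ht).2]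
    simp only [hsplit]
    rw [intervalIntegral.integral_sub ((hvr t ht).1.const_mul _) ((hvr' t ht).1.const_mul _),
      intervalIntegral.integral_const_mul, intervalIntegral.integral_const_mul]
    ring
  · rcases ht.eq_or_lt with rfl | ht
    · simp
    rw [hp t ht.le, hp 0 le_rfl, h.integral_poissonWeight_inverse_zero,
      h.integral_poissonWeight_inverse hq k ht, hite, hvU t ht, hvU' t ht,
      intervalIntegral.integral_const_mul, intervalIntegral.integral_sub hv.intervalIntegrable
        (hv'.const_mul c).intervalIntegrable, intervalIntegral.integral_const_mul]
  · simp only [hsplit]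
    exact ((hvr t ht).1.const_mul _).sub ((hvr' t ht).1.const_mul _)

end IsLawPair

end InverseSubordinator

/-! ### From the processes to the kernels of their laws. -/

namespace InverseSubordinator

open Filter Topology

section Laws

set_option linter.unusedSectionVars false

variable {Ω : Type*} [MeasurableSpace Ω] {P : Measure Ω} [IsProbabilityMeasure P]
  {H : ℝ≥0 → Ω → ℝ≥0∞} {f : ℝ → ℝ}

/-- The law of `H y` on the finite values. -/
noncomputable def finiteLaw (H : ℝ≥0 → Ω → ℝ≥0∞) (P : Measure Ω) (y : ℝ) : Measure ℝ :=
  (P.restrict {ω | H y.toNNReal ω < ∞}).map fun ω => (H y.toNNReal ω).toReal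

lemma finiteLaw_apply (hH : IsSubordinator H P) (y : ℝ) {B : Set ℝ} (hB : MeasurableSet B) :
    finiteLaw H P y B = P {ω | H y.toNNReal ω < ∞ ∧ (H y.toNNReal ω).toReal ∈ B} := by
  have hm := hH.measurable y.toNNReal
  rw [finiteLaw, Measure.map_apply hm.ennreal_toReal hB,
    Measure.restrict_apply (hm.ennreal_toReal hB)]
  congr 1
  ext ω
  exact and_comm

instance isFiniteMeasure_finiteLaw (H : ℝ≥0 → Ω → ℝ≥0∞) (y : ℝ) :
    IsFiniteMeasure (finiteLaw H P y) := by
  unfold finiteLaw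
  infer_instance

/-- The convention e^{-x∞} = 0 is exactly the restriction to finite values, so killing only lowers
the total mass. -/
lemma laplace_finiteLaw (hH : IsSubordinator H P) (hf : HasLaplaceExponent H f P) {y x : ℝ}
    (hy : 0 ≤ y) (hx : 0 < x) :
    laplace (finiteLaw H P y) x = ENNReal.ofReal (Real.exp (-(y * f x))) := by
  have hm := hH.measurable y.toNNReal
  have h1 := hf y.toNNReal x hx
  rw [Real.coe_toNNReal y hy] at h1
  have hset : MeasurableSet {ω | H y.toNNReal ω < ∞} := hm measurableSet_Iio
  have hind : ∀ ω, (if H y.toNNReal ω = ∞ then 0 else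
      Real.exp (-(x * (H y.toNNReal ω).toReal))) = {ω | H y.toNNReal ω < ∞}.indicator
        (fun ω => Real.exp (-(x * (H y.toNNReal ω).toReal))) ω := by
    intro ω
    by_cases hω : H y.toNNReal ω = ∞
    · simp [hω]
    · simp [hω, lt_top_iff_ne_top]
  have hme : Measurable fun ω => Real.exp (-(x * (H y.toNNReal ω).toReal)) := by fun_prop
  simp only [hind] at h1
  rw [integral_indicator hset] at h1
  rw [laplace, finiteLaw, lintegral_map (by fun_prop) hm.ennreal_toReal, ← h1,
    ofReal_integral_eq_lintegral_ofReal]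
  · refine (integrable_const (1 : ℝ)).mono' hme.aestronglyMeasurable (ae_of_all _ fun ω => ?_)
    rw [Real.norm_eq_abs, abs_of_pos (Real.exp_pos _)]
    have := mul_nonneg hx.le (ENNReal.toReal_nonneg (a := H y.toNNReal ω))
    exact Real.exp_le_one_iff.2 (by linarith)
  · exact ae_of_all _ fun ω => (Real.exp_pos _).le

lemma finiteLaw_Iio_zero (hH : IsSubordinator H P) (y : ℝ) : finiteLaw H P y (Iio 0) = 0 := by
  rw [finiteLaw_apply hH y measurableSet_Iio]
  convert measure_empty (μ := P)
  ext ω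
  simp

/-- Paths increase almost surely, so y ↦ P{H(y) < ∞, H(y) ∈ B} is antitone, hence measurable, when B
is closed downwards in [0, ∞). The whole line is treated as well since the masses need not be 1. -/
lemma measurable_finiteLaw (hH : IsSubordinator H P) : Measurable (finiteLaw H P) := by
  have key : ∀ B : Set ℝ, MeasurableSet B → (∀ c d : ℝ, 0 ≤ c → c ≤ d → d ∈ B → c ∈ B) →
      Measurable fun y => finiteLaw H P y B := by
    intro B hB hdown
    refine Antitone.measurable fun y z hyz => ?_
    simp only [finiteLaw_apply hH _ hB]
    refine measure_mono_ae ?_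
    filter_upwards [hH.mono] with ω hω hz
    have hle := hω (Real.toNNReal_le_toNNReal hyz)
    exact ⟨hle.trans_lt hz.1, hdown _ _ ENNReal.toReal_nonneg
      (ENNReal.toReal_mono hz.1.ne hle) hz.2⟩
  refine Measurable.measure_of_isPiSystem (S := range Iic) (borel_eq_generateFrom_Iic ℝ ▸
    BorelSpace.measurable_eq) isPiSystem_Iic ?_ (key univ MeasurableSet.univ fun _ _ _ _ _ => trivial)
  rintro _ ⟨t, rfl⟩
  exact key _ measurableSet_Iic fun c d _ hcd hd => hcd.trans hd

/-- The laws of the subordinator on the finite values, as a kernel. -/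
noncomputable def finiteKernel (hH : IsSubordinator H P) : Kernel ℝ ℝ :=
  ⟨finiteLaw H P, measurable_finiteLaw hH⟩

instance (hH : IsSubordinator H P) : IsFiniteKernel (finiteKernel hH) :=
  ⟨1, ENNReal.one_lt_top, fun y => by
    change finiteLaw H P y univ ≤ 1
    rw [finiteLaw_apply hH y MeasurableSet.univ]
    exact prob_le_one⟩

/-- The subordinator exceeds every level almost surely. -/
lemma ae_exists_lt (hH : IsSubordinator H P) (hf : HasLaplaceExponent H f P) (hpos : 0 < f 1)
    (t : ℝ) : ∀ᵐ ω ∂P, ∃ s, ENNReal.ofReal t < H s ω := by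
  -- Chernoff's bound at time n: P{H(n) ≤ T} ≤ e^T e^{-n f(1)}. Here T = max t 0, since
  -- `ENNReal.ofReal` truncates negative t.
  have hbound : ∀ n : ℕ, P {ω | ∀ s, H s ω ≤ ENNReal.ofReal t} ≤
      ENNReal.ofReal (Real.exp (max t 0)) * ENNReal.ofReal (Real.exp (-(n * f 1))) := by
    intro n
    have h1 := laplace_finiteLaw hH hf (Nat.cast_nonneg n) one_pos
    have h2 : P {ω | ∀ s, H s ω ≤ ENNReal.ofReal t} ≤ finiteLaw H P n (Iic (max t 0)) := by
      rw [finiteLaw_apply hH _ measurableSet_Iic]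
      refine measure_mono fun ω hω => ?_
      have := hω ((n : ℝ).toNNReal)
      refine ⟨this.trans_lt ENNReal.ofReal_lt_top, ?_⟩
      have h3 := ENNReal.toReal_mono ENNReal.ofReal_ne_top this
      rwa [ENNReal.toReal_ofReal'] at h3
    refine h2.trans ?_
    rw [← h1, laplace, ← lintegral_const_mul _ (by fun_prop), ← lintegral_indicator_one
      measurableSet_Iic]
    refine lintegral_mono fun y => ?_
    by_cases hy : y ∈ Iic (max t 0)
    · rw [indicator_of_mem hy, ← ENNReal.ofReal_mul (Real.exp_pos _).le, ← Real.exp_add,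
        Pi.one_apply, ENNReal.one_le_ofReal, Real.one_le_exp_iff]
      linarith [mem_Iic.1 hy]
    · rw [indicator_of_notMem hy]
      exact zero_le
  have hlim : Tendsto (fun n : ℕ => ENNReal.ofReal (Real.exp (max t 0)) *
      ENNReal.ofReal (Real.exp (-(n * f 1)))) atTop (𝓝 0) := by
    have h1 : Tendsto (fun n : ℕ => ENNReal.ofReal (Real.exp (-((n : ℝ) * f 1)))) atTop (𝓝 0) := by
      have := Real.tendsto_exp_neg_atTop_nhds_zero.comp
        (tendsto_natCast_atTop_atTop.atTop_mul_const hpos)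
      simpa [Function.comp_def] using (ENNReal.continuous_ofReal.tendsto _).comp this
    simpa using ENNReal.Tendsto.const_mul h1 (Or.inr ENNReal.ofReal_ne_top)
  have h0 : P {ω | ∀ s, H s ω ≤ ENNReal.ofReal t} = 0 :=
    le_antisymm (ge_of_tendsto' hlim hbound) zero_le
  rw [ae_iff]
  simpa using h0

lemma inverse_le_of_lt {t : ℝ} {ω : Ω} {s : ℝ≥0} (h : ENNReal.ofReal t < H s ω) :
    inverse H t ω ≤ s := csInf_le (OrderBot.bddBelow _) h

/-- The event Y(t) < y agrees with the union of the events H(s) > t over a countable dense set of s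
< y. This holds only almost surely: it needs monotone paths, and an infimum over a nonempty set
because `sInf ∅ = 0` in ℝ≥0. -/
lemma aemeasurable_inverse (hH : IsSubordinator H P) (hf : HasLaplaceExponent H f P)
    (hpos : 0 < f 1) (t : ℝ) : AEMeasurable (inverse H t) P := by
  obtain ⟨D, hDc, hDd⟩ := TopologicalSpace.exists_countable_dense ℝ≥0
  refine NullMeasurable.aemeasurable (f := inverse H t) ?_
  refine @measurable_of_Iio ℝ≥0 (NullMeasurableSpace Ω P) _ _ _ _ _ _ _ _ fun y => ?_
  change NullMeasurableSet (inverse H t ⁻¹' Iio y) P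
  have hm : MeasurableSet (⋃ s ∈ D ∩ Iio y, {ω | ENNReal.ofReal t < H s ω}) :=
    MeasurableSet.biUnion (hDc.mono inter_subset_left) fun s _ =>
      hH.measurable s measurableSet_Ioi
  refine hm.nullMeasurableSet.congr ?_
  filter_upwards [hH.mono, ae_exists_lt hH hf hpos t] with ω hmono hex
  refine propext ⟨fun hω => ?_, fun hω => ?_⟩
  · obtain ⟨s, ⟨_, hsy⟩, hs⟩ := mem_iUnion₂.1 hω
    exact (inverse_le_of_lt hs).trans_lt hsy
  · obtain ⟨s, hs, hsy⟩ := exists_lt_of_csInf_lt hex hω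
    obtain ⟨d, hd, hsd, hdy⟩ := hDd.exists_between hsy
    exact mem_iUnion₂.2 ⟨d, ⟨hd, hdy⟩, lt_of_lt_of_le hs (hmono hsd.le)⟩

/-- The law of the inverse. -/
noncomputable def inverseLaw (H : ℝ≥0 → Ω → ℝ≥0∞) (P : Measure Ω) (t : ℝ) : Measure ℝ :=
  P.map fun ω => (inverse H t ω : ℝ)

lemma aemeasurable_coe_inverse (hH : IsSubordinator H P) (hf : HasLaplaceExponent H f P)
    (hpos : 0 < f 1) (t : ℝ) : AEMeasurable (fun ω => (inverse H t ω : ℝ)) P :=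
  measurable_coe_nnreal_real.comp_aemeasurable (aemeasurable_inverse hH hf hpos t)

lemma inverseLaw_Ioi (hH : IsSubordinator H P) (hf : HasLaplaceExponent H f P)
    (hpos : 0 < f 1) (t y : ℝ) : inverseLaw H P t (Ioi y) = P {ω | y < inverse H t ω} :=
  Measure.map_apply_of_aemeasurable (aemeasurable_coe_inverse hH hf hpos t) measurableSet_Ioi

lemma measurable_inverseLaw (hH : IsSubordinator H P) (hf : HasLaplaceExponent H f P)
    (hpos : 0 < f 1) : Measurable (inverseLaw H P) := by
  have hprob : ∀ t, IsProbabilityMeasure (inverseLaw H P t) := fun t =>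
    Measure.isProbabilityMeasure_map (aemeasurable_coe_inverse hH hf hpos t)
  refine Measurable.measure_of_isPiSystem_of_isProbabilityMeasure (S := range Ioi)
    (borel_eq_generateFrom_Ioi ℝ ▸ BorelSpace.measurable_eq) isPiSystem_Ioi ?_
  rintro _ ⟨y, rfl⟩
  refine Monotone.measurable fun s t hst => ?_
  simp only [inverseLaw_Ioi hH hf hpos]
  refine measure_mono_ae ?_
  filter_upwards [ae_exists_lt hH hf hpos t] with ω hex hω
  refine lt_of_lt_of_le hω (NNReal.coe_le_coe.2 ?_)
  exact csInf_le_csInf (OrderBot.bddBelow _) hex fun r hr =>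
    lt_of_le_of_lt (ENNReal.ofReal_le_ofReal hst) hr

/-- The laws of the inverse, as a kernel. -/
noncomputable def inverseKernel (hH : IsSubordinator H P) (hf : HasLaplaceExponent H f P)
    (hpos : 0 < f 1) : Kernel ℝ ℝ :=
  ⟨inverseLaw H P, measurable_inverseLaw hH hf hpos⟩

instance (hH : IsSubordinator H P) (hf : HasLaplaceExponent H f P) (hpos : 0 < f 1) :
    IsMarkovKernel (inverseKernel hH hf hpos) :=
  ⟨fun t => Measure.isProbabilityMeasure_map (aemeasurable_coe_inverse hH hf hpos t)⟩

/-- The subordinator has no fixed values. -/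
lemma ae_ne_ofReal (hH : IsSubordinator H P) (hac : ∀ s, 0 < s → finiteLaw H P s ≪ volume)
    {y : ℝ≥0} (hy : 0 < y) {t : ℝ} (ht : 0 ≤ t) : ∀ᵐ ω ∂P, H y ω ≠ ENNReal.ofReal t := by
  have h0 := hac y (by exact_mod_cast hy) (Real.volume_singleton (a := t))
  rw [finiteLaw_apply hH _ (measurableSet_singleton t), Real.toNNReal_coe] at h0
  rw [ae_iff]
  refine measure_mono_null (fun ω hω => ?_) h0
  have hω' : H y ω = ENNReal.ofReal t := by simpa using hω
  refine ⟨?_, ?_⟩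
  · rw [hω']
    exact ENNReal.ofReal_lt_top
  · rw [hω', ENNReal.toReal_ofReal ht]
    rfl

/-- The laws of a subordinator and of its inverse satisfy the analytic axioms. -/
theorem isLawPair (hH : IsSubordinator H P) (hf : HasLaplaceExponent H f P) (hpos : 0 < f 1)
    (hac : ∀ s, 0 < s → finiteLaw H P s ≪ volume) :
    IsLawPair f (finiteKernel hH) (inverseKernel hH hf hpos) where
  nonneg y _ := finiteLaw_Iio_zero hH y
  laplace_eq y hy x hx := laplace_finiteLaw hH hf hy hx
  inverse_nonneg t := by
    change inverseLaw H P t (Iio 0) = 0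
    rw [inverseLaw, Measure.map_apply_of_aemeasurable (aemeasurable_coe_inverse hH hf hpos t)
      measurableSet_Iio]
    convert measure_empty (μ := P)
    ext ω
    simp
  inverse_zero := by
    change inverseLaw H P 0 (Ioi 0) = 0
    rw [inverseLaw_Ioi hH hf hpos]
    -- Positivity of H at all times 1/(n + 1), due to the absence of atoms, forces Y(0) = 0.
    have h1 : ∀ᵐ ω ∂P, ∀ n : ℕ, H (1 / ((n : ℝ≥0) + 1)) ω ≠ ENNReal.ofReal 0 :=
      ae_all_iff.2 fun n => ae_ne_ofReal hH hac (by positivity) le_rfl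
    have h2 : ∀ᵐ ω ∂P, ¬ (0 : ℝ) < inverse H 0 ω := by
      filter_upwards [h1] with ω hω hlt
      obtain ⟨n, hn⟩ := exists_nat_one_div_lt hlt
      have h3 : ENNReal.ofReal 0 < H (1 / ((n : ℝ≥0) + 1)) ω := by
        refine lt_of_le_of_ne ?_ (hω n).symm
        simp
      have h4 := NNReal.coe_le_coe.2 (inverse_le_of_lt h3)
      push_cast at h4
      linarith
    rw [ae_iff] at h2
    simpa only [not_not] using h2
  passage t ht y hy := by
    change inverseLaw H P t (Ioi y) = finiteLaw H P y (Iic t)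
    lift y to ℝ≥0 using hy
    rw [inverseLaw_Ioi hH hf hpos, finiteLaw_apply hH _ measurableSet_Iic, Real.toNNReal_coe]
    -- Y(t) > y implies H(y) ≤ t, while the converse uses H(y) < t and right-continuity. The gap
    -- H(y) = t is a null event: for y = 0 since H(0) = 0 < t, otherwise by absolute continuity.
    have hne : ∀ᵐ ω ∂P, H y ω ≠ ENNReal.ofReal t := by
      rcases eq_or_ne y 0 with rfl | hy0
      · filter_upwards [hH.zero] with ω hω
        rw [hω]
        exact (ENNReal.ofReal_pos.2 ht).ne
      · exact ae_ne_ofReal hH hac (pos_iff_ne_zero.2 hy0) ht.le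
    refine measure_congr ?_
    filter_upwards [hH.mono, hH.right_cont, hne, ae_exists_lt hH hf hpos t] with ω hmono hrc hω hex
    refine propext ⟨fun h => ?_, fun h => ?_⟩
    · have h1 : H y ω ≤ ENNReal.ofReal t := by
        by_contra hlt
        exact absurd (NNReal.coe_le_coe.2 (inverse_le_of_lt (not_le.1 hlt))) (not_le.2 h)
      refine ⟨h1.trans_lt ENNReal.ofReal_lt_top, ?_⟩
      exact (ENNReal.toReal_mono ENNReal.ofReal_ne_top h1).trans_eq (ENNReal.toReal_ofReal ht.le)
    · have h1 : H y ω < ENNReal.ofReal t := by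
        refine lt_of_le_of_ne ?_ hω
        rw [← ENNReal.ofReal_toReal h.1.ne]
        exact ENNReal.ofReal_le_ofReal h.2
      have h2 : ∀ᶠ s in 𝓝[≥] y, H s ω < ENNReal.ofReal t := (hrc y).eventually (gt_mem_nhds h1)
      obtain ⟨z, hz, hzs⟩ := (mem_nhdsGE_iff_exists_Ico_subset).1 h2
      refine NNReal.coe_lt_coe.2 (lt_of_lt_of_le hz ?_)
      refine le_csInf hex fun s hs => ?_
      by_contra hsz
      rcases le_or_gt y s with hys | hys
      · have h3 : H s ω < ENNReal.ofReal t := hzs ⟨hys, not_le.1 hsz⟩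
        exact lt_asymm h3 hs
      · exact absurd ((hmono hys.le).trans_lt h1) (not_lt.2 (le_of_lt hs))

end Laws

end InverseSubordinator

/-! ### A Poisson process at an independent random time. -/

namespace InverseSubordinator

open Filter Topology

section RandomTime

set_option linter.unusedSectionVars false

variable {Ω : Type*} [MeasurableSpace Ω] {P : Measure Ω} [IsProbabilityMeasure P]
  {lam : ℝ≥0} {N : ℝ≥0 → Ω → ℕ} {X : Ω → ℝ≥0}

lemma IsPoissonProcess.measure_eq (hN : IsPoissonProcess N lam P) (s : ℝ≥0) (k : ℕ) :
    P (N s ⁻¹' {k}) = ENNReal.ofReal (poissonWeight lam k s) := by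
  have h1 := hN.increments_law 0 s
  have h2 : (fun ω => N (0 + s) ω - N 0 ω) =ᵐ[P] N s := by
    filter_upwards [hN.zero] with ω hω
    rw [hω, zero_add, Nat.sub_zero]
  rw [Measure.map_congr h2] at h1
  rw [← Measure.map_apply (hN.measurable s) (measurableSet_singleton k), h1,
    poissonMeasure_singleton, poissonWeight]
  push_cast
  rfl

lemma IsPoissonProcess.measurable_discrete (hN : IsPoissonProcess N lam P) (hX : Measurable X)
    {g : ℝ≥0 → ℕ} (hg : Measurable g) (c : ℕ → ℝ≥0) :
    Measurable fun ω => N (c (g (X ω))) ω := by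
  have h1 : Measurable fun p : ℕ × Ω => N (c p.1) p.2 :=
    measurable_from_prod_countable_right fun j => hN.measurable (c j)
  exact h1.comp ((hg.comp hX).prodMk measurable_id)

/-- With countably many possible times the event splits over the value of the time, and independence
factors each piece. -/
lemma IsPoissonProcess.measure_discrete_eq (hN : IsPoissonProcess N lam P) (hX : Measurable X)
    (hind : IndepFun (fun ω (s : ℝ≥0) => N s ω) X P) {g : ℝ≥0 → ℕ} (hg : Measurable g)
    (c : ℕ → ℝ≥0) (k : ℕ) :
    P ((fun ω => N (c (g (X ω))) ω) ⁻¹' {k}) =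
      ∫⁻ ω, ENNReal.ofReal (poissonWeight lam k (c (g (X ω)))) ∂P := by
  have hgX := hg.comp hX
  have h1 : (fun ω => N (c (g (X ω))) ω) ⁻¹' {k} =
      ⋃ j, (N (c j) ⁻¹' {k} ∩ (g ∘ X) ⁻¹' {j}) := by
    ext ω
    simp
  have h2 : ∫⁻ ω, ENNReal.ofReal (poissonWeight lam k (c (g (X ω)))) ∂P =
      ∫⁻ j, ENNReal.ofReal (poissonWeight lam k (c j)) ∂(P.map (g ∘ X)) :=
    (lintegral_map (f := fun j => ENNReal.ofReal (poissonWeight lam k (c j)))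
      Measurable.of_discrete hgX).symm
  rw [h2, lintegral_countable', h1, measure_iUnion]
  · refine tsum_congr fun j => ?_
    have h3 : IndepFun (N (c j)) (g ∘ X) P :=
      hind.comp (φ := fun p : ℝ≥0 → ℕ => p (c j)) (measurable_pi_apply (c j)) hg
    rw [h3.measure_inter_preimage_eq_mul _ _ (measurableSet_singleton k)
      (measurableSet_singleton j), hN.measure_eq,
      Measure.map_apply hgX (measurableSet_singleton j)]
  · intro i j hij
    refine Disjoint.mono inter_subset_right inter_subset_right ?_
    exact Disjoint.preimage _ (disjoint_singleton.2 hij)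
  · exact fun j => (hN.measurable _ (measurableSet_singleton k)).inter
      (hgX (measurableSet_singleton j))

/-- The approximation of `x` from the right with mesh `1 / (n + 1)`. -/
noncomputable def upperApprox (n : ℕ) (x : ℝ≥0) : ℝ≥0 :=
  ((⌊((n : ℝ≥0) + 1) * x⌋₊ : ℝ≥0) + 1) / (n + 1)

lemma lt_upperApprox (n : ℕ) (x : ℝ≥0) : x < upperApprox n x := by
  rw [upperApprox, lt_div_iff₀ (by positivity), mul_comm]
  exact Nat.lt_floor_add_one _

lemma upperApprox_le (n : ℕ) (x : ℝ≥0) : upperApprox n x ≤ x + 1 / (n + 1) := by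
  rw [upperApprox, add_div]
  gcongr
  rw [div_le_iff₀ (by positivity), mul_comm x]
  exact Nat.floor_le zero_le

lemma tendsto_upperApprox (x : ℝ≥0) :
    Tendsto (fun n => upperApprox n x) atTop (𝓝[≥] x) := by
  refine tendsto_nhdsWithin_iff.2 ⟨?_, Eventually.of_forall fun n => (lt_upperApprox n x).le⟩
  refine tendsto_of_tendsto_of_tendsto_of_le_of_le tendsto_const_nhds ?_
    (fun n => (lt_upperApprox n x).le) (fun n => upperApprox_le n x)
  simpa using tendsto_const_nhds.add (tendsto_one_div_add_atTop_nhds_zero_nat (𝕜 := ℝ≥0))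

/-- A Poisson process at an independent time. -/
theorem IsPoissonProcess.measure_comp_eq (hN : IsPoissonProcess N lam P) (hX : AEMeasurable X P)
    (hind : IndepFun (fun ω (s : ℝ≥0) => N s ω) X P) :
    AEMeasurable (fun ω => N (X ω) ω) P ∧ ∀ k, P.map (fun ω => N (X ω) ω) {k} =
      ∫⁻ ω, ENNReal.ofReal (poissonWeight lam k (X ω)) ∂P := by
  wlog hXm : Measurable X generalizing X
  · obtain ⟨h1, h2⟩ := this hX.measurable_mk.aemeasurable
      (hind.congr (Filter.EventuallyEq.refl _ _) hX.ae_eq_mk) hX.measurable_mk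
    have h3 : (fun ω => N (hX.mk X ω) ω) =ᵐ[P] fun ω => N (X ω) ω := by
      filter_upwards [hX.ae_eq_mk] with ω hω
      rw [hω]
    refine ⟨h1.congr h3, fun k => ?_⟩
    rw [← Measure.map_congr h3, h2]
    refine lintegral_congr_ae ?_
    filter_upwards [hX.ae_eq_mk] with ω hω
    rw [hω]
  have hg : ∀ n : ℕ, Measurable fun x : ℝ≥0 => ⌊((n : ℝ≥0) + 1) * x⌋₊ := fun n =>
    Nat.measurable_floor.comp (measurable_id.const_mul _)
  have hMm : ∀ n, Measurable fun ω => N (upperApprox n (X ω)) ω := fun n =>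
    hN.measurable_discrete hXm (hg n) fun j => ((j : ℝ≥0) + 1) / (n + 1)
  have hMeq : ∀ n k, P ((fun ω => N (upperApprox n (X ω)) ω) ⁻¹' {k}) =
      ∫⁻ ω, ENNReal.ofReal (poissonWeight lam k (upperApprox n (X ω))) ∂P := fun n k =>
    hN.measure_discrete_eq hXm hind (hg n) (fun j => ((j : ℝ≥0) + 1) / (n + 1)) k
  -- Paths are right-continuous, so the discretised times must approach X from above.
  have hlim : ∀ᵐ ω ∂P, Tendsto (fun n => N (upperApprox n (X ω)) ω) atTop (𝓝 (N (X ω) ω)) := by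
    filter_upwards [hN.right_cont] with ω hω
    exact (hω (X ω)).tendsto.comp (tendsto_upperApprox (X ω))
  have hM : AEMeasurable (fun ω => N (X ω) ω) P :=
    aemeasurable_of_tendsto_metrizable_ae atTop (fun n => (hMm n).aemeasurable) hlim
  have happ : ∀ n, Measurable (upperApprox n) := fun n => by
    have : Measurable fun j : ℕ => ((j : ℝ≥0) + 1) / (n + 1) := Measurable.of_discrete
    exact this.comp (hg n)
  refine ⟨hM, fun k => ?_⟩
  have hφ : ∀ {M : Ω → ℕ}, AEMeasurable M P →
      ∫⁻ ω, ({k} : Set ℕ).indicator 1 (M ω) ∂P = P.map M {k} := fun hM => by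
    rw [← lintegral_map' (f := ({k} : Set ℕ).indicator 1)
      Measurable.of_discrete.aemeasurable hM, lintegral_indicator_one (measurableSet_singleton k)]
  have h1 : Tendsto (fun n => P ((fun ω => N (upperApprox n (X ω)) ω) ⁻¹' {k})) atTop
      (𝓝 (P.map (fun ω => N (X ω) ω) {k})) := by
    have : ∀ n, P ((fun ω => N (upperApprox n (X ω)) ω) ⁻¹' {k}) =
        ∫⁻ ω, ({k} : Set ℕ).indicator 1 (N (upperApprox n (X ω)) ω) ∂P := fun n => by
      rw [hφ (hMm n).aemeasurable, Measure.map_apply (hMm n) (measurableSet_singleton k)]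
    simp only [this, ← hφ hM]
    refine tendsto_lintegral_of_dominated_convergence' 1 (fun n => ?_) (fun n => ?_) (by simp) ?_
    · exact ((Measurable.of_discrete (f := ({k} : Set ℕ).indicator 1)).comp (hMm n)).aemeasurable
    · exact ae_of_all _ fun ω => indicator_le_self _ _ _
    · filter_upwards [hlim] with ω hω
      exact (continuous_of_discreteTopology.tendsto _).comp hω
  have h2 : Tendsto (fun n => ∫⁻ ω, ENNReal.ofReal (poissonWeight lam k (upperApprox n (X ω))) ∂P)
      atTop (𝓝 (∫⁻ ω, ENNReal.ofReal (poissonWeight lam k (X ω)) ∂P)) := by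
    refine tendsto_lintegral_of_dominated_convergence' 1 (fun n => ?_) (fun n => ?_) (by simp) ?_
    · have := (happ n).comp hXm
      simp only [Function.comp_def] at this
      fun_prop
    · exact ae_of_all _ fun ω => ENNReal.ofReal_le_one.2
        (poissonWeight_le_one lam.coe_nonneg k (NNReal.coe_nonneg _))
    · refine ae_of_all _ fun ω => ?_
      have hc : Continuous fun x : ℝ≥0 => ENNReal.ofReal (poissonWeight lam k x) :=
        ENNReal.continuous_ofReal.comp (by fun_prop)
      exact (hc.tendsto _).comp ((tendsto_upperApprox (X ω)).mono_right nhdsWithin_le_nhds)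
  simp only [hMeq] at h1
  exact tendsto_nhds_unique h1 h2

end RandomTime

end InverseSubordinator

/-! ### Marginals, generating function and Laplace transform of the density. -/

namespace InverseSubordinator

open Filter Topology

section Marginals

variable {Ω : Type*} [MeasurableSpace Ω] {P : Measure Ω} [IsProbabilityMeasure P]
  {H : ℝ≥0 → Ω → ℝ≥0∞} {f : ℝ → ℝ} {lam : ℝ≥0} {N : ℝ≥0 → Ω → ℕ}

lemma ae_inverseLaw_nonneg (hH : IsSubordinator H P) (hf : HasLaplaceExponent H f P)
    (hpos : 0 < f 1) (t : ℝ) : ∀ᵐ y ∂(inverseLaw H P t), 0 ≤ y := by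
  rw [inverseLaw, ae_map_iff (aemeasurable_coe_inverse hH hf hpos t) measurableSet_Ici]
  exact ae_of_all _ fun ω => NNReal.coe_nonneg _

/-- The law of a Poisson process at the inverse subordinator. -/
lemma map_comp_inverse (hH : IsSubordinator H P) (hf : HasLaplaceExponent H f P)
    (hpos : 0 < f 1) (hN : IsPoissonProcess N lam P)
    (hind : IndepFun (fun ω (s : ℝ≥0) => N s ω) (fun ω (t : ℝ) => inverse H t ω) P) (t : ℝ) :
    AEMeasurable (fun ω => N (inverse H t ω) ω) P ∧ ∀ k,
      (P.map fun ω => N (inverse H t ω) ω).real {k} =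
        ∫ y, poissonWeight lam k y ∂(inverseLaw H P t) := by
  have hX := aemeasurable_inverse hH hf hpos t
  obtain ⟨h1, h2⟩ := hN.measure_comp_eq hX
    (hind.comp (φ := id) (ψ := fun p : ℝ → ℝ≥0 => p t) measurable_id (measurable_pi_apply t))
  refine ⟨h1, fun k => ?_⟩
  rw [measureReal_def, h2, inverseLaw, integral_map (aemeasurable_coe_inverse hH hf hpos t)
    (by fun_prop), integral_eq_lintegral_of_nonneg_ae]
  · exact ae_of_all _ fun ω => poissonWeight_nonneg lam.coe_nonneg k (NNReal.coe_nonneg _)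
  · have := aemeasurable_coe_inverse hH hf hpos t
    exact ((continuous_poissonWeight lam k).measurable.comp_aemeasurable
      this).aestronglyMeasurable

lemma prob_eq_integral (hH : IsSubordinator H P) (hf : HasLaplaceExponent H f P)
    (hpos : 0 < f 1) (hN : IsPoissonProcess N lam P)
    (hind : IndepFun (fun ω (s : ℝ≥0) => N s ω) (fun ω (t : ℝ) => inverse H t ω) P)
    (k : ℕ) (t : ℝ) :
    prob N H P k t = ∫ y, poissonWeight lam k y ∂(inverseLaw H P t) := by
  obtain ⟨h1, h2⟩ := map_comp_inverse hH hf hpos hN hind t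
  rw [← h2, map_measureReal_apply_of_aemeasurable h1 (measurableSet_singleton k)]
  rfl

/-- The Poisson generating function e^{-qy(1-u)} is itself a weight of order 0 at rate q(1-u). This
puts the generating function under the equation already proved for k = 0. -/
lemma hasSum_poissonWeight_mul_pow (q u y : ℝ) :
    HasSum (fun k => poissonWeight q k y * u ^ k) (poissonWeight (q * (1 - u)) 0 y) := by
  have h1 := NormedSpace.expSeries_div_hasSum_exp (q * y * u)
  rw [← Real.exp_eq_exp_ℝ] at h1
  have h2 := h1.mul_left (Real.exp (-(q * y)))
  rw [← Real.exp_add] at h2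
  have h3 : (fun k => poissonWeight q k y * u ^ k) =
      fun k => Real.exp (-(q * y)) * ((q * y * u) ^ k / k.factorial) := by
    ext k
    rw [poissonWeight, mul_pow _ u]
    ring
  have h4 : poissonWeight (q * (1 - u)) 0 y = Real.exp (-(q * y) + q * y * u) := by
    simp only [poissonWeight, pow_zero, Nat.factorial_zero, Nat.cast_one, div_one, mul_one]
    ring_nf
  rw [h3, h4]
  exact h2

lemma pgf_eq_integral (hH : IsSubordinator H P) (hf : HasLaplaceExponent H f P)
    (hpos : 0 < f 1) (hN : IsPoissonProcess N lam P)
    (hind : IndepFun (fun ω (s : ℝ≥0) => N s ω) (fun ω (t : ℝ) => inverse H t ω) P)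
    {u : ℝ} (hu : |u| < 1) (t : ℝ) :
    pgf N H P u t = ∫ y, poissonWeight (lam * (1 - u)) 0 y ∂(inverseLaw H P t) := by
  obtain ⟨h1, h2⟩ := map_comp_inverse hH hf hpos hN hind t
  have hprob : IsProbabilityMeasure (inverseLaw H P t) :=
    Measure.isProbabilityMeasure_map (aemeasurable_coe_inverse hH hf hpos t)
  have hprob' := Measure.isProbabilityMeasure_map h1
  have hle : ∀ (k : ℕ), ‖u ^ k‖ ≤ |u| ^ k := fun k => by simp
  have hint : Integrable (fun k : ℕ => u ^ k) (P.map fun ω => N (inverse H t ω) ω) :=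
    (integrable_const (1 : ℝ)).mono' (by fun_prop) (ae_of_all _ fun k =>
      (hle k).trans (pow_le_one₀ (abs_nonneg u) hu.le))
  have h3 : pgf N H P u t = ∑' k, (∫ y, poissonWeight lam k y ∂(inverseLaw H P t)) * u ^ k := by
    rw [pgf, ← integral_map (f := fun k : ℕ => u ^ k) h1 (by fun_prop), integral_countable hint]
    refine tsum_congr fun k => ?_
    rw [h2, smul_eq_mul]
  -- Domination by the geometric series of |u|^k justifies exchanging sum and expectation.
  have hwle : ∀ k, ∀ᵐ y ∂(inverseLaw H P t), ‖poissonWeight lam k y * u ^ k‖ ≤ |u| ^ k := by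
    intro k
    filter_upwards [ae_inverseLaw_nonneg hH hf hpos t] with y hy
    rw [norm_mul, Real.norm_eq_abs, abs_of_nonneg (poissonWeight_nonneg lam.coe_nonneg k hy)]
    exact (mul_le_of_le_one_left (norm_nonneg _)
      (poissonWeight_le_one lam.coe_nonneg k hy)).trans (hle k)
  have hwint : ∀ k, Integrable (fun y => poissonWeight lam k y * u ^ k) (inverseLaw H P t) :=
    fun k => (integrable_const (|u| ^ k)).mono' (by fun_prop) (hwle k)
  have h4 := hasSum_integral_of_summable_integral_norm hwint
    (Summable.of_nonneg_of_le (fun k => integral_nonneg fun y => norm_nonneg _)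
      (fun k => (integral_mono_ae (hwint k).norm (integrable_const _) (hwle k)).trans_eq (by simp))
      (summable_geometric_of_lt_one (abs_nonneg u) hu))
  rw [h3]
  simp only [integral_mul_const, (hasSum_poissonWeight_mul_pow _ _ _).tsum_eq] at h4
  exact h4.tsum_eq

end Marginals

section Density

variable {Ω : Type*} [MeasurableSpace Ω] {P : Measure Ω} [IsProbabilityMeasure P]
  {H : ℝ≥0 → Ω → ℝ≥0∞} {f : ℝ → ℝ} {t : ℝ}

/-- The law charges only (0, ∞), so the half-line integral is the full expectation. Smoothness and
derivatives in q are then inherited from the moment generating function. -/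
lemma densityLaplace_eq_mgf (hpdf : HasPDF (fun ω => (inverse H t ω : ℝ)) P volume)
    (h0 : inverseLaw H P t (Iic 0) = 0) (q : ℝ) :
    densityLaplace H P t q = mgf id (inverseLaw H P t) (-q) := by
  have hg : Measurable ((Ioi (0 : ℝ)).indicator fun x => Real.exp (-(q * x))) :=
    (by fun_prop : Measurable fun x : ℝ => Real.exp (-(q * x))).indicator measurableSet_Ioi
  have h1 : ∫ x, (pdf (fun ω => (inverse H t ω : ℝ)) P volume x).toReal •
      (Ioi (0 : ℝ)).indicator (fun x => Real.exp (-(q * x))) x =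
        ∫ ω, (Ioi (0 : ℝ)).indicator (fun x => Real.exp (-(q * x))) (inverse H t ω : ℝ) ∂P :=
    pdf.integral_pdf_smul hg.aestronglyMeasurable
  have hm : AEMeasurable (fun ω => (inverse H t ω : ℝ)) P := hpdf.aemeasurable
  have h2 : ∀ᵐ ω ∂P, (0 : ℝ) < inverse H t ω := by
    rw [inverseLaw, Measure.map_apply_of_aemeasurable hm measurableSet_Iic] at h0
    rw [ae_iff]
    simp only [not_lt]
    exact h0
  rw [densityLaplace, ← integral_indicator measurableSet_Ioi]
  have h3 : ∀ x, (Ioi (0 : ℝ)).indicator (fun x => Real.exp (-(q * x)) * density H P t x) x =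
      (pdf (fun ω => (inverse H t ω : ℝ)) P volume x).toReal •
        (Ioi (0 : ℝ)).indicator (fun x => Real.exp (-(q * x))) x := by
    intro x
    by_cases hx : x ∈ Ioi (0 : ℝ)
    · rw [indicator_of_mem hx, indicator_of_mem hx, smul_eq_mul, mul_comm]
      rfl
    · rw [indicator_of_notMem hx, indicator_of_notMem hx, smul_zero]
  simp only [h3]
  rw [h1, mgf, inverseLaw, integral_map hm (by fun_prop)]
  refine integral_congr_ae ?_
  filter_upwards [h2] with ω hω
  rw [indicator_of_mem (by exact hω)]
  simp

lemma contDiffOn_densityLaplace (hpdf : HasPDF (fun ω => (inverse H t ω : ℝ)) P volume)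
    (h0 : inverseLaw H P t (Iic 0) = 0) :
    ContDiffOn ℝ (⊤ : ℕ∞) (densityLaplace H P t) (Ioi 0) := by
  have hfin : IsFiniteMeasure (inverseLaw H P t) := by
    unfold inverseLaw
    infer_instance
  have h1 : densityLaplace H P t = fun q => mgf id (inverseLaw H P t) (-q) :=
    funext fun q => densityLaplace_eq_mgf hpdf h0 q
  rw [h1]
  have h2 : ContDiffOn ℝ (⊤ : ℕ∞) (mgf id (inverseLaw H P t))
      (interior (integrableExpSet id (inverseLaw H P t))) :=
    analyticOnNhd_mgf.analyticOn.contDiffOn isOpen_interior.uniqueDiffOn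
  exact h2.comp contDiff_neg.contDiffOn fun q hq =>
    neg_mem_interior_integrableExpSet (measure_mono_null Iio_subset_Iic_self h0) hq

lemma integral_poissonWeight_eq_iteratedDeriv
    (hpdf : HasPDF (fun ω => (inverse H t ω : ℝ)) P volume)
    (h0 : inverseLaw H P t (Iic 0) = 0) {q : ℝ} (hq : 0 < q) (k : ℕ) :
    ∫ y, poissonWeight q k y ∂(inverseLaw H P t) =
      (-q) ^ k / (k.factorial : ℝ) * iteratedDeriv k (densityLaplace H P t) q := by
  have hfin : IsFiniteMeasure (inverseLaw H P t) := by
    unfold inverseLaw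
    infer_instance
  have h1 : densityLaplace H P t = fun q => mgf id (inverseLaw H P t) (-q) :=
    funext fun q => densityLaplace_eq_mgf hpdf h0 q
  rw [h1, iteratedDeriv_comp_neg, iteratedDeriv_mgf
    (neg_mem_interior_integrableExpSet (measure_mono_null Iio_subset_Iic_self h0) hq),
    smul_eq_mul, ← mul_assoc, ← integral_const_mul]
  refine integral_congr_ae (ae_of_all _ fun y => ?_)
  -- One sign comes from the prefactor, the other from evaluating the moment generating function at
  -- -q; they cancel.
  have h2 : (-q) ^ k * (-1) ^ k = q ^ k := by
    rw [← mul_pow]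
    simp
  simp only [poissonWeight, id_eq, neg_mul]
  rw [mul_pow, div_mul_eq_mul_div, h2]
  ring

end Density

end InverseSubordinator

/-! ### The main theorem. -/

theorem mainTheorem3 {Ω : Type*} [MeasurableSpace Ω] (P : Measure Ω) [IsProbabilityMeasure P]
    (a b : ℝ) (ha : 0 ≤ a) (hb : 0 ≤ b) (ν : Measure ℝ)
    (hν : InverseSubordinator.IsLevyMeasure ν) (hI : InverseSubordinator.ConditionI a ν)
    (H : ℝ≥0 → Ω → ℝ≥0∞) (hH : InverseSubordinator.IsSubordinator H P)
    (hf : InverseSubordinator.HasLaplaceExponent H (InverseSubordinator.bernstein a b ν) P)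
    (lam : ℝ≥0) (hlam : 0 < lam)
    (N : ℝ≥0 → Ω → ℕ) (hN : InverseSubordinator.IsPoissonProcess N lam P)
    (hind : IndepFun (fun ω (s : ℝ≥0) => N s ω)
      (fun ω (t : ℝ) => InverseSubordinator.inverse H t ω) P) :
    -- for `t > 0` the inverse subordinator has a density
    (∀ t : ℝ, 0 < t →
      HasPDF (fun ω => (InverseSubordinator.inverse H t ω : ℝ)) P volume) ∧
    -- the equation for the marginal probabilities
    (∀ k : ℕ,
      InverseSubordinator.ConvDifferentiable b (InverseSubordinator.levyTail a ν)
        (InverseSubordinator.prob N H P k) ∧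
      (∀ t : ℝ, 0 < t →
        InverseSubordinator.convDeriv b (InverseSubordinator.levyTail a ν)
          (InverseSubordinator.prob N H P k) t =
        -(lam : ℝ) * (InverseSubordinator.prob N H P k t -
          if k = 0 then 0 else InverseSubordinator.prob N H P (k - 1) t)) ∧
      InverseSubordinator.prob N H P k 0 = if k = 0 then 1 else 0) ∧
    -- the marginal probabilities through the Laplace transform of the density
    (∀ t : ℝ, 0 < t →
      ContDiffOn ℝ (⊤ : ℕ∞) (InverseSubordinator.densityLaplace H P t) (Ioi 0) ∧
      ∀ k : ℕ, InverseSubordinator.prob N H P k t =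
        (-(lam : ℝ)) ^ k / (k.factorial : ℝ) *
          iteratedDeriv k (InverseSubordinator.densityLaplace H P t) lam) ∧
    -- the probability generating function
    (∀ u : ℝ, |u| < 1 →
      (∀ t : ℝ, 0 < t → InverseSubordinator.pgf N H P u t =
        InverseSubordinator.densityLaplace H P t (lam * (1 - u))) ∧
      InverseSubordinator.ConvDifferentiable b (InverseSubordinator.levyTail a ν)
        (InverseSubordinator.pgf N H P u) ∧
      (∀ t : ℝ, 0 < t →
        InverseSubordinator.convDeriv b (InverseSubordinator.levyTail a ν)
          (InverseSubordinator.pgf N H P u) t =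
        -((lam : ℝ) * (1 - u)) * InverseSubordinator.pgf N H P u t) ∧
      InverseSubordinator.pgf N H P u 0 = 1) := by
  have hpos : 0 < InverseSubordinator.bernstein a b ν 1 := hν.bernstein_pos ha hb hI.infinite one_pos
  have hac : ∀ s, 0 < s → InverseSubordinator.finiteLaw H P s ≪ volume := fun s hs =>
    InverseSubordinator.absolutelyContinuous_of_laplace ha hb hν hI hs (InverseSubordinator.finiteLaw_Iio_zero hH s)
      fun x hx => InverseSubordinator.laplace_finiteLaw hH hf hs.le hx
  have hpair := InverseSubordinator.isLawPair hH hf hpos hac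
  have h0 : ∀ t, 0 < t → InverseSubordinator.inverseLaw H P t (Iic 0) = 0 := fun t ht => hpair.inverse_Iic_zero ht
  have hpdf : ∀ t : ℝ, 0 < t → HasPDF (fun ω => (InverseSubordinator.inverse H t ω : ℝ)) P volume := fun t ht =>
    ⟨InverseSubordinator.aemeasurable_coe_inverse hH hf hpos t, inferInstance,
      hpair.inverse_absolutelyContinuous
        (fun x hx => hν.bernstein_pos ha hb hI.infinite hx) hac ht⟩
  have hprob := InverseSubordinator.prob_eq_integral hH hf hpos hN hind
  have hzero : ∀ q k, ∫ y, InverseSubordinator.poissonWeight q k y ∂(InverseSubordinator.inverseLaw H P 0) = InverseSubordinator.poissonWeight q k 0 :=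
    fun q k => hpair.integral_poissonWeight_inverse_zero q k
  have hlam' : (0 : ℝ) < lam := hlam
  refine ⟨hpdf, fun k => ?_, fun t ht => ⟨InverseSubordinator.contDiffOn_densityLaplace (hpdf t ht) (h0 t ht),
    fun k => ?_⟩, fun u hu => ?_⟩
  · obtain ⟨h1, h2⟩ := hpair.convDeriv_integral_poissonWeight ha hb hν hI hac hlam' k
      (p := InverseSubordinator.prob N H P k) fun t _ => hprob k t
    refine ⟨h1, fun t ht => ?_, ?_⟩
    · rw [h2 t ht, hprob k t, hprob (k - 1) t]
      rfl
    · rw [hprob, hzero]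
      rcases k with _ | k <;> simp [InverseSubordinator.poissonWeight]
  · rw [hprob, InverseSubordinator.integral_poissonWeight_eq_iteratedDeriv (hpdf t ht) (h0 t ht) hlam']
  -- The generating function is the case k = 0 with rate λ(1 - u), which is positive because u < 1.
  · have hq : 0 < (lam : ℝ) * (1 - u) := mul_pos hlam' (by linarith [(abs_lt.1 hu).2])
    have hpgf := InverseSubordinator.pgf_eq_integral hH hf hpos hN hind hu
    obtain ⟨h1, h2⟩ := hpair.convDeriv_integral_poissonWeight ha hb hν hI hac hq 0
      (p := InverseSubordinator.pgf N H P u) fun t _ => hpgf t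
    refine ⟨fun t ht => ?_, h1, fun t ht => ?_, ?_⟩
    · rw [hpgf, InverseSubordinator.integral_poissonWeight_eq_iteratedDeriv (hpdf t ht) (h0 t ht) hq]
      simp
    · rw [h2 t ht, hpgf t, if_pos rfl, sub_zero]
      rfl
    · rw [hpgf, hzero]
      simp [InverseSubordinator.poissonWeight]
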